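/- **Theorem (Schläfli formula for convex polyhedra).** Let $m\ge 2$, and let $M$ be an $(m+1)$-dimensional Riemannian space form (a complete connected manifold of constant curvature $K$, i.e. the quotient of the sphere, Euclidean space or hyperbolic space of curvature $K$ by a group of isometries acting freely and properly discontinuously), with scalar curvature $S$. A compact convex polyhedron in $M$ is the image, under the universal covering of $M$, of a compact intersection with nonempty interior of finitely many closed half-spaces of the universal cover, on which the covering is injective; the half-spaces are taken irredundant, so that each one contributes a facet. Let $(P_t)_{t\in I}$, with $I\subset\mathbb R$ a nondegenerate interval, be a deformation of compact convex polyhedra in $M$: the half-spaces bounding (the lift of) $P_t$ depend on $t$ in a $C^1$ way, and all the $P_t$ have the same combinatorics. Let $V(t)$ be the volume of $P_t$; for each codimension 2 face $i$ let $W_i(t)$ be its $(m-1)$-dimensional volume and $\theta_i(t)$ the interior dihedral angle of $P_t$ at this face, that is, $\pi$ minus the angle between the outward unit normals of the two facets that meet there. Then for every $t\in I$ the volumes $V(t)$ and $W_i(t)$ are finite, the functions $V$ and $\theta_i$ are differentiable at $t$ (one-sidedly if $t$ is an endpoint of $I$), and $$\frac{S}{m+1}\,V'(t)=\sum_i W_i(t)\,\theta_i'(t),$$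 where the sum is over the codimension 2 faces of $P_t$. -/

import Mathlib

open scoped ENNReal

noncomputable section

namespace SpaceForms

/-! ## The simply connected model space of dimension `n` and constant curvature `K` -/

/-- The linear space `ℝ × ℝⁿ` that contains the model space. Only its topology and its linear
structure are used; lengths are measured with `metricForm`. -/
abbrev Ambient (n : ℕ) : Type := ℝ × EuclideanSpace ℝ (Fin n)

/-- The complete simply connected space of constant curvature `K` (for `n ≥ 2`), as the quadric
`x₀² + K |x'|² = 1` of `ℝ × ℝⁿ`: a sphere for `K > 0`, the affine hyperplane `x₀ = 1` for
`K = 0`, the upper sheet of a hyperboloid for `K < 0`. -/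
def modelSet (K : ℝ) (n : ℕ) : Set (Ambient n) :=
  {x | x.1 ^ 2 + K * ‖x.2‖ ^ 2 = 1 ∧ (K ≤ 0 → 0 < x.1)}

/-- The model space as a type. -/
abbrev Model (K : ℝ) (n : ℕ) : Type := modelSet K n

/-- Tangent vectors of the model space at `x`: the kernel of the differential of the equation. -/
def IsTangent (K : ℝ) {n : ℕ} (x v : Ambient n) : Prop :=
  x.1 * v.1 + K * inner ℝ x.2 v.2 = 0

/-- The Riemannian metric of the model space is the restriction to the tangent spaces of the form
`dx₀² / K + |dx'|²`. For `K = 0` tangent vectors have `v₀ = 0` and this reads `|dx'|²`, which is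
also what Lean's `a / 0 = 0` gives. -/
def metricForm (K : ℝ) {n : ℕ} (v w : Ambient n) : ℝ :=
  v.1 * w.1 / K + inner ℝ v.2 w.2

/-! ## Scalar curvature -/

/-- The partial derivative `∂ᵢ f (u)`. -/
def partialDeriv {n : ℕ} (i : Fin n) (f : EuclideanSpace ℝ (Fin n) → ℝ)
    (u : EuclideanSpace ℝ (Fin n)) : ℝ :=
  fderiv ℝ f u (EuclideanSpace.single i 1)

/-- The Christoffel symbol `Γᵏᵢⱼ` of a metric `g` given in coordinates. -/
def christoffel {n : ℕ} (g : EuclideanSpace ℝ (Fin n) → Matrix (Fin n) (Fin n) ℝ)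
    (k i j : Fin n) (u : EuclideanSpace ℝ (Fin n)) : ℝ :=
  (1 / 2) * ∑ l, (g u)⁻¹ k l *
    (partialDeriv i (fun w => g w j l) u + partialDeriv j (fun w => g w i l) u
      - partialDeriv l (fun w => g w i j) u)

/-- The Ricci tensor `Ricᵢⱼ` of a metric given in coordinates. -/
def ricci {n : ℕ} (g : EuclideanSpace ℝ (Fin n) → Matrix (Fin n) (Fin n) ℝ)
    (i j : Fin n) (u : EuclideanSpace ℝ (Fin n)) : ℝ :=
  ∑ k, (partialDeriv k (christoffel g k i j) u - partialDeriv j (christoffel g k i k) u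
    + ∑ l, (christoffel g k k l u * christoffel g l i j u
      - christoffel g k j l u * christoffel g l i k u))

/-- The scalar curvature of a metric given in coordinates. -/
def scalarCurvature {n : ℕ} (g : EuclideanSpace ℝ (Fin n) → Matrix (Fin n) (Fin n) ℝ)
    (u : EuclideanSpace ℝ (Fin n)) : ℝ :=
  ∑ i, ∑ j, (g u)⁻¹ i j * ricci g i j u

/-- The parametrization `u ↦ (√(1 - K |u|²), u)` of the part `x₀ > 0` of the model space. -/
def chart (K : ℝ) (n : ℕ) (u : EuclideanSpace ℝ (Fin n)) : Ambient n :=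
  (Real.sqrt (1 - K * ‖u‖ ^ 2), u)

/-- The metric of the model space in these coordinates. -/
def chartMetric (K : ℝ) (n : ℕ) (u : EuclideanSpace ℝ (Fin n)) : Matrix (Fin n) (Fin n) ℝ :=
  Matrix.of fun i j =>
    metricForm K (fderiv ℝ (chart K n) u (EuclideanSpace.single i 1))
      (fderiv ℝ (chart K n) u (EuclideanSpace.single j 1))

/-- The `n`-dimensional space forms of curvature `K` have scalar curvature `S`. (They are locally
isometric to the part `x₀ > 0` of the model space.) -/
def HasScalarCurvature (K : ℝ) (n : ℕ) (S : ℝ) : Prop :=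
  ∀ u : EuclideanSpace ℝ (Fin n), 0 < 1 - K * ‖u‖ ^ 2 → scalarCurvature (chartMetric K n) u = S

/-! ## Space forms -/

/-- `Γ` is a group of isometries of the model space which acts freely and properly
discontinuously, i.e. the quotient is a (Hausdorff) manifold covered by the model space. -/
structure IsSpaceFormGroup (K : ℝ) {n : ℕ} (Γ : Subgroup (Ambient n ≃L[ℝ] Ambient n)) :
    Prop where
  mapsTo : ∀ γ ∈ Γ, ∀ x ∈ modelSet K n, γ x ∈ modelSet K n
  isometry : ∀ γ ∈ Γ, ∀ x ∈ modelSet K n, ∀ v w : Ambient n, IsTangent K x v → IsTangent K x w →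
    metricForm K (γ v) (γ w) = metricForm K v w
  wandering : ∀ x ∈ modelSet K n, ∃ U : Set (Ambient n), IsOpen U ∧ x ∈ U ∧
    ∀ γ ∈ Γ, γ ≠ 1 → ∀ y ∈ U ∩ modelSet K n, γ y ∉ U
  separated : ∀ x ∈ modelSet K n, ∀ y ∈ modelSet K n, (∀ γ ∈ Γ, γ x ≠ y) →
    ∃ U V : Set (Ambient n), IsOpen U ∧ IsOpen V ∧ x ∈ U ∧ y ∈ V ∧
      ∀ γ ∈ Γ, ∀ z ∈ U ∩ modelSet K n, γ z ∉ V

/-- Two points of the model space are identified if an element of `Γ` maps one to the other. -/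
def orbitSetoid (K : ℝ) {n : ℕ} (Γ : Subgroup (Ambient n ≃L[ℝ] Ambient n)) :
    Setoid (Model K n) where
  r x y := ∃ γ ∈ Γ, γ (x : Ambient n) = y
  iseqv :=
    { refl := fun _ => ⟨1, Γ.one_mem, rfl⟩
      symm := by
        rintro x y ⟨γ, hγ, h⟩
        refine ⟨γ⁻¹, Γ.inv_mem hγ, ?_⟩
        rw [← h]
        exact γ.symm_apply_apply _
      trans := by
        rintro x y z ⟨γ, hγ, h⟩ ⟨δ, hδ, h'⟩
        refine ⟨δ * γ, Γ.mul_mem hδ hγ, ?_⟩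
        rw [← h', ← h]
        rfl }

/-- The space form `M = (model space) / Γ`. -/
def SpaceForm (K : ℝ) {n : ℕ} (Γ : Subgroup (Ambient n ≃L[ℝ] Ambient n)) : Type :=
  Quotient (orbitSetoid K Γ)

/-- The universal covering `model space → M`. -/
def proj (K : ℝ) {n : ℕ} (Γ : Subgroup (Ambient n ≃L[ℝ] Ambient n)) (x : Model K n) :
    SpaceForm K Γ :=
  Quotient.mk (orbitSetoid K Γ) x

/-! ## Riemannian `k`-volume -/

/-- A countable family of differentiable parametrizations, by measurable subsets `U j` of `ℝᵏ`, of
pieces of the subset `A` of the space form `M`, no point of `A` being hit twice. Each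
parametrization is given by a lift `ψ j` to the model space; `ψ' j` is its derivative. -/
structure IsParametrization (K : ℝ) {n : ℕ} (Γ : Subgroup (Ambient n ≃L[ℝ] Ambient n)) (k : ℕ)
    (A : Set (SpaceForm K Γ)) (U : ℕ → Set (EuclideanSpace ℝ (Fin k)))
    (ψ : ℕ → EuclideanSpace ℝ (Fin k) → Model K n)
    (ψ' : ℕ → EuclideanSpace ℝ (Fin k) → EuclideanSpace ℝ (Fin k) →L[ℝ] Ambient n) : Prop where
  measurable : ∀ j, MeasurableSet (U j)
  hasFDerivWithinAt : ∀ j, ∀ u ∈ U j,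
    HasFDerivWithinAt (fun w => (ψ j w : Ambient n)) (ψ' j u) (U j) u
  mapsTo : ∀ j, ∀ u ∈ U j, proj K Γ (ψ j u) ∈ A
  injective : ∀ i j, ∀ u ∈ U i, ∀ w ∈ U j,
    proj K Γ (ψ i u) = proj K Γ (ψ j w) → i = j ∧ u = w

/-- The Gram matrix of the metric pulled back by the linear map `L`. -/
def gram (K : ℝ) {n k : ℕ} (L : EuclideanSpace ℝ (Fin k) →L[ℝ] Ambient n) :
    Matrix (Fin k) (Fin k) ℝ :=
  Matrix.of fun a b =>
    metricForm K (L (EuclideanSpace.single a 1)) (L (EuclideanSpace.single b 1))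

/-- The `k`-dimensional Riemannian volume of a subset `A` of the space form: the integral of
`√(det g)` in parameters, over parametrized pieces that exhaust `A` (the supremum over all
families of disjoint pieces). For `k = 0` it is the number of points. -/
def riemannianVolume (K : ℝ) {n : ℕ} (Γ : Subgroup (Ambient n ≃L[ℝ] Ambient n)) (k : ℕ)
    (A : Set (SpaceForm K Γ)) : ℝ≥0∞ :=
  ⨆ (U : ℕ → Set (EuclideanSpace ℝ (Fin k))) (ψ : ℕ → EuclideanSpace ℝ (Fin k) → Model K n)
    (ψ' : ℕ → EuclideanSpace ℝ (Fin k) → EuclideanSpace ℝ (Fin k) →L[ℝ] Ambient n)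
    (_ : IsParametrization K Γ k A U ψ ψ'),
    ∑' j, ∫⁻ u in U j, ENNReal.ofReal (Real.sqrt (gram K (ψ' j u)).det)

/-! ## Half-spaces and convex polyhedra -/

/-- The linear function on `ℝ × ℝⁿ` with coefficients `a`. -/
def pairing {n : ℕ} (a x : Ambient n) : ℝ := a.1 * x.1 + inner ℝ a.2 x.2

/-- The gradient, for the metric of the model space, of the linear function with coefficients `a`,
along its zero set: the outward normal of the half-space `pairing a ≤ 0`. -/
def normal (K : ℝ) {n : ℕ} (a : Ambient n) : Ambient n := (K * a.1, a.2)

theorem normal_isTangent (K : ℝ) {n : ℕ} (a x : Ambient n) (h : pairing a x = 0) :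
    IsTangent K x (normal K a) := by
  unfold pairing at h
  change x.1 * (K * a.1) + K * inner ℝ x.2 a.2 = 0
  rw [real_inner_comm]
  linear_combination K * h

theorem metricForm_normal (K : ℝ) {n : ℕ} (a x v : Ambient n) (hx : x ∈ modelSet K n)
    (hv : IsTangent K x v) : metricForm K (normal K a) v = pairing a v := by
  unfold metricForm normal pairing
  rcases eq_or_ne K 0 with rfl | hK
  · have h1 : 0 < x.1 := hx.2 le_rfl
    have h2 : v.1 = 0 := by
      have h3 : x.1 * v.1 = 0 := by simpa [IsTangent] using hv
      rcases mul_eq_zero.mp h3 with h | h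
      · exact absurd h h1.ne'
      · exact h
    simp [h2]
  · field_simp

/-- The intersection, in the model space, of the half-spaces `pairing (ν i) ≤ 0`. -/
def polyhedron (K : ℝ) {n N : ℕ} (ν : Fin N → Ambient n) : Set (Model K n) :=
  {x | ∀ i, pairing (ν i) x ≤ 0}

/-- The facet (codimension 1 face) of the polyhedron in the `i`-th hyperplane. -/
def facet (K : ℝ) {n N : ℕ} (ν : Fin N → Ambient n) (i : Fin N) : Set (Model K n) :=
  {x | x ∈ polyhedron K ν ∧ pairing (ν i) x = 0}

/-- The half-spaces `pairing (ν i) ≤ 0` define a compact convex polyhedron with nonempty interior,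
each of them contributing a facet, which projects injectively to the space form. Each half-space is
described by its unit conormal. -/
structure IsConvexPolyhedron (K : ℝ) {n N : ℕ} (Γ : Subgroup (Ambient n ≃L[ℝ] Ambient n))
    (ν : Fin N → Ambient n) : Prop where
  unit : ∀ i, metricForm K (normal K (ν i)) (normal K (ν i)) = 1
  compact : IsCompact (polyhedron K ν)
  interior : ∃ x : Model K n, ∀ i, pairing (ν i) x < 0
  /-- The facet `i` has a point that is on no other bounding hyperplane: the half-spaces are
  irredundant and the facets are distinct, of codimension 1. -/
  facets : ∀ i, ∃ x ∈ polyhedron K ν, ∀ j, pairing (ν j) x = 0 ↔ j = i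
  embedded : Set.InjOn (proj K Γ) (polyhedron K ν)

/-- The combinatorial type of the polyhedron, with labelled facets: each (open) face is recorded as
the set of the facets that contain it. -/
def combinatorialType (K : ℝ) {n N : ℕ} (ν : Fin N → Ambient n) : Set (Set (Fin N)) :=
  {s | ∃ x ∈ polyhedron K ν, s = {i | pairing (ν i) x = 0}}

/-- The dimension of `F` (of the smallest totally geodesic subspace that contains `F`) is `d`. -/
def HasDim (K : ℝ) {n : ℕ} (F : Set (Model K n)) (d : ℕ) : Prop :=
  Module.finrank ℝ (Submodule.span ℝ ((fun x : Model K n => (x : Ambient n)) '' F)) = d + 1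

/-- The codimension 2 faces, each one as the pair `i < j` of the two facets whose intersection it
is. -/
def codimTwoFaces (K : ℝ) {n N : ℕ} (ν : Fin N → Ambient n) : Finset (Fin N × Fin N) :=
  open Classical in
  Finset.univ.filter fun p =>
    p.1 < p.2 ∧ ∃ d, d + 2 = n ∧ HasDim K (facet K ν p.1 ∩ facet K ν p.2) d

/-- The (interior) dihedral angle between the facets `i` and `j`: `π` minus the angle between the
outward unit normals. -/
def dihedralAngle (K : ℝ) {n N : ℕ} (ν : Fin N → Ambient n) (i j : Fin N) : ℝ :=
  Real.pi - Real.arccos (metricForm K (normal K (ν i)) (normal K (ν j)))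

/-- The polyhedron seen in the space form. -/
def body (K : ℝ) {n N : ℕ} (Γ : Subgroup (Ambient n ≃L[ℝ] Ambient n)) (ν : Fin N → Ambient n) :
    Set (SpaceForm K Γ) :=
  proj K Γ '' polyhedron K ν

/-- The intersection of the facets `i` and `j`, seen in the space form. -/
def ridge (K : ℝ) {n N : ℕ} (Γ : Subgroup (Ambient n ≃L[ℝ] Ambient n)) (ν : Fin N → Ambient n)
    (i j : Fin N) : Set (SpaceForm K Γ) :=
  proj K Γ '' (facet K ν i ∩ facet K ν j)

/-- A one-parameter family, parametrized by `I`, of convex polyhedra of the same combinatorial type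
in the space form; the bounding half-spaces depend on the parameter in a `C¹` way. -/
structure IsDeformation (K : ℝ) {n N : ℕ} (Γ : Subgroup (Ambient n ≃L[ℝ] Ambient n)) (I : Set ℝ)
    (ν : ℝ → Fin N → Ambient n) : Prop where
  contDiffOn : ∀ i, ContDiffOn ℝ 1 (fun t => ν t i) I
  isConvexPolyhedron : ∀ t ∈ I, IsConvexPolyhedron K Γ (ν t)
  combinatorialType_eq : ∀ s ∈ I, ∀ t ∈ I,
    combinatorialType K (ν s) = combinatorialType K (ν t)

end SpaceForms

end

/-!
Write `n = m + 1 = k + 2`. The model space is the quadric `quad K = 1` in the linear space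
`Ambient n`, for every sign of `K`, so a polyhedron and its faces are the sections of the polyhedral
cone `polyCone ν` and of its faces. The proof takes place in these cones, and treats all curvatures
at once.

*Volumes.* The volume form of a totally geodesic piece of the model space is, up to a constant `κ`,
the Euclidean volume spanned by the tangent vectors and the position vector (`sqrt_det_gram`,
`sqrt_det_gram_codimTwo`). Hence the integral of a function of `quad K` over the cone over the piece
is `κ` times a Lebesgue integral, and equals the Riemannian volume of the piece times a radial
integral (`IsConeOver.riemannianVolume_mul`). The upper bound, for arbitrary parametrizations, is
the area formula applied to the countably many lifts under the deck group; the lower bound comes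
from central projection. Let `g = weight` be a radial cutoff, and use `-2 g' = weightD` for the
polyhedron and `g` for the faces of codimension two. Then the volume `V` is a constant multiple of
`coneVol K ν = ∫_{polyCone ν} weightD (quad K y) dy`.

*First variation.* The indicator function of the cone is replaced by a product of smooth cutoffs
`cut (⟨νᵢ, y⟩ / ε)`. The smoothed integrals are differentiated under the integral sign. A linear
change of variables that straightens one facet shows that the derivatives converge as `ε → 0`,
locally uniformly in the half-spaces (`exists_tendsto_smoothVolDeriv`), so `coneVol` is
differentiable and its derivative is the limit (`exists_hasFDerivAt_coneVol`).

*Integration by parts.* Let `δ` be the velocity of the half-spaces. Since the conormals are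
normalized, the constant vector field `normal K (δ i)` is tangent to the hyperplane `i`. Its
derivative of `g (quad K y)` is `2 K ⟨δ i, y⟩ g'`, which is, up to the factor `-K`, the integrand of
the variation on the facet `i`. Integration by parts moves the derivative to the cutoffs of the
other facets, and what remains is concentrated on the intersections of two facets, with coefficients
`⟨νⱼ, normal K (δ i)⟩` (`mul_sum_integral_smoothVolDeriv`).

*Limit.* The integrals over the intersection of the facets `i` and `j` converge to a constant times
`Wᵢⱼ / sin θᵢⱼ` if the facets meet in a face of codimension two, and to zero otherwise
(`IsConvexPolyhedron.tendsto_integral_faceDensity_of_hasDim`,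
`IsConvexPolyhedron.tendsto_integral_faceDensity_of_not_hasDim`). The two terms of a face add up to
the derivative of `⟨νᵢ, normal K νⱼ⟩ = - cos θᵢⱼ`, that is, to `sin θᵢⱼ θᵢⱼ'`.

The two radial integrals differ by the factor `m`, and the scalar curvature is `(m + 1) m K`
(`HasScalarCurvature.eq`), which gives the constant in the formula.
-/

noncomputable section

namespace SpaceForms

open MeasureTheory Set Filter Topology

/-! ### Scalar curvature of the model space -/

theorem hasFDerivAt_chart (K : ℝ) {n : ℕ} {u : EuclideanSpace ℝ (Fin n)}
    (hu : 0 < 1 - K * ‖u‖ ^ 2) :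
    HasFDerivAt (chart K n)
      (((-(K / Real.sqrt (1 - K * ‖u‖ ^ 2))) • innerSL ℝ u).prod
        (ContinuousLinearMap.id ℝ _)) u := by
  have h1 : HasFDerivAt (fun w : EuclideanSpace ℝ (Fin n) => 1 - K * ‖w‖ ^ 2)
      (-(K • (2 • innerSL ℝ u))) u :=
    (((hasStrictFDerivAt_norm_sq u).hasFDerivAt).const_mul K).const_sub 1
  have h2 := h1.sqrt hu.ne'
  refine HasFDerivAt.prodMk (h2.congr_fderiv ?_) (hasFDerivAt_id u)
  ext v
  simp
  field_simp

theorem chartMetric_apply (K : ℝ) {n : ℕ} {u : EuclideanSpace ℝ (Fin n)}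
    (hu : 0 < 1 - K * ‖u‖ ^ 2) (i j : Fin n) :
    chartMetric K n u i j = K * u i * u j / (1 - K * ‖u‖ ^ 2) + if i = j then 1 else 0 := by
  have hs := Real.sq_sqrt hu.le
  have hs' := Real.sqrt_pos.2 hu
  simp only [chartMetric, Matrix.of_apply, (hasFDerivAt_chart K hu).fderiv, metricForm,
    ContinuousLinearMap.prod_apply]
  simp only [_root_.smul_apply, innerSL_apply_apply, EuclideanSpace.inner_single_right,
    ContinuousLinearMap.id_apply]
  congr 1
  · set r := Real.sqrt (1 - K * ‖u‖ ^ 2)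
    rw [← hs]
    rcases eq_or_ne K 0 with rfl | hK
    · simp
    · simp
      field_simp
  · simp [eq_comm]

theorem chartMetric_inv_apply (K : ℝ) {n : ℕ} {u : EuclideanSpace ℝ (Fin n)}
    (hu : 0 < 1 - K * ‖u‖ ^ 2) (i j : Fin n) :
    (chartMetric K n u)⁻¹ i j = (if i = j then 1 else 0) - K * u i * u j := by
  have h : (chartMetric K n u)⁻¹ =
      Matrix.of fun i j => (if i = j then 1 else 0) - K * u i * u j := by
    refine Matrix.inv_eq_right_inv ?_
    ext i j
    simp only [Matrix.mul_apply, chartMetric_apply K hu, Matrix.of_apply, Matrix.one_apply]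
    have hn : ‖u‖ ^ 2 = ∑ k, u k * u k := by
      rw [EuclideanSpace.norm_sq_eq]; simp [sq]
    have : ∀ k, (K * u i * u k / (1 - K * ‖u‖ ^ 2) + if i = k then 1 else 0) *
        ((if k = j then 1 else 0) - K * u k * u j) =
        (if k = j then K * u i * u k / (1 - K * ‖u‖ ^ 2) else 0)
        + (if i = k then (if k = j then 1 else 0) - K * u k * u j else 0)
        - (K * u i / (1 - K * ‖u‖ ^ 2)) * (K * u j) * (u k * u k) := by
      intro k
      split_ifs <;> ring
    simp only [this, Finset.sum_sub_distrib, Finset.sum_add_distrib, Finset.sum_ite_eq',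
      Finset.sum_ite_eq, Finset.mem_univ, if_true, ← Finset.mul_sum, ← hn]
    split_ifs <;> field_simp <;> ring
  rw [h, Matrix.of_apply]

theorem isOpen_chartDomain (K : ℝ) (n : ℕ) :
    IsOpen {u : EuclideanSpace ℝ (Fin n) | 0 < 1 - K * ‖u‖ ^ 2} :=
  isOpen_lt continuous_const (by fun_prop)

theorem hasFDerivAt_coord {n : ℕ} (i : Fin n) (u : EuclideanSpace ℝ (Fin n)) :
    HasFDerivAt (fun w : EuclideanSpace ℝ (Fin n) => w i) (EuclideanSpace.proj (𝕜 := ℝ) i) u :=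
  (EuclideanSpace.proj (𝕜 := ℝ) i).hasFDerivAt

theorem hasFDerivAt_chartMetric (K : ℝ) {n : ℕ} {u : EuclideanSpace ℝ (Fin n)}
    (hu : 0 < 1 - K * ‖u‖ ^ 2) (i j : Fin n) :
    HasFDerivAt (fun w => chartMetric K n w i j)
      ((K / (1 - K * ‖u‖ ^ 2)) • (u i • EuclideanSpace.proj (𝕜 := ℝ) j
          + u j • EuclideanSpace.proj (𝕜 := ℝ) i)
        + (2 * K ^ 2 * u i * u j / (1 - K * ‖u‖ ^ 2) ^ 2) • innerSL ℝ u) u := by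
  have h0 : (fun w => chartMetric K n w i j) =ᶠ[nhds u] fun w =>
      K * (w i * w j) * (1 - K * ‖w‖ ^ 2)⁻¹ + if i = j then 1 else 0 := by
    filter_upwards [(isOpen_chartDomain K n).mem_nhds hu] with w hw
    rw [chartMetric_apply K hw, div_eq_mul_inv, mul_assoc K]
  refine HasFDerivAt.congr_of_eventuallyEq ?_ h0
  have h1 : HasFDerivAt (fun w : EuclideanSpace ℝ (Fin n) => 1 - K * ‖w‖ ^ 2)
      (-(K • (2 • innerSL ℝ u))) u :=
    (((hasStrictFDerivAt_norm_sq u).hasFDerivAt).const_mul K).const_sub 1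
  have h2 := ((hasDerivAt_inv hu.ne').comp_hasFDerivAt u h1)
  refine ((((((hasFDerivAt_coord i u).mul (hasFDerivAt_coord j u)).const_mul K).mul h2)).add_const
    _).congr_fderiv ?_
  ext v
  simp
  field_simp
  ring

theorem partialDeriv_chartMetric (K : ℝ) {n : ℕ} {u : EuclideanSpace ℝ (Fin n)}
    (hu : 0 < 1 - K * ‖u‖ ^ 2) (l i j : Fin n) :
    partialDeriv l (fun w => chartMetric K n w i j) u =
      K / (1 - K * ‖u‖ ^ 2) * (u i * (if j = l then 1 else 0) + u j * (if i = l then 1 else 0))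
        + 2 * K ^ 2 * u i * u j * u l / (1 - K * ‖u‖ ^ 2) ^ 2 := by
  rw [partialDeriv, (hasFDerivAt_chartMetric K hu i j).fderiv]
  simp only [_root_.add_apply, _root_.smul_apply, innerSL_apply_apply,
    EuclideanSpace.inner_single_right, PiLp.proj_apply, PiLp.single_apply, smul_eq_mul]
  simp only [conj_trivial]
  ring

/-- In the chart, the second fundamental form of the quadric gives `Γᵏᵢⱼ = K uₖ gᵢⱼ`. -/
theorem christoffel_chartMetric (K : ℝ) {n : ℕ} {u : EuclideanSpace ℝ (Fin n)}
    (hu : 0 < 1 - K * ‖u‖ ^ 2) (k i j : Fin n) :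
    christoffel (chartMetric K n) k i j u = K * u k * chartMetric K n u i j := by
  have hn : ‖u‖ ^ 2 = ∑ k, u k * u k := by
    rw [EuclideanSpace.norm_sq_eq]; simp [sq]
  rw [christoffel, chartMetric_apply K hu]
  have key : ∀ l, (chartMetric K n u)⁻¹ k l *
      (partialDeriv i (fun w => chartMetric K n w j l) u
        + partialDeriv j (fun w => chartMetric K n w i l) u
        - partialDeriv l (fun w => chartMetric K n w i j) u) =
      (if k = l then u l * (2 * K / (1 - K * ‖u‖ ^ 2) * (if i = j then 1 else 0)
        + 2 * K ^ 2 * u i * u j / (1 - K * ‖u‖ ^ 2) ^ 2) else 0)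
      - K * u k * (2 * K / (1 - K * ‖u‖ ^ 2) * (if i = j then 1 else 0)
        + 2 * K ^ 2 * u i * u j / (1 - K * ‖u‖ ^ 2) ^ 2) * (u l * u l) := by
    intro l
    rw [chartMetric_inv_apply K hu, partialDeriv_chartMetric K hu, partialDeriv_chartMetric K hu,
      partialDeriv_chartMetric K hu]
    have e1 : (if j = i then (1 : ℝ) else 0) = if i = j then 1 else 0 := by simp [eq_comm]
    have e2 : (if l = i then (1 : ℝ) else 0) = if i = l then 1 else 0 := by simp [eq_comm]
    have e3 : (if l = j then (1 : ℝ) else 0) = if j = l then 1 else 0 := by simp [eq_comm]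
    rw [e1, e2, e3]
    generalize (if i = j then (1 : ℝ) else 0) = a
    generalize (if i = l then (1 : ℝ) else 0) = b
    generalize (if j = l then (1 : ℝ) else 0) = c
    split_ifs <;> ring
  simp only [key, Finset.sum_sub_distrib, Finset.sum_ite_eq, Finset.mem_univ, if_true,
    ← Finset.mul_sum, ← hn]
  generalize (if i = j then (1 : ℝ) else 0) = a
  field_simp
  ring

theorem partialDeriv_christoffel_zero (K : ℝ) {n : ℕ} (l k i j : Fin n) :
    partialDeriv l (christoffel (chartMetric K n) k i j) 0 =
      K * (if k = l then 1 else 0) * (if i = j then 1 else 0) := by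
  have h0 : (0 : ℝ) < 1 - K * ‖(0 : EuclideanSpace ℝ (Fin n))‖ ^ 2 := by simp
  have h1 : christoffel (chartMetric K n) k i j =ᶠ[nhds 0]
      fun u => K * u k * chartMetric K n u i j := by
    filter_upwards [(isOpen_chartDomain K n).mem_nhds h0] with w hw
    exact christoffel_chartMetric K hw k i j
  have h2 : HasFDerivAt (fun u => K * u k * chartMetric K n u i j) _ 0 :=
    ((hasFDerivAt_coord k 0).const_mul K).mul (hasFDerivAt_chartMetric K h0 i j)
  rw [partialDeriv, h1.fderiv_eq, h2.fderiv, chartMetric_apply K h0]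
  by_cases h : i = j <;> simp [h]

/-- The model space of curvature `K` and dimension `n` has scalar curvature `n (n - 1) K`. It is
enough to compute it at the centre of the chart. -/
theorem HasScalarCurvature.eq {K : ℝ} {n : ℕ} {S : ℝ} (h : HasScalarCurvature K n S) :
    S = n * (n - 1) * K := by
  have h0 : (0 : ℝ) < 1 - K * ‖(0 : EuclideanSpace ℝ (Fin n))‖ ^ 2 := by simp
  rw [← h 0 h0, scalarCurvature]
  have hr : ∀ i j, ricci (chartMetric K n) i j 0 = (n - 1) * K * if i = j then 1 else 0 := by
    intro i j
    simp only [ricci, partialDeriv_christoffel_zero, christoffel_chartMetric K h0]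
    simp
    split_ifs <;> ring
  simp only [hr, chartMetric_inv_apply K h0]
  simp
  ring

/-! ### The quadratic form of the model space -/

/-- The bilinear form `x₀ v₀ + K ⟨x', v'⟩` whose unit quadric is the model space. -/
def form (K : ℝ) {n : ℕ} (x v : Ambient n) : ℝ := x.1 * v.1 + K * inner ℝ x.2 v.2

/-- The quadratic form `x₀² + K |x'|²` whose unit quadric is the model space. -/
def quad (K : ℝ) {n : ℕ} (x : Ambient n) : ℝ := x.1 ^ 2 + K * ‖x.2‖ ^ 2

theorem form_comm (K : ℝ) {n : ℕ} (x v : Ambient n) : form K x v = form K v x := by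
  simp only [form, real_inner_comm]; ring

theorem isTangent_iff {K : ℝ} {n : ℕ} {x v : Ambient n} : IsTangent K x v ↔ form K x v = 0 :=
  Iff.rfl

theorem form_normal (K : ℝ) {n : ℕ} (a y : Ambient n) :
    form K (normal K a) y = K * pairing a y := by
  simp only [form, normal, pairing]; ring

theorem quad_smul (K : ℝ) {n : ℕ} (r : ℝ) (x : Ambient n) : quad K (r • x) = r ^ 2 * quad K x := by
  simp only [quad, Prod.smul_fst, Prod.smul_snd, norm_smul, smul_eq_mul, mul_pow, Real.norm_eq_abs,
    sq_abs]
  ring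

theorem continuous_quad (K : ℝ) (n : ℕ) : Continuous (quad K : Ambient n → ℝ) := by
  unfold quad; fun_prop

theorem hasFDerivAt_quad (K : ℝ) {n : ℕ} (x : Ambient n) :
    HasFDerivAt (quad K) ((2 * x.1) • ContinuousLinearMap.fst ℝ ℝ (EuclideanSpace ℝ (Fin n)) +
      (2 * K) • (innerSL ℝ x.2).comp
        (ContinuousLinearMap.snd ℝ ℝ (EuclideanSpace ℝ (Fin n)))) x := by
  have h1 : HasFDerivAt (fun y : Ambient n => y.1) (ContinuousLinearMap.fst ℝ ℝ _) x :=
    hasFDerivAt_fst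
  have h2 : HasFDerivAt (fun y : Ambient n => y.2) (ContinuousLinearMap.snd ℝ ℝ _) x :=
    hasFDerivAt_snd
  refine ((h1.pow 2).add ((h2.norm_sq).const_mul K)).congr_fderiv ?_
  ext v <;> simp
  ring

theorem fderiv_quad_apply (K : ℝ) {n : ℕ} (x v : Ambient n) :
    fderiv ℝ (quad K) x v = 2 * form K x v := by
  rw [(hasFDerivAt_quad K x).fderiv]
  simp [form]
  ring

theorem quad_eq_one {K : ℝ} {n : ℕ} {x : Ambient n} (hx : x ∈ modelSet K n) : quad K x = 1 := hx.1

/-- The linear function `pairing a` as a continuous linear map. -/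
def pairingL {n : ℕ} (a : Ambient n) : Ambient n →L[ℝ] ℝ :=
  a.1 • ContinuousLinearMap.fst ℝ ℝ _ + (innerSL ℝ a.2).comp (ContinuousLinearMap.snd ℝ ℝ _)

@[simp]
theorem pairingL_apply {n : ℕ} (a x : Ambient n) : pairingL a x = pairing a x := by
  simp [pairingL, pairing]

theorem pairing_comm {n : ℕ} (a x : Ambient n) : pairing a x = pairing x a := by
  simp only [pairing, real_inner_comm]; ring

theorem pairing_smul {n : ℕ} (a x : Ambient n) (r : ℝ) : pairing a (r • x) = r * pairing a x := by
  rw [← pairingL_apply, map_smul, pairingL_apply, smul_eq_mul]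

theorem pairing_add {n : ℕ} (a x y : Ambient n) :
    pairing a (x + y) = pairing a x + pairing a y := by
  simp only [← pairingL_apply, map_add]

theorem add_pairing {n : ℕ} (a b x : Ambient n) :
    pairing (a + b) x = pairing a x + pairing b x := by
  simp only [pairing_comm _ x, pairing_add]

theorem smul_pairing {n : ℕ} (a x : Ambient n) (r : ℝ) : pairing (r • a) x = r * pairing a x := by
  simp only [pairing_comm _ x, pairing_smul]

theorem pairing_self_pos {n : ℕ} {a : Ambient n} (ha : a ≠ 0) : 0 < pairing a a := by
  simp only [pairing, real_inner_self_eq_norm_sq]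
  by_cases h : a.1 = 0
  · have h2 : a.2 ≠ 0 := fun h2 => ha (Prod.ext h h2)
    have : 0 < ‖a.2‖ := norm_pos_iff.2 h2
    rw [h]; positivity
  · have : 0 < a.1 * a.1 := mul_self_pos.2 h
    positivity

theorem continuous_pairing {n : ℕ} :
    Continuous fun p : Ambient n × Ambient n => pairing p.1 p.2 := by
  unfold pairing; fun_prop

/-- The metric between two conormals, without division by `K`. -/
theorem metricForm_normal_normal (K : ℝ) {n : ℕ} (a b : Ambient n) :
    metricForm K (normal K a) (normal K b) = pairing a (normal K b) := by
  simp only [metricForm, normal, pairing]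
  rcases eq_or_ne K 0 with rfl | hK
  · simp
  · field_simp

theorem pairing_normal_comm (K : ℝ) {n : ℕ} (a b : Ambient n) :
    pairing a (normal K b) = pairing b (normal K a) := by
  simp only [normal, pairing, real_inner_comm]; ring

/-- The metric is positive definite on the tangent spaces of the model space. -/
theorem metricForm_self_pos {K : ℝ} {n : ℕ} {x v : Ambient n} (hx : x ∈ modelSet K n)
    (hv : IsTangent K x v) (hv0 : v ≠ 0) : 0 < metricForm K v v := by
  have hx1 := hx.1
  have hx2 := hx.2
  unfold IsTangent at hv
  simp only [metricForm, real_inner_self_eq_norm_sq]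
  rcases lt_trichotomy K 0 with hK | rfl | hK
  · have hx0 := hx2 hK.le
    -- Cauchy-Schwarz bounds the negative part `v₀² / K`
    have hcs : inner ℝ x.2 v.2 ^ 2 ≤ ‖x.2‖ ^ 2 * ‖v.2‖ ^ 2 := by
      rw [← mul_pow, ← sq_abs]
      exact pow_le_pow_left₀ (abs_nonneg _) (abs_real_inner_le_norm _ _) 2
    have e1 : x.1 ^ 2 * (v.1 * v.1) = K ^ 2 * inner ℝ x.2 v.2 ^ 2 := by
      have : x.1 * v.1 = - (K * inner ℝ x.2 v.2) := by linarith
      calc x.1 ^ 2 * (v.1 * v.1) = (x.1 * v.1) ^ 2 := by ring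
        _ = _ := by rw [this]; ring
    have e2 : x.1 ^ 2 * (v.1 * v.1 / K + ‖v.2‖ ^ 2) ≥ ‖v.2‖ ^ 2 := by
      have : x.1 ^ 2 * (v.1 * v.1 / K) = K * inner ℝ x.2 v.2 ^ 2 := by
        rw [← mul_div_assoc, e1]; field_simp
      rw [mul_add, this]
      have h3 : K * inner ℝ x.2 v.2 ^ 2 ≥ K * (‖x.2‖ ^ 2 * ‖v.2‖ ^ 2) :=
        mul_le_mul_of_nonpos_left hcs hK.le
      have h4 : x.1 ^ 2 = 1 - K * ‖x.2‖ ^ 2 := by linarith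
      rw [h4]; nlinarith
    have h2 : v.2 ≠ 0 := by
      intro h2
      apply hv0
      rw [h2, inner_zero_right, mul_zero, add_zero] at hv
      exact Prod.ext ((mul_eq_zero.1 hv).resolve_left hx0.ne') h2
    have : 0 < ‖v.2‖ ^ 2 := by have := norm_pos_iff.2 h2; positivity
    have h5 : 0 < x.1 ^ 2 * (v.1 * v.1 / K + ‖v.2‖ ^ 2) := lt_of_lt_of_le this e2
    exact (pos_iff_pos_of_mul_pos h5).1 (by positivity)
  · have hx0 := hx2 le_rfl
    have h1 : v.1 = 0 := by
      have h3 : x.1 * v.1 = 0 := by simpa using hv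
      exact (mul_eq_zero.1 h3).resolve_left hx0.ne'
    have h2 : v.2 ≠ 0 := fun h2 => hv0 (Prod.ext h1 h2)
    have := norm_pos_iff.2 h2
    rw [h1]; simp; positivity
  · by_cases h1 : v.1 = 0
    · have h2 : v.2 ≠ 0 := fun h2 => hv0 (Prod.ext h1 h2)
      have := norm_pos_iff.2 h2
      rw [h1]; simp; positivity
    · have : 0 < v.1 * v.1 := mul_self_pos.2 h1
      positivity

/-- Two different hyperplanes that meet in the model space do so at an angle in `(0, π)`. -/
theorem metricForm_normal_sq_lt_one {K : ℝ} {n : ℕ} {x a b : Ambient n} (hx : x ∈ modelSet K n)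
    (ha : pairing a x = 0) (hb : pairing b x = 0)
    (ha1 : pairing a (normal K a) = 1) (hb1 : pairing b (normal K b) = 1)
    (hab : ∀ s : ℝ, b ≠ s • a) :
    pairing a (normal K b) ^ 2 < 1 := by
  have hne : ∀ s : ℝ, normal K (b + (-s) • a) ≠ 0 := by
    intro s h
    set d := b + (-s) • a with hd
    have h2 : d.2 = 0 := congrArg Prod.snd h
    have h0 : d.1 = 0 := by
      have hdx : pairing d x = 0 := by rw [hd, add_pairing, smul_pairing, ha, hb]; simp
      have h1 : K * d.1 = 0 := congrArg Prod.fst h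
      have h3 : d.1 * x.1 = 0 := by simpa [pairing, h2] using hdx
      rcases mul_eq_zero.1 h1 with hK | h
      · exact (mul_eq_zero.1 h3).resolve_right (hx.2 hK.le).ne'
      · exact h
    apply hab s
    have : d = 0 := Prod.ext h0 h2
    rw [hd, neg_smul, ← sub_eq_add_neg, sub_eq_zero] at this
    exact this
  have key : ∀ s : ℝ, 0 < 1 - 2 * s * pairing a (normal K b) + s ^ 2 := by
    intro s
    have h := metricForm_self_pos hx (normal_isTangent K (b + (-s) • a) x
      (by rw [add_pairing, smul_pairing, ha, hb]; simp)) (hne s)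
    rw [metricForm_normal_normal, add_pairing, pairing_normal_comm K b, add_pairing,
      smul_pairing, smul_pairing, pairing_normal_comm K a (_ + _), add_pairing, smul_pairing,
      ha1, hb1, pairing_normal_comm K b a] at h
    linarith
  have h1 := key (pairing a (normal K b))
  nlinarith

/-! ### Gram determinants and Lebesgue volume in the ambient space -/

/-- The linear map `(s, u) ↦ s z + L u`. Its determinant is the volume spanned by `z` and the
columns of `L`. -/
def combine {k : ℕ} (z : Ambient k) (L : EuclideanSpace ℝ (Fin k) →L[ℝ] Ambient k) :
    Ambient k →L[ℝ] Ambient k :=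
  (ContinuousLinearMap.toSpanSingleton ℝ z).coprod L

theorem combine_apply {k : ℕ} (z : Ambient k) (L : EuclideanSpace ℝ (Fin k) →L[ℝ] Ambient k)
    (w : Ambient k) : combine z L w = w.1 • z + L w.2 := by
  simp [combine]

/-- The standard basis of the ambient space. -/
def ambientBasis (k : ℕ) : Module.Basis (Unit ⊕ Fin k) ℝ (Ambient k) :=
  (Module.Basis.singleton Unit ℝ).prod (EuclideanSpace.basisFun (Fin k) ℝ).toBasis

theorem toMatrix_combine {k : ℕ} (z : Ambient k) (L : EuclideanSpace ℝ (Fin k) →L[ℝ] Ambient k) :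
    LinearMap.toMatrix (ambientBasis k) (ambientBasis k) (combine z L : Ambient k →ₗ[ℝ] Ambient k) =
      Matrix.fromBlocks (Matrix.of fun _ _ => z.1)
        (Matrix.of fun _ a => (L (EuclideanSpace.single a 1)).1)
        (Matrix.of fun i _ => z.2 i)
        (Matrix.of fun i a => (L (EuclideanSpace.single a 1)).2 i) := by
  ext i j
  rcases i with i | i <;> rcases j with j | j <;>
    simp [LinearMap.toMatrix_apply, ambientBasis, combine_apply]

theorem det_combine {k : ℕ} (z : Ambient k) (L : EuclideanSpace ℝ (Fin k) →L[ℝ] Ambient k) :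
    (combine z L).det = (Matrix.fromBlocks (Matrix.of fun (_ _ : Unit) => z.1)
        (Matrix.of fun _ a => (L (EuclideanSpace.single a 1)).1)
        (Matrix.of fun i _ => z.2 i)
        (Matrix.of fun i a => (L (EuclideanSpace.single a 1)).2 i)).det := by
  rw [← toMatrix_combine, LinearMap.det_toMatrix]

/-- At a point `x` of the model space, the Riemannian volume spanned by tangent vectors is the
Euclidean volume in the ambient space spanned by these vectors and `x`. This holds for every `K`,
including `K = 0`. -/
theorem det_combine_sq {K : ℝ} {n : ℕ} {x : Ambient n} (hx : x ∈ modelSet K n)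
    (L : EuclideanSpace ℝ (Fin n) →L[ℝ] Ambient n) (hL : ∀ u, IsTangent K x (L u)) :
    (combine x L).det ^ 2 = (gram K L).det := by
  rcases eq_or_ne K 0 with rfl | hK
  · have hx0 : x.1 = 1 := by
      have h1 : x.1 ^ 2 = 1 := by simpa using hx.1
      have h2 := hx.2 le_rfl
      nlinarith
    have h1 : ∀ u, (L u).1 = 0 := by
      intro u
      have := hL u
      simpa [IsTangent, hx0] using this
    set A : Matrix (Fin n) (Fin n) ℝ :=
      Matrix.of fun i a => (L (EuclideanSpace.single a 1)).2 i with hA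
    have hg : gram 0 L = A.transpose * A := by
      ext a b
      simp only [gram, metricForm, Matrix.of_apply, Matrix.mul_apply, Matrix.transpose_apply, hA,
        h1, PiLp.inner_apply]
      simp [mul_comm]
    have hz : (Matrix.of fun (_ : Unit) (a : Fin n) => (L (EuclideanSpace.single a 1)).1) = 0 := by
      ext; simp [h1]
    rw [det_combine, hz, Matrix.det_fromBlocks_zero₁₂, hg, Matrix.det_mul, Matrix.det_transpose]
    simp [hx0, sq, hA]
  · set M := Matrix.fromBlocks (Matrix.of fun (_ _ : Unit) => x.1)
        (Matrix.of fun _ a => (L (EuclideanSpace.single a 1)).1)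
        (Matrix.of fun i _ => x.2 i)
        (Matrix.of fun i a => (L (EuclideanSpace.single a 1)).2 i) with hM
    have key : M.transpose * Matrix.fromBlocks 1 0 0 (K • (1 : Matrix (Fin n) (Fin n) ℝ)) * M =
        Matrix.fromBlocks (1 : Matrix Unit Unit ℝ) 0 0 (K • gram K L) := by
      rw [hM, Matrix.fromBlocks_transpose, Matrix.fromBlocks_multiply, Matrix.fromBlocks_multiply]
      have hin : ∀ v w : EuclideanSpace ℝ (Fin n), inner ℝ v w = ∑ i, v i * w i := by
        intro v w; simp [PiLp.inner_apply, mul_comm]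
      congr 1
      · ext i j
        have h := hx.1
        rw [← real_inner_self_eq_norm_sq, hin] at h
        simp [Matrix.mul_apply]
        rw [← h]
        simp [sq]
      · ext i j
        have h := hL (EuclideanSpace.single j 1)
        rw [IsTangent, hin] at h
        simp [Matrix.mul_apply]
        rw [← h]
      · ext j i
        have h := hL (EuclideanSpace.single j 1)
        rw [IsTangent, hin] at h
        simp [Matrix.mul_apply]
        rw [← h]
        simp only [mul_comm]
      · ext a b
        have hc : ∀ p q : ℝ, K * (p * q / K) = p * q := fun p q => by field_simp
        simp [Matrix.mul_apply, gram, metricForm, hin, mul_add, hc]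
    have hdet := congrArg Matrix.det key
    rw [Matrix.det_mul, Matrix.det_mul, Matrix.det_transpose, Matrix.det_fromBlocks_zero₂₁,
      Matrix.det_fromBlocks_zero₂₁, Matrix.det_smul, Matrix.det_smul] at hdet
    simp only [Matrix.det_one, mul_one, one_mul, Fintype.card_fin] at hdet
    rw [det_combine, ← hM]
    have hKn : K ^ n ≠ 0 := pow_ne_zero _ hK
    refine mul_left_cancel₀ hKn ?_
    rw [← hdet]; ring

theorem sqrt_det_gram {K : ℝ} {n : ℕ} {x : Ambient n} (hx : x ∈ modelSet K n)
    (L : EuclideanSpace ℝ (Fin n) →L[ℝ] Ambient n) (hL : ∀ u, IsTangent K x (L u)) :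
    Real.sqrt (gram K L).det = |(combine x L).det| := by
  rw [← det_combine_sq hx L hL, Real.sqrt_sq_eq_abs]

/-! ### Gram determinants in codimension two -/

/-- Splitting off the last two coordinates of a Euclidean space. -/
def euclideanSplit (k : ℕ) :
    EuclideanSpace ℝ (Fin (k + 2)) ≃ₗ[ℝ] EuclideanSpace ℝ (Fin k) × (ℝ × ℝ) where
  toFun u := (WithLp.toLp 2 fun i => u (Fin.castAdd 2 i), (u (Fin.natAdd k 0), u (Fin.natAdd k 1)))
  invFun v := WithLp.toLp 2 (Fin.append v.1 ![v.2.1, v.2.2])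
  map_add' u v := rfl
  map_smul' c u := rfl
  left_inv u := by
    ext i
    refine Fin.addCases (fun i => ?_) (fun i => ?_) i
    · simp
    · fin_cases i
      · simp
      · simp
  right_inv v := by
    refine Prod.ext ?_ (Prod.ext ?_ ?_)
    · ext i; simp
    · simp
    · simp

theorem euclideanSplit_apply (k : ℕ) (u : EuclideanSpace ℝ (Fin (k + 2))) :
    euclideanSplit k u = (WithLp.toLp 2 fun i => u (Fin.castAdd 2 i),
      (u (Fin.natAdd k 0), u (Fin.natAdd k 1))) := rfl

/-- Splitting off the last two coordinates of the ambient space. -/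
def ambientSplit (k : ℕ) : Ambient (k + 2) ≃ₗ[ℝ] Ambient k × (ℝ × ℝ) :=
  ((LinearEquiv.refl ℝ ℝ).prodCongr (euclideanSplit k)).trans
    (LinearEquiv.prodAssoc ℝ ℝ (EuclideanSpace ℝ (Fin k)) (ℝ × ℝ)).symm

theorem ambientSplit_apply (k : ℕ) (w : Ambient (k + 2)) :
    ambientSplit k w = ((w.1, (euclideanSplit k w.2).1), (euclideanSplit k w.2).2) := rfl

theorem euclideanSplit_single_castAdd (k : ℕ) (i : Fin k) :
    euclideanSplit k (EuclideanSpace.single (Fin.castAdd 2 i) 1) =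
      (EuclideanSpace.single i 1, 0) := by
  have hi := i.isLt
  rw [euclideanSplit_apply]
  refine Prod.ext ?_ (Prod.ext ?_ ?_)
  · ext j
    simp [Fin.ext_iff]
  · simp [Fin.ext_iff]
    omega
  · simp [Fin.ext_iff]
    omega

theorem euclideanSplit_single_natAdd (k : ℕ) (i : Fin 2) :
    euclideanSplit k (EuclideanSpace.single (Fin.natAdd k i) 1) =
      (0, if i = 0 then (1, 0) else (0, 1)) := by
  rw [euclideanSplit_apply]
  refine Prod.ext ?_ (Prod.ext ?_ ?_)
  · ext j
    have hj := j.isLt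
    simp [Fin.ext_iff]
    omega
  · fin_cases i <;> simp [Fin.ext_iff]
  · fin_cases i <;> simp [Fin.ext_iff]

theorem measurePreserving_euclideanSplit (k : ℕ) :
    MeasureTheory.MeasurePreserving (euclideanSplit k) := by
  have h1 := EuclideanSpace.volume_preserving_symm_measurableEquiv_toLp (Fin (k + 2))
  have h2 := MeasureTheory.volume_measurePreserving_piCongrLeft (fun _ : Fin (k + 2) => ℝ)
    (finSumFinEquiv (m := k) (n := 2))
  have h3 := MeasureTheory.volume_measurePreserving_sumPiEquivProdPi
    (fun _ : Fin k ⊕ Fin 2 => ℝ)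
  have h4 := (EuclideanSpace.volume_preserving_symm_measurableEquiv_toLp (Fin k)).symm
  have h5 := MeasureTheory.volume_preserving_finTwoArrow ℝ
  have h := ((h4.prod h5).comp h3).comp ((h2.symm).comp h1)
  exact h

theorem measurePreserving_ambientSplit (k : ℕ) :
    MeasureTheory.MeasurePreserving (ambientSplit k) := by
  have h := (MeasureTheory.MeasurePreserving.id
    (MeasureTheory.volume : MeasureTheory.Measure ℝ)).prod (measurePreserving_euclideanSplit k)
  exact (MeasureTheory.volume_preserving_prodAssoc
    (α₁ := ℝ) (β₁ := EuclideanSpace ℝ (Fin k)) (γ₁ := ℝ × ℝ)).symm.comp h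

/-- The linear map `(z, a, b) ↦ T z + a p + b r`, precomposed with the splitting of the last two
coordinates. -/
def extendByTwo {k : ℕ} (T : Ambient k →L[ℝ] Ambient (k + 2)) (p r : Ambient (k + 2)) :
    Ambient (k + 2) →ₗ[ℝ] Ambient (k + 2) :=
  ((T : Ambient k →ₗ[ℝ] Ambient (k + 2)).coprod
    ((LinearMap.toSpanSingleton ℝ _ p).coprod (LinearMap.toSpanSingleton ℝ _ r))).comp
    (ambientSplit k : Ambient (k + 2) →ₗ[ℝ] Ambient k × (ℝ × ℝ))

theorem extendByTwo_apply {k : ℕ} (T : Ambient k →L[ℝ] Ambient (k + 2)) (p r w : Ambient (k + 2)) :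
    extendByTwo T p r w = T (ambientSplit k w).1 +
      ((ambientSplit k w).2.1 • p + (ambientSplit k w).2.2 • r) := rfl

/-- The Riemannian volume in a totally geodesic subspace of codimension two, in terms of the
Euclidean volume in parameters of the linear subspace. -/
theorem sqrt_det_gram_codimTwo {K : ℝ} {k : ℕ} (T : Ambient k →L[ℝ] Ambient (k + 2))
    {p r : Ambient (k + 2)} {c : ℝ} (hpp : metricForm K p p = 1) (hrr : metricForm K r r = 1)
    (hpr : metricForm K p r = c) (hc : c ^ 2 < 1) {z : Ambient k} (hz : T z ∈ modelSet K (k + 2))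
    (hp : IsTangent K (T z) p) (hr : IsTangent K (T z) r)
    (L : EuclideanSpace ℝ (Fin k) →L[ℝ] Ambient k) (hL : ∀ u, IsTangent K (T z) (T (L u)))
    (hpL : ∀ u, metricForm K p (T (L u)) = 0) (hrL : ∀ u, metricForm K r (T (L u)) = 0) :
    Real.sqrt (gram K (T.comp L)).det =
      |LinearMap.det (extendByTwo T p r)| / Real.sqrt (1 - c ^ 2) * |(combine z L).det| := by
  have mf_comm : ∀ v w : Ambient (k + 2), metricForm K v w = metricForm K w v := by
    intro v w; simp only [metricForm, real_inner_comm]; ring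
  set Lt : EuclideanSpace ℝ (Fin (k + 2)) →L[ℝ] Ambient (k + 2) := LinearMap.toContinuousLinearMap
    ((((T.comp L : EuclideanSpace ℝ (Fin k) →L[ℝ] _) : _ →ₗ[ℝ] Ambient (k + 2)).coprod
    ((LinearMap.toSpanSingleton ℝ _ p).coprod (LinearMap.toSpanSingleton ℝ _ r))).comp
    (euclideanSplit k).toLinearMap) with hLt
  have hLt_apply : ∀ u, Lt u = T (L (euclideanSplit k u).1) +
      ((euclideanSplit k u).2.1 • p + (euclideanSplit k u).2.2 • r) := fun u => rfl
  have hform : ∀ v w s : Ambient (k + 2), ∀ a b : ℝ, form K v (w + (a • p + b • r)) =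
      form K v w + (a * form K v p + b * form K v r) := by
    intro v w s a b
    simp only [form, Prod.fst_add, Prod.snd_add, Prod.smul_fst, Prod.smul_snd, inner_add_right,
      inner_smul_right, smul_eq_mul]
    ring
  have htan : ∀ u, IsTangent K (T z) (Lt u) := by
    intro u
    have h1 : form K (T z) (T (L (euclideanSplit k u).1)) = 0 := hL _
    have h2 : form K (T z) p = 0 := hp
    have h3 : form K (T z) r = 0 := hr
    rw [isTangent_iff, hLt_apply, hform _ _ 0, h1, h2, h3]
    simp
  have hdetL : (combine (T z) Lt).det =
      LinearMap.det (extendByTwo T p r) * (combine z L).det := by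
    have hmap : ((combine (T z) Lt : Ambient (k + 2) →L[ℝ] _) : Ambient (k + 2) →ₗ[ℝ] _) =
        (extendByTwo T p r) ∘ₗ (ambientSplit k).symm.toLinearMap ∘ₗ
          ((combine z L : Ambient k →ₗ[ℝ] Ambient k).prodMap LinearMap.id) ∘ₗ
          (ambientSplit k).symm.symm.toLinearMap := by
      refine LinearMap.ext fun w => ?_
      simp only [LinearMap.coe_comp, Function.comp_apply, LinearEquiv.coe_coe,
        LinearEquiv.symm_symm, extendByTwo_apply, LinearEquiv.apply_symm_apply,
        LinearMap.prodMap_apply, ContinuousLinearMap.coe_coe, combine_apply, ambientSplit_apply,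
        hLt_apply, map_add, map_smul, LinearMap.id_apply]
      rw [add_assoc]
    change LinearMap.det _ = _
    rw [hmap, LinearMap.det_comp, ← LinearMap.comp_assoc, LinearMap.comp_assoc, LinearMap.det_conj,
      LinearMap.det_prodMap, LinearMap.det_id, mul_one]
  have hgram : (gram K Lt).det = (gram K (T.comp L)).det * (1 - c ^ 2) := by
    rw [← Matrix.det_submatrix_equiv_self (finSumFinEquiv (m := k) (n := 2))]
    have : (gram K Lt).submatrix finSumFinEquiv finSumFinEquiv =
        Matrix.fromBlocks (gram K (T.comp L)) 0 0 !![1, c; c, 1] := by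
      ext i j
      rcases i with i | i <;> rcases j with j | j
      · simp [gram, hLt_apply, euclideanSplit_single_castAdd]
      · simp only [Matrix.submatrix_apply, gram, Matrix.of_apply, finSumFinEquiv_apply_left,
          finSumFinEquiv_apply_right, hLt_apply, euclideanSplit_single_castAdd,
          euclideanSplit_single_natAdd, Matrix.fromBlocks_apply₁₂, Matrix.zero_apply]
        fin_cases j <;> simp [mf_comm _ p, mf_comm _ r, hpL, hrL]
      · simp only [Matrix.submatrix_apply, gram, Matrix.of_apply, finSumFinEquiv_apply_left,
          finSumFinEquiv_apply_right, hLt_apply, euclideanSplit_single_castAdd,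
          euclideanSplit_single_natAdd, Matrix.fromBlocks_apply₂₁, Matrix.zero_apply]
        fin_cases i <;> simp [hpL, hrL]
      · simp only [Matrix.submatrix_apply, gram, Matrix.of_apply,
          finSumFinEquiv_apply_right, hLt_apply,
          euclideanSplit_single_natAdd, Matrix.fromBlocks_apply₂₂]
        fin_cases i <;> fin_cases j <;> simp [hpp, hrr, hpr, mf_comm r p]
    rw [this, Matrix.det_fromBlocks_zero₂₁, Matrix.det_fin_two_of]
    ring
  have hc1 : 0 < 1 - c ^ 2 := by linarith
  have h1 := det_combine_sq hz Lt htan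
  rw [hgram, hdetL] at h1
  have h2 : (gram K (T.comp L)).det =
      (|LinearMap.det (extendByTwo T p r)| / Real.sqrt (1 - c ^ 2) * |(combine z L).det|) ^ 2 := by
    rw [mul_pow, div_pow, sq_abs, sq_abs, Real.sq_sqrt hc1.le, div_mul_eq_mul_div, ← mul_pow, h1]
    field_simp
  rw [h2, Real.sqrt_sq (by positivity)]

/-! ### Volume in the model space as Lebesgue volume of a cone -/

/-- At almost every point of a measurable set, any derivative within the set of a function that is
constant there vanishes. (At points that are not density points the derivative is not unique.) -/
theorem ae_fderivWithin_eq_zero {E G : Type*} [NormedAddCommGroup E] [NormedSpace ℝ E]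
    [FiniteDimensional ℝ E] [MeasurableSpace E] [BorelSpace E] [NormedAddCommGroup G]
    [NormedSpace ℝ G] [FiniteDimensional ℝ G] (μ : Measure E) [μ.IsAddHaarMeasure] {s : Set E}
    (hs : MeasurableSet s) {f : E → G} {f' : E → E →L[ℝ] G} {c : G}
    (hf : ∀ x ∈ s, HasFDerivWithinAt f (f' x) s x) (h0 : ∀ x ∈ s, f x = c) :
    ∀ᵐ x ∂μ.restrict s, f' x = 0 := by
  rcases subsingleton_or_nontrivial E with hE | hE
  · refine Filter.Eventually.of_forall fun x => ?_
    ext v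
    rw [Subsingleton.elim v 0, map_zero, map_zero]
  obtain ⟨e, he⟩ := exists_ne (0 : E)
  -- the derivative estimates are available for maps from `E` to `E`: test with functionals
  let b := Module.finBasis ℝ G
  have key : ∀ i, ∀ᵐ x ∂μ.restrict s, ∀ v, b.coord i (f' x v) = 0 := by
    intro i
    let ℓ : G →L[ℝ] E := (ContinuousLinearMap.toSpanSingleton ℝ e).comp
      (LinearMap.toContinuousLinearMap (b.coord i))
    have h1 : ApproximatesLinearOn (fun x => ℓ (f x)) (0 : E →L[ℝ] E) s 0 := by
      intro x hx y hy
      simp [h0 x hx, h0 y hy]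
    have h2 := h1.norm_fderiv_sub_le μ hs (fun x => ℓ.comp (f' x))
      (fun x hx => ℓ.hasFDerivAt.comp_hasFDerivWithinAt x (hf x hx))
    filter_upwards [h2] with x hx v
    have h3 : ℓ.comp (f' x) = 0 := by simpa using hx
    have h4 : ℓ (f' x v) = 0 := by
      have := DFunLike.congr_fun h3 v
      simpa using this
    have h5 : (b.coord i (f' x v)) • e = 0 := h4
    exact (smul_eq_zero.1 h5).resolve_right he
  filter_upwards [ae_all_iff.2 key] with x hx
  ext v
  refine b.ext_elem fun i => ?_
  simpa using hx i v

instance isAddHaarMeasure_volume_ambient (n : ℕ) :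
    (volume : Measure (Ambient n)).IsAddHaarMeasure :=
  Measure.prod.instIsAddHaarMeasure volume volume

theorem det_combine_smul {k : ℕ} (z : Ambient k) (L : EuclideanSpace ℝ (Fin k) →L[ℝ] Ambient k)
    (r : ℝ) : (combine z (r • L)).det = r ^ k * (combine z L).det := by
  have : ((combine z (r • L) : Ambient k →L[ℝ] Ambient k) : Ambient k →ₗ[ℝ] Ambient k) =
      (combine z L : Ambient k →ₗ[ℝ] Ambient k) ∘ₗ
        (LinearMap.id.prodMap (r • LinearMap.id)) := by
    refine LinearMap.ext fun w => ?_
    simp [combine_apply]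
  change LinearMap.det _ = _
  rw [this, LinearMap.det_comp, LinearMap.det_prodMap, LinearMap.det_id, LinearMap.det_smul,
    finrank_euclideanSpace_fin, LinearMap.det_id, mul_comm, one_mul, mul_one]

/-- Almost everywhere, the derivatives of a parametrization of a piece of the model space take
tangent values. -/
theorem ae_isTangent {K : ℝ} {k n : ℕ} {V : Set (EuclideanSpace ℝ (Fin k))} (hV : MeasurableSet V)
    {φ : EuclideanSpace ℝ (Fin k) → Ambient n}
    {φ' : EuclideanSpace ℝ (Fin k) → EuclideanSpace ℝ (Fin k) →L[ℝ] Ambient n}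
    (hφ : ∀ u ∈ V, HasFDerivWithinAt φ (φ' u) V u) (hφm : ∀ u ∈ V, φ u ∈ modelSet K n) :
    ∀ᵐ u ∂volume.restrict V, ∀ v, IsTangent K (φ u) (φ' u v) := by
  have h := ae_fderivWithin_eq_zero volume hV (f := fun u => quad K (φ u))
    (f' := fun u => (fderiv ℝ (quad K) (φ u)).comp (φ' u)) (c := 1)
    (fun u hu => ((hasFDerivAt_quad K (φ u)).differentiableAt.hasFDerivAt).comp_hasFDerivWithinAt
      u (hφ u hu))
    (fun u hu => quad_eq_one (hφm u hu))
  filter_upwards [h] with u hu v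
  have h1 := DFunLike.congr_fun hu v
  rw [ContinuousLinearMap.comp_apply, fderiv_quad_apply] at h1
  have h2 : form K (φ u) (φ' u v) = 0 := by simpa using h1
  exact h2

/-- The cone over a parametrized piece of the model space, in linear coordinates. -/
def coneMap {k n : ℕ} (S : Ambient n →L[ℝ] Ambient k) (φ : EuclideanSpace ℝ (Fin k) → Ambient n)
    (p : ℝ × EuclideanSpace ℝ (Fin k)) : Ambient k := p.1 • S (φ p.2)

theorem hasFDerivWithinAt_coneMap {k n : ℕ} (S : Ambient n →L[ℝ] Ambient k)
    {φ : EuclideanSpace ℝ (Fin k) → Ambient n}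
    {φ' : EuclideanSpace ℝ (Fin k) → EuclideanSpace ℝ (Fin k) →L[ℝ] Ambient n}
    {V : Set (EuclideanSpace ℝ (Fin k))}
    (hφ : ∀ u ∈ V, HasFDerivWithinAt φ (φ' u) V u) (p : ℝ × EuclideanSpace ℝ (Fin k))
    (hp : p ∈ Ioi (0 : ℝ) ×ˢ V) :
    HasFDerivWithinAt (coneMap S φ) (combine (S (φ p.2)) (p.1 • S.comp (φ' p.2)))
      (Ioi (0 : ℝ) ×ˢ V) p := by
  have h1 : HasFDerivWithinAt (fun q : ℝ × EuclideanSpace ℝ (Fin k) => S (φ q.2))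
      ((S.comp (φ' p.2)).comp (ContinuousLinearMap.snd ℝ ℝ _)) (Ioi (0 : ℝ) ×ˢ V) p := by
    refine HasFDerivWithinAt.comp p (S.hasFDerivAt.comp_hasFDerivWithinAt p.2 (hφ p.2 hp.2))
      hasFDerivWithinAt_snd ?_
    exact fun q hq => hq.2
  have h2 : HasFDerivWithinAt (fun q : ℝ × EuclideanSpace ℝ (Fin k) => q.1)
      (ContinuousLinearMap.fst ℝ ℝ _) (Ioi (0 : ℝ) ×ˢ V) p := hasFDerivWithinAt_fst
  refine (h2.smul h1).congr_fderiv ?_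
  ext w <;> simp [combine_apply]

/-- The area formula for the cone over a parametrized piece of the model space that lies in a
linear subspace, the image of `T`. -/
theorem lintegral_coneMap {K : ℝ} {k n : ℕ} {T : Ambient k →L[ℝ] Ambient n}
    {S : Ambient n →L[ℝ] Ambient k} {κ : ℝ} (hκ0 : 0 ≤ κ)
    (hκ : ∀ (z : Ambient k) (L : EuclideanSpace ℝ (Fin k) →L[ℝ] Ambient k),
      T z ∈ modelSet K n → (∀ u, IsTangent K (T z) (T (L u))) →
      Real.sqrt (gram K (T.comp L)).det = κ * |(combine z L).det|)
    {V : Set (EuclideanSpace ℝ (Fin k))} (hV : MeasurableSet V)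
    {φ : EuclideanSpace ℝ (Fin k) → Ambient n}
    {φ' : EuclideanSpace ℝ (Fin k) → EuclideanSpace ℝ (Fin k) →L[ℝ] Ambient n}
    (hφ : ∀ u ∈ V, HasFDerivWithinAt φ (φ' u) V u) (hφm : ∀ u ∈ V, φ u ∈ modelSet K n)
    (hφT : ∀ u ∈ V, T (S (φ u)) = φ u) (hinj : InjOn φ V)
    {f : ℝ → ℝ≥0∞} (hf : Measurable f)
    (hC : ∫⁻ r in Ioi (0 : ℝ), ENNReal.ofReal (r ^ k) * f (r ^ 2) ≠ ⊤) :
    MeasurableSet (coneMap S φ '' (Ioi (0 : ℝ) ×ˢ V)) ∧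
    (∫⁻ u in V, ENNReal.ofReal (Real.sqrt (gram K (φ' u)).det)) *
        ∫⁻ r in Ioi (0 : ℝ), ENNReal.ofReal (r ^ k) * f (r ^ 2) =
      ∫⁻ z in coneMap S φ '' (Ioi (0 : ℝ) ×ˢ V), ENNReal.ofReal κ * f (quad K (T z)) := by
  have hm : MeasurableSet (Ioi (0 : ℝ) ×ˢ V) := measurableSet_Ioi.prod hV
  have hd := fun p hp => hasFDerivWithinAt_coneMap S hφ p hp
  have hquad : ∀ p ∈ Ioi (0 : ℝ) ×ˢ V, quad K (T (coneMap S φ p)) = p.1 ^ 2 := by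
    intro p hp
    rw [coneMap, map_smul, hφT _ hp.2, quad_smul, quad_eq_one (hφm _ hp.2), mul_one]
  have hinj' : InjOn (coneMap S φ) (Ioi (0 : ℝ) ×ˢ V) := by
    intro p hp q hq h
    have h1 : p.1 = q.1 := by
      have := congrArg (fun z => quad K (T z)) h
      simp only [hquad p hp, hquad q hq] at this
      exact (pow_left_inj₀ (le_of_lt hp.1) (le_of_lt hq.1) two_ne_zero).1 this
    refine Prod.ext h1 (hinj hp.2 hq.2 ?_)
    have h2 : p.1 • S (φ p.2) = p.1 • S (φ q.2) := by
      exact h.trans (by rw [coneMap, h1])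
    have h3 := smul_right_injective _ (ne_of_gt hp.1 : p.1 ≠ 0) h2
    rw [← hφT _ hp.2, ← hφT _ hq.2, h3]
  refine ⟨measurable_image_of_fderivWithin hm hd hinj', ?_⟩
  rw [lintegral_image_eq_lintegral_abs_det_fderiv_mul volume hm hd hinj']
  have e1 : ∫⁻ p in Ioi (0 : ℝ) ×ˢ V,
      ENNReal.ofReal |(combine (S (φ p.2)) (p.1 • S.comp (φ' p.2))).det| *
        (ENNReal.ofReal κ * f (quad K (T (coneMap S φ p)))) =
      ∫⁻ p in Ioi (0 : ℝ) ×ˢ V,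
      ENNReal.ofReal |(combine (S (φ p.2)) (p.1 • S.comp (φ' p.2))).det| *
        (ENNReal.ofReal κ * f (p.1 ^ 2)) :=
    setLIntegral_congr_fun hm fun p hp => by simp only [hquad p hp]
  rw [e1]
  have hae := aemeasurable_ofReal_abs_det_fderivWithin volume hm hd
  rw [Measure.volume_eq_prod, ← Measure.prod_restrict] at hae ⊢
  have hae2 : AEMeasurable (fun p : ℝ × EuclideanSpace ℝ (Fin k) =>
      ENNReal.ofReal |(combine (S (φ p.2)) (p.1 • S.comp (φ' p.2))).det| *
        (ENNReal.ofReal κ * f (p.1 ^ 2)))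
      ((volume.restrict (Ioi (0 : ℝ))).prod (volume.restrict V)) := hae.mul (by fun_prop)
  rw [lintegral_prod_symm _ hae2, ← lintegral_mul_const' _ _ hC]
  -- a parametrization with values in a linear subspace has derivatives there almost everywhere
  have t1 : ∀ᵐ u ∂volume.restrict V, T.comp (S.comp (φ' u)) = φ' u := by
    have h := ae_fderivWithin_eq_zero volume hV (f := fun u => T (S (φ u)) - φ u)
      (f' := fun u => T.comp (S.comp (φ' u)) - φ' u) (c := 0)
      (fun u hu => (T.hasFDerivAt.comp_hasFDerivWithinAt u
        (S.hasFDerivAt.comp_hasFDerivWithinAt u (hφ u hu))).sub (hφ u hu))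
      (fun u hu => sub_eq_zero.2 (hφT u hu))
    filter_upwards [h] with u hu using sub_eq_zero.1 hu
  have t2 := ae_isTangent hV hφ hφm
  refine lintegral_congr_ae ?_
  filter_upwards [t1, t2, ae_restrict_mem hV] with u h1 h2 hu
  have e2 : Real.sqrt (gram K (φ' u)).det = κ * |(combine (S (φ u)) (S.comp (φ' u))).det| := by
    rw [← hκ (S (φ u)) (S.comp (φ' u)) (by rw [hφT u hu]; exact hφm u hu) ?_, h1]
    intro v
    rw [hφT u hu]
    have := DFunLike.congr_fun h1 v
    simp only [ContinuousLinearMap.comp_apply] at this ⊢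
    rw [this]
    exact h2 v
  rw [e2, ← lintegral_const_mul' _ _ ENNReal.ofReal_ne_top]
  refine setLIntegral_congr_fun measurableSet_Ioi fun r hr => ?_
  have hr' : (0 : ℝ) < r := hr
  simp only [det_combine_smul, abs_mul, abs_of_pos (pow_pos hr' k)]
  rw [ENNReal.ofReal_mul hκ0, ENNReal.ofReal_mul (pow_pos hr' k).le]
  ring

/-! ### The deck group -/

theorem IsSpaceFormGroup.eq_of_apply_eq {K : ℝ} {n : ℕ} {Γ : Subgroup (Ambient n ≃L[ℝ] Ambient n)}
    (hΓ : IsSpaceFormGroup K Γ) {x : Ambient n} (hx : x ∈ modelSet K n)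
    {γ δ : Ambient n ≃L[ℝ] Ambient n} (hγ : γ ∈ Γ) (hδ : δ ∈ Γ) (h : γ x = δ x) : γ = δ := by
  obtain ⟨U, -, hxU, hU⟩ := hΓ.wandering x hx
  by_contra hne
  have h1 : δ⁻¹ * γ ≠ 1 := fun h1 => hne (inv_mul_eq_one.1 h1).symm
  refine hU _ (Γ.mul_mem (Γ.inv_mem hδ) hγ) h1 x ⟨hxU, hx⟩ ?_
  have h2 : (δ⁻¹ * γ) x = x := by
    change δ.symm (γ x) = x
    rw [h, ContinuousLinearEquiv.symm_apply_apply]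
  rwa [h2]

theorem basepoint_mem (K : ℝ) (n : ℕ) : ((1, 0) : Ambient n) ∈ modelSet K n := by
  simp [modelSet]

/-- The translates of a wandering neighbourhood are disjoint, so there are countably many. -/
theorem IsSpaceFormGroup.countable {K : ℝ} {n : ℕ} {Γ : Subgroup (Ambient n ≃L[ℝ] Ambient n)}
    (hΓ : IsSpaceFormGroup K Γ) : Countable Γ := by
  obtain ⟨U, hUo, hxU, hU⟩ := hΓ.wandering _ (basepoint_mem K n)
  let s : Γ → Set (Model K n) := fun γ => {y | (γ : Ambient n ≃L[ℝ] Ambient n).symm y ∈ U}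
  have hs : ∀ γ ∈ (univ : Set Γ), IsOpen (s γ) := fun γ _ =>
    hUo.preimage ((γ : Ambient n ≃L[ℝ] Ambient n).symm.continuous.comp continuous_subtype_val)
  have hne : ∀ γ ∈ (univ : Set Γ), (s γ).Nonempty := fun γ _ =>
    ⟨⟨(γ : Ambient n ≃L[ℝ] Ambient n) (1, 0), hΓ.mapsTo _ γ.2 _ (basepoint_mem K n)⟩, by
      change (γ : Ambient n ≃L[ℝ] Ambient n).symm ((γ : Ambient n ≃L[ℝ] Ambient n) (1, 0)) ∈ U
      rwa [ContinuousLinearEquiv.symm_apply_apply]⟩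
  have hd : (univ : Set Γ).PairwiseDisjoint s := by
    intro γ _ δ _ hγδ
    refine Set.disjoint_left.2 fun y hy hy' => ?_
    have h1 : (δ : Ambient n ≃L[ℝ] Ambient n)⁻¹ * γ ≠ 1 := fun h1 =>
      hγδ (Subtype.ext (inv_mul_eq_one.1 h1).symm)
    refine hU _ (Γ.mul_mem (Γ.inv_mem δ.2) γ.2) h1 ((γ : Ambient n ≃L[ℝ] Ambient n).symm y)
      ⟨hy, hΓ.mapsTo _ (Γ.inv_mem γ.2) _ y.2⟩ ?_
    change (δ : Ambient n ≃L[ℝ] Ambient n).symm ((γ : Ambient n ≃L[ℝ] Ambient n) _) ∈ U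
    rw [ContinuousLinearEquiv.apply_symm_apply]
    exact hy'
  exact Set.countable_univ_iff.1 (hd.countable_of_isOpen hs hne)

/-! ### Volumes of pieces of totally geodesic subspaces -/

/-- A closed cone `A` in the image of `T`, all of whose rays meet the model space, and
whose section with the model space embeds in the space form. The section is a piece of
a totally geodesic subspace, `T` are linear coordinates on the linear span of that subspace, and `κ`
compares the Riemannian volume with the Euclidean volume in these coordinates. -/
structure IsConeOver (K : ℝ) {k n : ℕ} (Γ : Subgroup (Ambient n ≃L[ℝ] Ambient n))
    (T : Ambient k →L[ℝ] Ambient n) (S : Ambient n →L[ℝ] Ambient k) (κ : ℝ) (A : Set (Ambient n)) :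
    Prop where
  left_inv : ∀ z, S (T z) = z
  κ_nonneg : 0 ≤ κ
  sqrt_det : ∀ (z : Ambient k) (L : EuclideanSpace ℝ (Fin k) →L[ℝ] Ambient k),
      T z ∈ modelSet K n → (∀ u, IsTangent K (T z) (T (L u))) →
      Real.sqrt (gram K (T.comp L)).det = κ * |(combine z L).det|
  closed : IsClosed A
  smul_mem : ∀ r : ℝ, 0 < r → ∀ y ∈ A, r • y ∈ A
  right_inv : ∀ y ∈ A, T (S y) = y
  quad_pos : ∀ y ∈ A, y ≠ 0 → 0 < quad K y
  fst_pos : K ≤ 0 → ∀ y ∈ A, y ≠ 0 → 0 < y.1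
  injOn : InjOn (proj K Γ) {x : Model K n | (x : Ambient n) ∈ A}

namespace IsConeOver

variable {K : ℝ} {k n : ℕ} {Γ : Subgroup (Ambient n ≃L[ℝ] Ambient n)}
  {T : Ambient k →L[ℝ] Ambient n} {S : Ambient n →L[ℝ] Ambient k} {κ : ℝ} {A : Set (Ambient n)}

theorem sum_lintegral_le (hA : IsConeOver K Γ T S κ A) (hΓ : IsSpaceFormGroup K Γ)
    {f : ℝ → ℝ≥0∞} (hf : Measurable f)
    (hC : ∫⁻ r in Ioi (0 : ℝ), ENNReal.ofReal (r ^ k) * f (r ^ 2) ≠ ⊤)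
    {U : ℕ → Set (EuclideanSpace ℝ (Fin k))} {ψ : ℕ → EuclideanSpace ℝ (Fin k) → Model K n}
    {ψ' : ℕ → EuclideanSpace ℝ (Fin k) → EuclideanSpace ℝ (Fin k) →L[ℝ] Ambient n}
    (hψ : IsParametrization K Γ k (proj K Γ '' {x : Model K n | (x : Ambient n) ∈ A}) U ψ ψ') :
    (∑' j, ∫⁻ u in U j, ENNReal.ofReal (Real.sqrt (gram K (ψ' j u)).det)) *
        ∫⁻ r in Ioi (0 : ℝ), ENNReal.ofReal (r ^ k) * f (r ^ 2) ≤
      ∫⁻ z in T ⁻¹' A, ENNReal.ofReal κ * f (quad K (T z)) := by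
  have := hΓ.countable
  -- on `V (j, γ)` the lift `γ ∘ ψ j` takes values in the cone
  let V : ℕ × Γ → Set (EuclideanSpace ℝ (Fin k)) := fun q =>
    {u | u ∈ U q.1 ∧ (q.2 : Ambient n ≃L[ℝ] Ambient n) (ψ q.1 u) ∈ A}
  let φ : ℕ × Γ → EuclideanSpace ℝ (Fin k) → Ambient n := fun q u =>
    (q.2 : Ambient n ≃L[ℝ] Ambient n) (ψ q.1 u)
  let φ' : ℕ × Γ → EuclideanSpace ℝ (Fin k) → EuclideanSpace ℝ (Fin k) →L[ℝ] Ambient n := fun q u =>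
    ((q.2 : Ambient n ≃L[ℝ] Ambient n) : Ambient n →L[ℝ] Ambient n).comp (ψ' q.1 u)
  have hVU : ∀ q, V q ⊆ U q.1 := fun q u hu => hu.1
  have hφm : ∀ q u, φ q u ∈ modelSet K n := fun q u => hΓ.mapsTo _ q.2.2 _ (ψ q.1 u).2
  have hproj : ∀ q u, proj K Γ ⟨φ q u, hφm q u⟩ = proj K Γ (ψ q.1 u) := fun q u =>
    (Quotient.sound ⟨q.2, q.2.2, rfl⟩ : proj K Γ (ψ q.1 u) = proj K Γ ⟨φ q u, hφm q u⟩).symm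
  have hV : ∀ q, MeasurableSet (V q) := by
    intro q
    have hc : ContinuousOn (φ q) (U q.1) := fun u hu =>
      (q.2 : Ambient n ≃L[ℝ] Ambient n).continuous.continuousAt.comp_continuousWithinAt
        (hψ.hasFDerivWithinAt q.1 u hu).continuousWithinAt
    obtain ⟨F, hF, hF'⟩ := continuousOn_iff_isClosed.1 hc A hA.closed
    have : V q = F ∩ U q.1 := by
      rw [← hF']; ext u; exact and_comm
    rw [this]
    exact hF.measurableSet.inter (hψ.measurable q.1)
  have hφ : ∀ q, ∀ u ∈ V q, HasFDerivWithinAt (φ q) (φ' q u) (V q) u := fun q u hu =>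
    HasFDerivAt.comp_hasFDerivWithinAt u
      ((q.2 : Ambient n ≃L[ℝ] Ambient n) : Ambient n →L[ℝ] Ambient n).hasFDerivAt
      ((hψ.hasFDerivWithinAt q.1 u hu.1).mono (hVU q))
  have hinj : ∀ q q', ∀ u ∈ V q, ∀ w ∈ V q', φ q u = φ q' w → q = q' ∧ u = w := by
    intro q q' u hu w hw h
    have h1 : proj K Γ (ψ q.1 u) = proj K Γ (ψ q'.1 w) := by
      rw [← hproj, ← hproj]
      exact congrArg _ (Subtype.ext h)
    obtain ⟨h2, h3⟩ := hψ.injective q.1 q'.1 u hu.1 w hw.1 h1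
    refine ⟨Prod.ext h2 (Subtype.ext ?_), h3⟩
    refine hΓ.eq_of_apply_eq (ψ q.1 u).2 q.2.2 q'.2.2 ?_
    have h4 : φ q' w = (q'.2 : Ambient n ≃L[ℝ] Ambient n) (ψ q.1 u) := by
      simp only [φ, h3, h2]
    exact h.trans h4
  have hone := fun q => lintegral_coneMap hA.κ_nonneg hA.sqrt_det (hV q) (hφ q)
    (fun u _ => hφm q u) (fun u hu => hA.right_inv _ hu.2)
    (fun u hu w hw h => (hinj q q u hu w hw h).2) hf hC
  have hgram : ∀ q, ∫⁻ u in V q, ENNReal.ofReal (Real.sqrt (gram K (φ' q u)).det) =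
      ∫⁻ u in V q, ENNReal.ofReal (Real.sqrt (gram K (ψ' q.1 u)).det) := by
    intro q
    have ht := ae_isTangent (hV q)
      (fun u hu => (hψ.hasFDerivWithinAt q.1 u hu.1).mono (hVU q)) (fun u _ => (ψ q.1 u).2)
    refine lintegral_congr_ae ?_
    filter_upwards [ht] with u hu
    have : gram K (φ' q u) = gram K (ψ' q.1 u) := by
      ext a b
      exact hΓ.isometry _ q.2.2 _ (ψ q.1 u).2 _ _ (hu _) (hu _)
    rw [this]
  have hUV : ∀ j, U j = ⋃ γ : Γ, V (j, γ) := by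
    intro j
    refine Set.Subset.antisymm (fun u hu => ?_) (Set.iUnion_subset fun γ => hVU (j, γ))
    obtain ⟨x, hx, hxu⟩ := hψ.mapsTo j u hu
    obtain ⟨γ, hγ, h⟩ := Quotient.exact hxu.symm
    exact Set.mem_iUnion.2 ⟨⟨γ, hγ⟩, hu, by
      change γ (ψ j u) ∈ A
      rw [h]; exact hx⟩
  have hdisjV : ∀ j, Pairwise (Function.onFun Disjoint fun γ : Γ => V (j, γ)) := by
    intro j γ δ hγδ
    refine Set.disjoint_left.2 fun u hu hu' => hγδ ?_
    have h1 : (⟨φ (j, γ) u, hφm _ u⟩ : Model K n) = ⟨φ (j, δ) u, hφm _ u⟩ :=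
      hA.injOn hu.2 hu'.2 (by rw [hproj, hproj])
    have h2 := (hinj (j, γ) (j, δ) u hu u hu' (congrArg Subtype.val h1)).1
    exact congrArg Prod.snd h2
  have hdisjW : Pairwise (Function.onFun Disjoint
      fun q => coneMap S (φ q) '' (Ioi (0 : ℝ) ×ˢ V q)) := by
    intro q q' hqq
    refine Set.disjoint_left.2 ?_
    rintro z ⟨⟨r, u⟩, ⟨hr, hu⟩, rfl⟩ ⟨⟨r', u'⟩, ⟨hr', hu'⟩, h⟩
    apply hqq
    simp only [coneMap] at h hr hr' hu hu'
    have h1 : r' • φ q' u' = r • φ q u := by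
      have := congrArg T h
      rwa [map_smul, map_smul, hA.right_inv _ hu.2, hA.right_inv _ hu'.2] at this
    have h2 : r' = r := by
      have := congrArg (quad K) h1
      rw [quad_smul, quad_smul, quad_eq_one (hφm q u), quad_eq_one (hφm q' u'), mul_one,
        mul_one] at this
      exact (pow_left_inj₀ (le_of_lt hr') (le_of_lt hr) two_ne_zero).1 this
    rw [h2] at h1
    exact (hinj q q' u hu u' hu' (smul_right_injective _ (ne_of_gt hr) h1).symm).1
  have hsub : (⋃ q, coneMap S (φ q) '' (Ioi (0 : ℝ) ×ˢ V q)) ⊆ T ⁻¹' A := by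
    refine Set.iUnion_subset fun q => ?_
    rintro _ ⟨⟨r, u⟩, ⟨hr, hu⟩, rfl⟩
    change T (r • S (φ q u)) ∈ A
    rw [map_smul, hA.right_inv _ hu.2]
    exact hA.smul_mem r hr _ hu.2
  calc (∑' j, ∫⁻ u in U j, ENNReal.ofReal (Real.sqrt (gram K (ψ' j u)).det)) *
        ∫⁻ r in Ioi (0 : ℝ), ENNReal.ofReal (r ^ k) * f (r ^ 2)
      = ∑' q, (∫⁻ u in V q, ENNReal.ofReal (Real.sqrt (gram K (φ' q u)).det)) *
        ∫⁻ r in Ioi (0 : ℝ), ENNReal.ofReal (r ^ k) * f (r ^ 2) := by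
        rw [ENNReal.tsum_mul_right, ENNReal.tsum_prod']
        congr 2
        ext j
        conv_lhs => rw [hUV j, lintegral_iUnion (fun γ => hV (j, γ)) (hdisjV j)]
        exact tsum_congr fun γ => (hgram (j, γ)).symm
    _ = ∑' q, ∫⁻ z in coneMap S (φ q) '' (Ioi (0 : ℝ) ×ˢ V q),
          ENNReal.ofReal κ * f (quad K (T z)) := tsum_congr fun q => (hone q).2
    _ = ∫⁻ z in ⋃ q, coneMap S (φ q) '' (Ioi (0 : ℝ) ×ˢ V q),
          ENNReal.ofReal κ * f (quad K (T z)) :=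
        (lintegral_iUnion (fun q => (hone q).1) hdisjW _).symm
    _ ≤ _ := lintegral_mono_set hsub

/-- The central projection of the affine hyperplanes `z₀ = ± 1` of the parameter space. -/
def gnomonic (K : ℝ) (T : Ambient k →L[ℝ] Ambient n) (j : ℕ) (u : EuclideanSpace ℝ (Fin k)) :
    Ambient n :=
  ((-1) ^ j / Real.sqrt (quad K (T (1, u)))) • T (1, u)

theorem fst_null (k : ℕ) : volume {z : Ambient k | z.1 = 0} = 0 := by
  have : {z : Ambient k | z.1 = 0} = ({0} : Set ℝ) ×ˢ (univ : Set (EuclideanSpace ℝ (Fin k))) := by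
    ext z; simp
  rw [this, Measure.volume_eq_prod, Measure.prod_prod]
  simp

/-- The central projections parametrize the piece up to a null set. -/
theorem exists_isParametrization (hA : IsConeOver K Γ T S κ A)
    {f : ℝ → ℝ≥0∞} (hf : Measurable f)
    (hC : ∫⁻ r in Ioi (0 : ℝ), ENNReal.ofReal (r ^ k) * f (r ^ 2) ≠ ⊤) :
    ∃ U ψ ψ', IsParametrization K Γ k (proj K Γ '' {x : Model K n | (x : Ambient n) ∈ A}) U ψ ψ' ∧
    ∫⁻ z in T ⁻¹' A, ENNReal.ofReal κ * f (quad K (T z)) ≤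
    (∑' j, ∫⁻ u in U j, ENNReal.ofReal (Real.sqrt (gram K (ψ' j u)).det)) *
        ∫⁻ r in Ioi (0 : ℝ), ENNReal.ofReal (r ^ k) * f (r ^ 2) := by
  classical
  -- the two hyperplanes `z₀ = ± 1` are the charts `0` and `1`; the others are empty
  let U : ℕ → Set (EuclideanSpace ℝ (Fin k)) := fun j =>
    {u | j < 2 ∧ ((-1 : ℝ) ^ j) • T (1, u) ∈ A}
  let φ := gnomonic K T
  have hT0 : ∀ u, T (1, u) ≠ 0 := by
    intro u h
    have := hA.left_inv (1, u)
    rw [h, map_zero] at this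
    exact zero_ne_one (congrArg Prod.fst this)
  have hpow : ∀ j : ℕ, (-1 : ℝ) ^ j ≠ 0 := fun j => pow_ne_zero _ (by norm_num)
  have hpow2 : ∀ j : ℕ, ((-1 : ℝ) ^ j) ^ 2 = 1 := fun j => by
    rw [← pow_mul, mul_comm, pow_mul]; simp
  have hq : ∀ j, ∀ u ∈ U j, 0 < quad K (T (1, u)) := by
    intro j u hu
    have := hA.quad_pos _ hu.2 (smul_ne_zero (hpow j) (hT0 u))
    rwa [quad_smul, hpow2, one_mul] at this
  have hφA : ∀ j, ∀ u ∈ U j, φ j u ∈ A := by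
    intro j u hu
    have h := hA.smul_mem (Real.sqrt (quad K (T (1, u))))⁻¹
      (inv_pos.2 (Real.sqrt_pos.2 (hq j u hu))) _ hu.2
    rwa [smul_smul, ← div_eq_inv_mul] at h
  have hφ1 : ∀ j, ∀ u ∈ U j, quad K (φ j u) = 1 := by
    intro j u hu
    have h := hq j u hu
    simp only [φ, gnomonic, quad_smul, div_pow, hpow2, Real.sq_sqrt h.le]
    field_simp
  have hφm : ∀ j, ∀ u ∈ U j, φ j u ∈ modelSet K n := by
    intro j u hu
    refine ⟨hφ1 j u hu, fun hK => hA.fst_pos hK _ (hφA j u hu) fun h => ?_⟩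
    have := hφ1 j u hu
    rw [h] at this
    simp [quad] at this
  have hφd : ∀ j, ∀ u ∈ U j, DifferentiableAt ℝ (φ j) u := by
    intro j u hu
    have h1 : DifferentiableAt ℝ (fun u : EuclideanSpace ℝ (Fin k) => T (1, u)) u :=
      T.differentiableAt.comp u ((differentiableAt_const _).prodMk differentiableAt_id)
    have h2 : DifferentiableAt ℝ (fun u : EuclideanSpace ℝ (Fin k) => quad K (T (1, u))) u :=
      (hasFDerivAt_quad K _).differentiableAt.comp u h1
    have h3 : DifferentiableAt ℝ (fun u : EuclideanSpace ℝ (Fin k) =>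
        (-1 : ℝ) ^ j / Real.sqrt (quad K (T (1, u)))) u := by
      simp only [div_eq_mul_inv]
      exact ((h2.sqrt (hq j u hu).ne').fun_inv (Real.sqrt_pos.2 (hq j u hu)).ne').const_mul _
    exact h3.smul h1
  let ψ : ℕ → EuclideanSpace ℝ (Fin k) → Model K n := fun j u =>
    if h : φ j u ∈ modelSet K n then ⟨φ j u, h⟩ else ⟨(1, 0), basepoint_mem K n⟩
  have hψφ : ∀ j, ∀ u ∈ U j, (ψ j u : Ambient n) = φ j u := by
    intro j u hu
    simp only [ψ, dif_pos (hφm j u hu)]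
  have hU : ∀ j, MeasurableSet (U j) := by
    intro j
    by_cases hj : j < 2
    · have : U j = (fun u => ((-1 : ℝ) ^ j) • T (1, u)) ⁻¹' A := by
        ext u; exact ⟨fun h => h.2, fun h => ⟨hj, h⟩⟩
      rw [this]
      refine (hA.closed.preimage ?_).measurableSet
      fun_prop
    · have : U j = ∅ := Set.eq_empty_of_forall_notMem fun u hu => hj hu.1
      rw [this]; exact MeasurableSet.empty
  have hd : ∀ j, ∀ u ∈ U j, HasFDerivWithinAt (φ j) (fderiv ℝ (φ j) u) (U j) u := fun j u hu =>
    (hφd j u hu).hasFDerivAt.hasFDerivWithinAt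
  have hinj : ∀ i j, ∀ u ∈ U i, ∀ w ∈ U j, φ i u = φ j w → i = j ∧ u = w := by
    intro i j u hu w hw h
    have hu' := Real.sqrt_pos.2 (hq i u hu)
    have hw' := Real.sqrt_pos.2 (hq j w hw)
    have h1 := congrArg S h
    simp only [φ, gnomonic, map_smul, hA.left_inv] at h1
    have h2 := congrArg Prod.fst h1
    have h3 := congrArg Prod.snd h1
    simp only [Prod.smul_fst, Prod.smul_snd, smul_eq_mul, mul_one] at h2 h3
    have hi := hu.1
    have hj := hw.1
    have hij : i = j := by
      have e : ∀ a b : ℝ, 0 < a → 0 < b → 1 / a ≠ -1 / b := by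
        intro a b ha hb hab
        have h5 : 0 < 1 / a := by positivity
        have h6 : -1 / b < 0 := div_neg_of_neg_of_pos (by norm_num) hb
        linarith
      interval_cases i <;> interval_cases j <;> try rfl
      · simp only [pow_zero, pow_one] at h2
        exact absurd h2 (e _ _ hu' hw')
      · simp only [pow_zero, pow_one] at h2
        exact absurd h2.symm (e _ _ hw' hu')
    refine ⟨hij, ?_⟩
    rw [h2] at h3
    exact smul_right_injective _ (div_ne_zero (hpow j) hw'.ne') h3
  refine ⟨U, ψ, fun j u => fderiv ℝ (φ j) u, ⟨hU, ?_, ?_, ?_⟩, ?_⟩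
  · intro j u hu
    exact (hd j u hu).congr (fun w hw => hψφ j w hw) (hψφ j u hu)
  · intro j u hu
    refine ⟨ψ j u, ?_, rfl⟩
    change (ψ j u : Ambient n) ∈ A
    rw [hψφ j u hu]
    exact hφA j u hu
  · intro i j u hu w hw h
    have h1 := hA.injOn (by change (ψ i u : Ambient n) ∈ A; rw [hψφ i u hu]; exact hφA i u hu)
      (by change (ψ j w : Ambient n) ∈ A; rw [hψφ j w hw]; exact hφA j w hw) h
    refine hinj i j u hu w hw ?_
    rw [← hψφ i u hu, ← hψφ j w hw, h1]
  · have hone := fun j => lintegral_coneMap hA.κ_nonneg hA.sqrt_det (hU j) (hd j)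
      (hφm j) (fun u hu => hA.right_inv _ (hφA j u hu))
      (fun u hu w hw h => (hinj j j u hu w hw h).2) hf hC
    have hsub : T ⁻¹' A \ {z | z.1 = 0} ⊆ ⋃ j, coneMap S (φ j) '' (Ioi (0 : ℝ) ×ˢ U j) := by
      rintro z ⟨hz, hz0⟩
      have hz0' : z.1 ≠ 0 := hz0
      obtain ⟨j, hj, hjz⟩ : ∃ j : ℕ, j < 2 ∧ |z.1| * (-1) ^ j = z.1 := by
        rcases lt_or_gt_of_ne hz0' with h | h
        · exact ⟨1, by norm_num, by rw [abs_of_neg h]; ring⟩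
        · exact ⟨0, by norm_num, by rw [abs_of_pos h]; ring⟩
      set u := z.1⁻¹ • z.2 with hu
      have hzu : z = z.1 • ((1, u) : Ambient k) := by
        refine Prod.ext (by simp) ?_
        simp [hu, hz0']
      have hAu : ((-1 : ℝ) ^ j) • T (1, u) ∈ A := by
        have h := hA.smul_mem |z.1|⁻¹ (inv_pos.2 (abs_pos.2 hz0')) _ hz
        have h2 : |z.1|⁻¹ • T z = ((-1 : ℝ) ^ j) • T (1, u) := by
          conv_lhs => rw [hzu, map_smul, smul_smul]
          congr 1
          have := abs_pos.2 hz0'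
          nth_rewrite 2 [← hjz]
          field_simp
          simpa using hz0'
        rwa [h2] at h
      have huU : u ∈ U j := ⟨hj, hAu⟩
      have hs := Real.sqrt_pos.2 (hq j u huU)
      refine Set.mem_iUnion.2 ⟨j, (|z.1| * Real.sqrt (quad K (T (1, u))), u), ⟨?_, huU⟩, ?_⟩
      · exact mul_pos (abs_pos.2 hz0') hs
      · simp only [coneMap, φ, gnomonic, map_smul, hA.left_inv, smul_smul]
        conv_rhs => rw [hzu, ← hjz]
        congr 1
        field_simp
    calc ∫⁻ z in T ⁻¹' A, ENNReal.ofReal κ * f (quad K (T z))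
        = ∫⁻ z in T ⁻¹' A \ {z | z.1 = 0}, ENNReal.ofReal κ * f (quad K (T z)) := by
          refine setLIntegral_congr ?_
          exact (sdiff_null_ae_eq_self (fst_null k)).symm
      _ ≤ ∫⁻ z in ⋃ j, coneMap S (φ j) '' (Ioi (0 : ℝ) ×ˢ U j),
            ENNReal.ofReal κ * f (quad K (T z)) := lintegral_mono_set hsub
      _ ≤ ∑' j, ∫⁻ z in coneMap S (φ j) '' (Ioi (0 : ℝ) ×ˢ U j),
            ENNReal.ofReal κ * f (quad K (T z)) := lintegral_iUnion_le _ _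
      _ = ∑' j, (∫⁻ u in U j, ENNReal.ofReal (Real.sqrt (gram K (fderiv ℝ (φ j) u)).det)) *
            ∫⁻ r in Ioi (0 : ℝ), ENNReal.ofReal (r ^ k) * f (r ^ 2) :=
          tsum_congr fun j => (hone j).2.symm
      _ = _ := ENNReal.tsum_mul_right

/-- Integrals of radial functions over the cone compute the Riemannian volume of its section. -/
theorem riemannianVolume_mul (hA : IsConeOver K Γ T S κ A) (hΓ : IsSpaceFormGroup K Γ)
    {f : ℝ → ℝ≥0∞} (hf : Measurable f)
    (hC : ∫⁻ r in Ioi (0 : ℝ), ENNReal.ofReal (r ^ k) * f (r ^ 2) ≠ ⊤) :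
    riemannianVolume K Γ k (proj K Γ '' {x : Model K n | (x : Ambient n) ∈ A}) *
        ∫⁻ r in Ioi (0 : ℝ), ENNReal.ofReal (r ^ k) * f (r ^ 2) =
      ∫⁻ z in T ⁻¹' A, ENNReal.ofReal κ * f (quad K (T z)) := by
  refine le_antisymm ?_ ?_
  · simp only [riemannianVolume, ENNReal.iSup_mul]
    exact iSup_le fun U => iSup_le fun ψ => iSup_le fun ψ' => iSup_le fun h =>
      hA.sum_lintegral_le hΓ hf hC h
  · obtain ⟨U, ψ, ψ', h, hle⟩ := hA.exists_isParametrization hf hC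
    refine hle.trans ?_
    gcongr
    exact le_iSup_of_le U (le_iSup_of_le ψ (le_iSup_of_le ψ' (le_iSup_of_le h le_rfl)))

end IsConeOver

/-! ### The cone over a polyhedron -/

/-- The polyhedral cone in the ambient space whose section with the model space is the
polyhedron. -/
def polyCone {n N : ℕ} (ν : Fin N → Ambient n) : Set (Ambient n) :=
  {y | ∀ i, pairing (ν i) y ≤ 0}

theorem isClosed_polyCone {n N : ℕ} (ν : Fin N → Ambient n) : IsClosed (polyCone ν) := by
  simp only [polyCone, ofPred_forall]
  refine isClosed_iInter fun i => isClosed_le ?_ continuous_const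
  exact continuous_pairing.comp (continuous_const.prodMk continuous_id)

theorem smul_mem_polyCone {n N : ℕ} {ν : Fin N → Ambient n} {r : ℝ} (hr : 0 ≤ r) {y : Ambient n}
    (hy : y ∈ polyCone ν) : r • y ∈ polyCone ν := fun i => by
  rw [pairing_smul]
  exact mul_nonpos_of_nonneg_of_nonpos hr (hy i)

theorem normalize_mem_modelSet {K : ℝ} {n : ℕ} {y : Ambient n} (hq : 0 < quad K y)
    (hy : K ≤ 0 → 0 < y.1) : (Real.sqrt (quad K y))⁻¹ • y ∈ modelSet K n := by
  have hs := Real.sqrt_pos.2 hq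
  refine ⟨?_, fun hK => mul_pos (inv_pos.2 hs) (hy hK)⟩
  change quad K _ = 1
  rw [quad_smul, inv_pow, Real.sq_sqrt hq.le, inv_mul_cancel₀ hq.ne']

theorem norm_sq_le_of_isConvexPolyhedron {K : ℝ} {n N : ℕ} {ν : Fin N → Ambient n} {R : ℝ}
    (hR : ∀ z ∈ polyhedron K ν, ‖(z : Ambient n)‖ ≤ R) {y : Ambient n} (hy : y ∈ polyCone ν)
    (hq : 0 < quad K y) (hy1 : K ≤ 0 → 0 < y.1) : ‖y‖ ^ 2 ≤ R ^ 2 * quad K y := by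
  have hs := Real.sqrt_pos.2 hq
  have h := hR ⟨_, normalize_mem_modelSet hq hy1⟩
    (smul_mem_polyCone (inv_pos.2 hs).le hy)
  simp only [norm_smul, norm_inv, Real.norm_eq_abs, abs_of_pos hs] at h
  rw [inv_mul_le_iff₀ hs] at h
  calc ‖y‖ ^ 2 ≤ (Real.sqrt (quad K y) * R) ^ 2 := by gcongr
    _ = _ := by rw [mul_pow, Real.sq_sqrt hq.le]; ring

/-- Every ray of the cone over a compact polyhedron with interior points meets the model space. This
is clear for `K > 0`. For `K ≤ 0`, the segment from an interior point to a point of a ray that does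
not meet the model space would leave the cone over the model space, and its central projection would
go to infinity in the polyhedron. -/
theorem IsConvexPolyhedron.quad_pos {K : ℝ} {n N : ℕ} {Γ : Subgroup (Ambient n ≃L[ℝ] Ambient n)}
    {ν : Fin N → Ambient n} (hν : IsConvexPolyhedron K Γ ν) (hn : 0 < n) {y : Ambient n}
    (hy : y ∈ polyCone ν) (hy0 : y ≠ 0) : 0 < quad K y ∧ (K ≤ 0 → 0 < y.1) := by
  rcases lt_or_ge 0 K with hK | hK
  · refine ⟨?_, fun h => absurd h hK.not_ge⟩
    unfold quad
    by_cases h : y.1 = 0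
    · have h2 : y.2 ≠ 0 := fun h2 => hy0 (Prod.ext h h2)
      have := norm_pos_iff.2 h2
      positivity
    · positivity
  obtain ⟨R, hR⟩ := (hν.compact.image continuous_subtype_val).isBounded.exists_norm_le
  have hR : ∀ z ∈ polyhedron K ν, ‖(z : Ambient n)‖ ≤ R := fun z hz => hR _ ⟨z, hz, rfl⟩
  obtain ⟨x, hx⟩ := hν.interior
  have hR0 : 0 < R := by
    refine lt_of_lt_of_le (norm_pos_iff.2 ?_) (hR x fun i => (hx i).le)
    intro h
    have := x.2.2 hK
    rw [h] at this
    exact lt_irrefl _ this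
  -- without half-spaces the polyhedron would be the whole model space, which is unbounded
  have hN : Nonempty (Fin N) := by
    by_contra hN
    rw [not_nonempty_iff] at hN
    set v : Ambient n := (Real.sqrt (1 - K * (R + 1) ^ 2), EuclideanSpace.single ⟨0, hn⟩ (R + 1))
    have h1 : 0 < 1 - K * (R + 1) ^ 2 := by
      have : K * (R + 1) ^ 2 ≤ 0 := mul_nonpos_of_nonpos_of_nonneg hK (by positivity)
      linarith
    have hv2 : ‖v.2‖ = R + 1 := by
      simp only [v, PiLp.norm_single, Real.norm_eq_abs]
      exact abs_of_pos (by linarith)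
    have hv : v ∈ modelSet K n := by
      refine ⟨?_, fun _ => Real.sqrt_pos.2 h1⟩
      rw [hv2]
      simp only [v]
      rw [Real.sq_sqrt h1.le]
      ring
    have h2 := hR ⟨v, hv⟩ fun i => hN.elim i
    have h3 := norm_snd_le v
    simp only at h2
    linarith
  -- the segment from `x` to `y`, parametrized by the whole line to have a connected domain
  let c : ℝ → ℝ := fun s => max 0 (min 1 s)
  have hc : Continuous c := by fun_prop
  have hc0 : ∀ s, 0 ≤ c s := fun s => le_max_left _ _
  have hc1 : ∀ s, c s ≤ 1 := fun s => max_le zero_le_one (min_le_left _ _)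
  let z : ℝ → Ambient n := fun s => (1 - c s) • (x : Ambient n) + c s • y
  have hz : Continuous z := by fun_prop
  have hzC : ∀ s, z s ∈ polyCone ν := by
    intro s i
    simp only [z, pairing_add, pairing_smul]
    have h1 := mul_nonpos_of_nonneg_of_nonpos (sub_nonneg.2 (hc1 s)) (hx i).le
    have h2 := mul_nonpos_of_nonneg_of_nonpos (hc0 s) (hy i)
    linarith
  have hz0 : ∀ s, z s ≠ 0 := by
    intro s h
    rcases (hc1 s).lt_or_eq with h1 | h1
    · obtain ⟨i⟩ := hN
      have h2 := congrArg (pairing (ν i)) h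
      simp only [z, pairing_add, pairing_smul] at h2
      have h3 := mul_neg_of_pos_of_neg (sub_pos.2 h1) (hx i)
      have h4 := mul_nonpos_of_nonneg_of_nonpos (hc0 s) (hy i)
      have h5 : pairing (ν i) 0 = 0 := by simp [pairing]
      linarith
    · simp [z, h1] at h
      exact hy0 h
  -- the bound on the polyhedron turns the open condition into a closed one
  have hgood : {s | 0 < quad K (z s) ∧ 0 < (z s).1} =
      {s | ‖z s‖ ^ 2 ≤ R ^ 2 * quad K (z s) ∧ 0 ≤ (z s).1} := by
    ext s
    constructor
    · rintro ⟨h1, h2⟩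
      exact ⟨norm_sq_le_of_isConvexPolyhedron hR (hzC s) h1 fun _ => h2, h2.le⟩
    · rintro ⟨h1, h2⟩
      have h3 : 0 < quad K (z s) := by
        have : 0 < ‖z s‖ ^ 2 := by have := norm_pos_iff.2 (hz0 s); positivity
        exact pos_of_mul_pos_right (this.trans_le h1) (by positivity)
      refine ⟨h3, lt_of_le_of_ne h2 fun h => ?_⟩
      have : K * ‖(z s).2‖ ^ 2 ≤ 0 := mul_nonpos_of_nonpos_of_nonneg hK (by positivity)
      rw [quad, ← h] at h3
      linarith
  have hclopen : IsClopen {s | 0 < quad K (z s) ∧ 0 < (z s).1} := by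
    constructor
    · rw [hgood]
      exact (isClosed_le (by fun_prop) (((continuous_quad K n).comp hz).const_smul (R ^ 2))).inter
        (isClosed_le continuous_const (continuous_fst.comp hz))
    · exact (isOpen_lt continuous_const ((continuous_quad K n).comp hz)).inter
        (isOpen_lt continuous_const (continuous_fst.comp hz))
  have huniv := hclopen.eq_univ ⟨0, by
    have : z 0 = x := by simp [z, c]
    change 0 < quad K (z 0) ∧ 0 < (z 0).1
    rw [this, quad_eq_one x.2]
    exact ⟨one_pos, x.2.2 hK⟩⟩
  have h1 : (1 : ℝ) ∈ {s | 0 < quad K (z s) ∧ 0 < (z s).1} := huniv ▸ mem_univ _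
  have h2 : z 1 = y := by simp [z, c]
  rw [mem_ofPred_eq, h2] at h1
  exact ⟨h1.1, fun _ => h1.2⟩

/-- If the quadratic form is positive on a polyhedral cone, it is so uniformly on all nearby
cones. -/
theorem eventually_quad_ge {K : ℝ} {n N : ℕ} {ν₀ : Fin N → Ambient n}
    (h : ∀ y ∈ polyCone ν₀, y ≠ 0 → 0 < quad K y) :
    ∃ c > 0, ∀ᶠ ν in 𝓝 ν₀, ∀ y ∈ polyCone ν, c * ‖y‖ ^ 2 ≤ quad K y := by
  have hcomp : IsCompact (polyCone ν₀ ∩ Metric.sphere (0 : Ambient n) 1) :=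
    (isCompact_sphere _ _).inter_left (isClosed_polyCone ν₀)
  obtain ⟨c, hc0, hc⟩ : ∃ c > 0, ∀ y ∈ polyCone ν₀ ∩ Metric.sphere (0 : Ambient n) 1,
      c < quad K y := by
    rcases (polyCone ν₀ ∩ Metric.sphere (0 : Ambient n) 1).eq_empty_or_nonempty with he | he
    · exact ⟨1, one_pos, fun y hy => by rw [he] at hy; exact hy.elim⟩
    · obtain ⟨y₀, hy₀, hmin⟩ := hcomp.exists_isMinOn he (continuous_quad K n).continuousOn
      have hpos := h y₀ hy₀.1 (fun h0 => by
        have := hy₀.2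
        rw [h0] at this
        simp at this)
      exact ⟨quad K y₀ / 2, by positivity, fun y hy => by
        have : quad K y₀ ≤ quad K y := hmin hy
        linarith⟩
  refine ⟨c, hc0, ?_⟩
  have key : ∀ᶠ ν in 𝓝 ν₀, ∀ y ∈ Metric.sphere (0 : Ambient n) 1,
      (c < quad K y ∨ ∃ i, 0 < pairing (ν i) y) := by
    refine (isCompact_sphere (0 : Ambient n) 1).eventually_forall_of_forall_eventually
      fun y hy => ?_
    by_cases hyC : y ∈ polyCone ν₀
    · have : ∀ᶠ p : (Fin N → Ambient n) × Ambient n in 𝓝 (ν₀, y), c < quad K p.2 :=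
        ((continuous_quad K n).comp continuous_snd).continuousAt.eventually_const_lt
          (hc y ⟨hyC, hy⟩)
      exact this.mono fun p hp => Or.inl hp
    · simp only [polyCone, mem_ofPred_eq, not_forall, not_le] at hyC
      obtain ⟨i, hi⟩ := hyC
      have hcont : Continuous fun p : (Fin N → Ambient n) × Ambient n => pairing (p.1 i) p.2 :=
        Continuous.comp (f := fun p : (Fin N → Ambient n) × Ambient n => (p.1 i, p.2))
          continuous_pairing (by fun_prop)
      have : ∀ᶠ p : (Fin N → Ambient n) × Ambient n in 𝓝 (ν₀, y), 0 < pairing (p.1 i) p.2 :=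
        (hcont.tendsto (ν₀, y)).eventually_const_lt hi
      exact this.mono fun p hp => Or.inr ⟨i, hp⟩
  filter_upwards [key] with ν hν y hy
  by_cases hy0 : y = 0
  · simp [hy0, quad]
  have hn := norm_pos_iff.2 hy0
  rcases hν (‖y‖⁻¹ • y) (by simp [norm_smul, hn.ne']) with h1 | ⟨i, hi⟩
  · rw [quad_smul, inv_pow, inv_mul_eq_div, lt_div_iff₀ (by positivity)] at h1
    exact h1.le
  · rw [pairing_smul] at hi
    have := mul_nonpos_of_nonneg_of_nonpos (inv_pos.2 hn).le (hy i)
    linarith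

/-! ### Linear independence of the bounding hyperplanes -/

/-- No two bounding hyperplanes coincide. -/
theorem IsConvexPolyhedron.ne_smul {K : ℝ} {n N : ℕ} {Γ : Subgroup (Ambient n ≃L[ℝ] Ambient n)}
    {ν : Fin N → Ambient n} (hν : IsConvexPolyhedron K Γ ν) {i j : Fin N} (hij : i ≠ j) (s : ℝ) :
    ν j ≠ s • ν i := by
  intro h
  rcases lt_or_ge 0 s with hs | hs
  · obtain ⟨x, hx, hxj⟩ := hν.facets j
    have h1 := (hxj j).2 rfl
    have h2 : pairing (ν i) x < 0 := lt_of_le_of_ne (hx i) fun h => hij ((hxj i).1 h)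
    rw [h, smul_pairing] at h1
    exact (mul_neg_of_pos_of_neg hs h2).ne h1
  · obtain ⟨x, hx⟩ := hν.interior
    have h1 := hx j
    rw [h, smul_pairing] at h1
    exact (mul_nonneg_of_nonpos_of_nonpos hs (hx i).le).not_gt h1

/-- No three bounding hyperplanes belong to a pencil, since the half-spaces are irredundant. -/
theorem IsConvexPolyhedron.ne_smul_add_smul {K : ℝ} {n N : ℕ}
    {Γ : Subgroup (Ambient n ≃L[ℝ] Ambient n)} {ν : Fin N → Ambient n}
    (hν : IsConvexPolyhedron K Γ ν) {i j l : Fin N} (hij : i ≠ j) (hil : i ≠ l) (hjl : j ≠ l)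
    (s t : ℝ) : ν l ≠ s • ν i + t • ν j := by
  intro h
  have hp : ∀ x, pairing (ν l) x = s * pairing (ν i) x + t * pairing (ν j) x := fun x => by
    rw [h, add_pairing, smul_pairing, smul_pairing]
  have hfac : ∀ a, ∃ x : Ambient n, pairing (ν a) x = 0 ∧ ∀ b, b ≠ a → pairing (ν b) x < 0 := by
    intro a
    obtain ⟨x, hx, hxa⟩ := hν.facets a
    exact ⟨x, (hxa a).2 rfl, fun b hb => lt_of_le_of_ne (hx b) fun h => hb ((hxa b).1 h)⟩
  obtain ⟨x, hx⟩ := hν.interior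
  have h0 := hp x
  have hi := hx i
  have hj := hx j
  have hl := hx l
  rcases le_or_gt s 0 with hs | hs <;> rcases le_or_gt t 0 with ht | ht
  · nlinarith
  · obtain ⟨y, hy, hy'⟩ := hfac j
    have h1 := hp y
    rw [hy, mul_zero, add_zero] at h1
    have h2 := hy' i hij
    have h3 := hy' l hjl.symm
    nlinarith
  · obtain ⟨y, hy, hy'⟩ := hfac i
    have h1 := hp y
    rw [hy, mul_zero, zero_add] at h1
    have h2 := hy' j hij.symm
    have h3 := hy' l hil.symm
    nlinarith
  · obtain ⟨y, hy, hy'⟩ := hfac l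
    have h1 := hp y
    rw [hy] at h1
    have h2 := mul_neg_of_pos_of_neg hs (hy' i hil)
    have h3 := mul_neg_of_pos_of_neg ht (hy' j hjl)
    linarith

/-- If `b` is not a multiple of `a`, it does not vanish on the hyperplane `a = 0`. -/
theorem exists_pairing_eq {n : ℕ} {a b : Ambient n} (h : ∀ s : ℝ, b ≠ s • a) :
    ∃ e, pairing a e = 0 ∧ pairing b e = 1 := by
  set e := b + (-(pairing a b / pairing a a)) • a with he
  have he0 : e ≠ 0 := fun h0 => h (pairing a b / pairing a a) (by
    rwa [he, neg_smul, ← sub_eq_add_neg, sub_eq_zero] at h0)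
  have h1 : pairing a e = 0 := by
    by_cases ha : a = 0
    · simp [ha, pairing]
    · have := pairing_self_pos ha
      rw [he, pairing_add, pairing_smul]
      field_simp
      ring
  have h2 : pairing b e = pairing e e := by
    have : pairing e e = pairing b e + (-(pairing a b / pairing a a)) * pairing a e := by
      conv_lhs => rw [he, add_pairing, smul_pairing, ← he]
    rw [this, h1, mul_zero, add_zero]
  have h3 := pairing_self_pos he0
  refine ⟨(pairing e e)⁻¹ • e, by rw [pairing_smul, h1, mul_zero], ?_⟩
  rw [pairing_smul, h2, inv_mul_cancel₀ h3.ne']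

theorem exists_pairing_eq₂ {n : ℕ} {a b c : Ambient n} (hab : ∀ s : ℝ, b ≠ s • a)
    (h : ∀ s t : ℝ, c ≠ s • a + t • b) :
    ∃ e, pairing a e = 0 ∧ pairing b e = 0 ∧ pairing c e = 1 := by
  obtain ⟨f, hf1, hf2⟩ := exists_pairing_eq hab
  set c' := c + (-(pairing c f)) • b with hc'
  have h1 : ∀ s : ℝ, c' ≠ s • a := by
    intro s hs
    refine h s (pairing c f) ?_
    rw [← hs, hc', neg_smul]
    simp
  obtain ⟨e, he1, he2⟩ := exists_pairing_eq h1
  refine ⟨e + (-(pairing b e)) • f, ?_, ?_, ?_⟩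
  · rw [pairing_add, pairing_smul, he1, hf1]; simp
  · rw [pairing_add, pairing_smul, hf2]; simp
  · rw [pairing_add, pairing_smul]
    rw [hc', add_pairing, smul_pairing] at he2
    linarith

/-! ### Smoothed indicator functions and radial weights -/

/-- A smooth function that is `1` on `(-∞, -1]` and `0` on `[0, ∞)`. Rescaled, it approximates the
indicator function of the negative half-line from inside. -/
def cut (x : ℝ) : ℝ := Real.smoothTransition (-x)

theorem contDiff_cut : ContDiff ℝ 2 cut :=
  Real.smoothTransition.contDiff.comp contDiff_neg

theorem continuous_cut : Continuous cut := contDiff_cut.continuous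

theorem differentiable_cut : Differentiable ℝ cut := contDiff_cut.differentiable (by norm_num)

theorem contDiff_deriv_cut : ContDiff ℝ 1 (deriv cut) :=
  (contDiff_succ_iff_deriv (n := 1).1 contDiff_cut).2.2

theorem continuous_deriv_cut : Continuous (deriv cut) := contDiff_deriv_cut.continuous

theorem cut_nonneg (x : ℝ) : 0 ≤ cut x := Real.smoothTransition.nonneg _

theorem cut_le_one (x : ℝ) : cut x ≤ 1 := Real.smoothTransition.le_one _

theorem cut_of_nonneg {x : ℝ} (hx : 0 ≤ x) : cut x = 0 :=
  Real.smoothTransition.zero_of_nonpos (by linarith)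

theorem cut_of_le {x : ℝ} (hx : x ≤ -1) : cut x = 1 :=
  Real.smoothTransition.one_of_one_le (by linarith)

theorem deriv_cut_of_nonneg {x : ℝ} (hx : 0 ≤ x) : deriv cut x = 0 := by
  refine IsLocalMin.deriv_eq_zero (Eventually.of_forall fun y => ?_)
  rw [cut_of_nonneg hx]
  exact cut_nonneg y

theorem deriv_cut_of_le {x : ℝ} (hx : x ≤ -1) : deriv cut x = 0 := by
  refine IsLocalMax.deriv_eq_zero (Eventually.of_forall fun y => ?_)
  rw [cut_of_le hx]
  exact cut_le_one y

theorem deriv_cut_support {x : ℝ} (hx : deriv cut x ≠ 0) : -1 < x ∧ x < 0 :=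
  ⟨not_le.1 fun h => hx (deriv_cut_of_le h), not_le.1 fun h => hx (deriv_cut_of_nonneg h)⟩

theorem hasCompactSupport_deriv_cut : HasCompactSupport (deriv cut) :=
  HasCompactSupport.intro (isCompact_Icc (a := (-1 : ℝ)) (b := 0)) fun x hx => by
    by_contra h
    have := deriv_cut_support h
    exact hx ⟨this.1.le, this.2.le⟩

theorem exists_abs_deriv_cut_le : ∃ C, ∀ x, |deriv cut x| ≤ C :=
  hasCompactSupport_deriv_cut.exists_bound_of_continuous continuous_deriv_cut

theorem integral_deriv_cut : ∫ x, deriv cut x = -1 := by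
  have h1 : ∫ x, deriv cut x = ∫ x in Ioc (-1 : ℝ) 0, deriv cut x :=
    (setIntegral_eq_integral_of_forall_compl_eq_zero fun x hx => by
      by_contra h
      have := deriv_cut_support h
      exact hx ⟨this.1, this.2.le⟩).symm
  rw [h1, ← intervalIntegral.integral_of_le (by norm_num),
    intervalIntegral.integral_deriv_eq_sub (fun x _ => differentiable_cut x)
      (continuous_deriv_cut.intervalIntegrable _ _), cut_of_nonneg le_rfl, cut_of_le le_rfl]
  norm_num

/-- The rescaled cutoff converges to the indicator function of the negative half-line. -/
theorem tendsto_cut_div {ι : Type*} {l : Filter ι} {ε b : ι → ℝ} {b₀ : ℝ}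
    (hε : Tendsto ε l (𝓝[>] 0)) (hb : Tendsto b l (𝓝 b₀)) (hb₀ : b₀ ≠ 0) :
    Tendsto (fun x => cut (b x / ε x)) l (𝓝 (if b₀ < 0 then 1 else 0)) := by
  have hε0 : Tendsto ε l (𝓝 0) := hε.mono_right nhdsWithin_le_nhds
  have hεpos : ∀ᶠ x in l, 0 < ε x := hε.eventually self_mem_nhdsWithin
  split_ifs with h
  · refine tendsto_const_nhds.congr' ?_
    have h1 : ∀ᶠ x in l, b x < b₀ / 2 := hb.eventually_lt_const (by linarith)
    have h2 : ∀ᶠ x in l, ε x < -(b₀ / 2) := hε0.eventually_lt_const (by linarith)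
    filter_upwards [hεpos, h1, h2] with x hx h1 h2
    refine (cut_of_le ?_).symm
    rw [div_le_iff₀ hx]
    linarith
  · have hpos : 0 < b₀ := lt_of_le_of_ne (not_lt.1 h) hb₀.symm
    refine tendsto_const_nhds.congr' ?_
    filter_upwards [hεpos, hb.eventually_const_lt hpos] with x hx h1
    exact (cut_of_nonneg (div_pos h1 hx).le).symm

/-- A smooth non-increasing function on the line that is `1` on `(-∞, 1]` and `0` on `[2, ∞)`. -/
def weight (x : ℝ) : ℝ := cut (x - 2)

/-- The weight `-2 g'` that belongs to the weight `g`. -/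
def weightD (x : ℝ) : ℝ := -2 * deriv cut (x - 2)

theorem continuous_weight : Continuous weight := continuous_cut.comp (by fun_prop)

theorem continuous_weightD : Continuous weightD :=
  continuous_const.mul (continuous_deriv_cut.comp (by fun_prop))

theorem hasDerivAt_weight (x : ℝ) : HasDerivAt weight (-(1 / 2) * weightD x) x := by
  have h := (differentiable_cut (x - 2)).hasDerivAt.comp_sub_const x 2
  refine h.congr_deriv ?_
  rw [weightD]; ring

theorem weight_nonneg (x : ℝ) : 0 ≤ weight x := cut_nonneg _

theorem antitone_cut : Antitone cut := fun _ _ h => Real.smoothTransition.monotone (neg_le_neg h)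

theorem weightD_nonneg (x : ℝ) : 0 ≤ weightD x := by
  have : deriv cut (x - 2) ≤ 0 := antitone_cut.deriv_nonpos
  rw [weightD]; linarith

theorem weight_support {x : ℝ} (h : weight x ≠ 0) : x ≤ 2 := by
  by_contra hx
  exact h (cut_of_nonneg (by linarith))

theorem weightD_support {x : ℝ} (h : weightD x ≠ 0) : x ≤ 2 := by
  by_contra hx
  exact h (by rw [weightD, deriv_cut_of_nonneg (by linarith), mul_zero])

theorem weight_eq_one {x : ℝ} (h : x ≤ 1) : weight x = 1 := cut_of_le (by linarith)

/-! ### Linear changes of variables -/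

theorem integral_eq_abs_det_smul {E G : Type*} [NormedAddCommGroup E] [NormedSpace ℝ E]
    [FiniteDimensional ℝ E] [MeasurableSpace E] [BorelSpace E] [NormedAddCommGroup G]
    [NormedSpace ℝ G] (μ : Measure E) [μ.IsAddHaarMeasure] {R : E →ₗ[ℝ] E}
    (hR : LinearMap.det R ≠ 0) (F : E → G) :
    ∫ y, F y ∂μ = |LinearMap.det R| • ∫ y, F (R y) ∂μ := by
  have h1 := Measure.map_linearMap_addHaar_eq_smul_addHaar μ hR
  let e : E ≃L[ℝ] E := (LinearMap.equivOfDetNeZero R hR).toContinuousLinearEquiv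
  have h2 : MeasurableEmbedding (R : E → E) := e.toHomeomorph.measurableEmbedding
  rw [← h2.integral_map, h1, integral_smul_measure, ENNReal.toReal_ofReal (abs_nonneg _),
    smul_smul, abs_inv, mul_inv_cancel₀ (abs_ne_zero.2 hR), one_smul]

theorem integrable_of_continuous_of_norm_le {E G : Type*} [NormedAddCommGroup E] [NormedSpace ℝ E]
    [FiniteDimensional ℝ E] [MeasurableSpace E] [BorelSpace E] [NormedAddCommGroup G]
    (μ : Measure E) [IsFiniteMeasureOnCompacts μ] {F : E → G} (hF : Continuous F)
    {ρ : ℝ} (h : ∀ y, F y ≠ 0 → ‖y‖ ≤ ρ) : Integrable F μ := by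
  have : ProperSpace E := FiniteDimensional.proper ℝ E
  refine hF.integrable_of_hasCompactSupport
    (HasCompactSupport.intro (isCompact_closedBall (0 : E) ρ) fun y hy => ?_)
  by_contra hne
  exact hy (mem_closedBall_zero_iff.2 (h y hne))

section

variable {K : ℝ} {n N : ℕ}

/-! ### First variation of the volume -/

/-- The integral over the polyhedral cone of the radial weight `weightD`. It is a multiple of the
volume of the polyhedron. -/
def coneVol (K : ℝ) (ν : Fin N → Ambient n) : ℝ := ∫ y in polyCone ν, weightD (quad K y)

/-- The smoothed version of `coneVol`. -/
def smoothVol (K ε : ℝ) (ν : Fin N → Ambient n) : ℝ :=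
  ∫ y : Ambient n, weightD (quad K y) * ∏ i, cut (pairing (ν i) y / ε)

/-- A smooth density concentrated near the intersection of the facets in the hyperplanes `s`: the
smoothed indicator function of the cone, differentiated once in each of the variables
`⟨νᵢ, y⟩`, `i ∈ s`. -/
def faceDensity (s : Finset (Fin N)) (ε : ℝ) (ν : Fin N → Ambient n) (y : Ambient n) : ℝ :=
  (∏ i ∈ s, ε⁻¹ * deriv cut (pairing (ν i) y / ε)) * ∏ i ∈ sᶜ, cut (pairing (ν i) y / ε)

theorem faceDensity_support {s : Finset (Fin N)} {ε : ℝ} (hε : 0 < ε) {ν : Fin N → Ambient n}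
    {y : Ambient n} (h : faceDensity s ε ν y ≠ 0) : y ∈ polyCone ν := by
  intro i
  by_contra hi
  apply h
  have hpos : 0 ≤ pairing (ν i) y / ε := (div_pos (not_le.1 hi) hε).le
  rw [faceDensity]
  by_cases his : i ∈ s
  · rw [Finset.prod_eq_zero his, zero_mul]
    rw [deriv_cut_of_nonneg hpos, mul_zero]
  · rw [Finset.prod_eq_zero (Finset.mem_compl.2 his) (cut_of_nonneg hpos), mul_zero]

theorem faceDensity_empty (ε : ℝ) (ν : Fin N → Ambient n) (y : Ambient n) :
    faceDensity ∅ ε ν y = ∏ i, cut (pairing (ν i) y / ε) := by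
  simp [faceDensity]

theorem continuous_faceDensity (s : Finset (Fin N)) (ε : ℝ) :
    Continuous fun p : (Fin N → Ambient n) × Ambient n => faceDensity s ε p.1 p.2 := by
  have h : ∀ i, Continuous fun p : (Fin N → Ambient n) × Ambient n =>
      pairing (p.1 i) p.2 / ε := fun i =>
    (Continuous.comp (f := fun p : (Fin N → Ambient n) × Ambient n => (p.1 i, p.2))
          continuous_pairing (by fun_prop)).div_const ε
  unfold faceDensity
  exact (continuous_finsetProd _ fun i _ =>
    continuous_const.mul (continuous_deriv_cut.comp (h i))).mul
    (continuous_finsetProd _ fun i _ => continuous_cut.comp (h i))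

theorem continuous_faceDensity_right (s : Finset (Fin N)) (ε : ℝ) (ν : Fin N → Ambient n) :
    Continuous (faceDensity s ε ν) :=
  Continuous.comp (f := fun y : Ambient n => (ν, y)) (continuous_faceDensity s ε) (by fun_prop)

theorem norm_le_of_quad_le {c : ℝ} (hc : 0 < c) {y : Ambient n} (h : c * ‖y‖ ^ 2 ≤ quad K y)
    (h2 : quad K y ≤ 2) : ‖y‖ ≤ Real.sqrt (2 / c) := by
  apply Real.le_sqrt_of_sq_le
  rw [le_div_iff₀ hc]
  linarith

/-- The functional `δ ↦ ⟨δ i, y⟩` on variations of the half-spaces. -/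
def variationAt (i : Fin N) (y : Ambient n) : (Fin N → Ambient n) →L[ℝ] ℝ :=
  (pairingL y).comp (ContinuousLinearMap.proj i)

theorem variationAt_apply (i : Fin N) (y : Ambient n) (δ : Fin N → Ambient n) :
    variationAt i y δ = pairing (δ i) y := by
  simp [variationAt, pairing_comm]

theorem continuous_variationAt (i : Fin N) :
    Continuous fun y : Ambient n => (variationAt i y : (Fin N → Ambient n) →L[ℝ] ℝ) := by
  have h : Continuous fun y : Ambient n => (pairingL y : Ambient n →L[ℝ] ℝ) := by
    unfold pairingL; fun_prop
  exact h.clm_comp continuous_const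

/-- The derivative of the integrand of `smoothVol` with respect to the half-space `i`. -/
def smoothVolDeriv (K ε : ℝ) (i : Fin N) (ν : Fin N → Ambient n) (y : Ambient n) :
    (Fin N → Ambient n) →L[ℝ] ℝ :=
  (weightD (quad K y) * faceDensity {i} ε ν y) • variationAt i y

theorem continuous_smoothVolDeriv (K ε : ℝ) (i : Fin N) :
    Continuous fun p : (Fin N → Ambient n) × Ambient n => smoothVolDeriv K ε i p.1 p.2 :=
  ((continuous_weightD.comp ((continuous_quad K n).comp continuous_snd)).mul
    (continuous_faceDensity _ _)).smul ((continuous_variationAt i).comp continuous_snd)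

theorem continuous_smoothVolDeriv_right (K ε : ℝ) (i : Fin N) (ν : Fin N → Ambient n) :
    Continuous (smoothVolDeriv K ε i ν) :=
  Continuous.comp (f := fun y : Ambient n => (ν, y)) (continuous_smoothVolDeriv K ε i) (by fun_prop)

theorem hasFDerivAt_smoothVol_integrand (K ε : ℝ) (ν : Fin N → Ambient n) (y : Ambient n) :
    HasFDerivAt (fun ν : Fin N → Ambient n =>
      weightD (quad K y) * ∏ i, cut (pairing (ν i) y / ε)) (∑ i, smoothVolDeriv K ε i ν y) ν := by
  have h1 : ∀ i ∈ (Finset.univ : Finset (Fin N)),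
      HasFDerivAt (fun ν : Fin N → Ambient n => cut (pairing (ν i) y / ε))
      ((ε⁻¹ * deriv cut (pairing (ν i) y / ε)) • variationAt i y) ν := by
    intro i _
    have h2 : HasFDerivAt (fun ν : Fin N → Ambient n => pairing (ν i) y / ε)
        (ε⁻¹ • variationAt i y) ν := by
      have h3 := ((variationAt i y : (Fin N → Ambient n) →L[ℝ] ℝ).hasFDerivAt (x := ν)).const_smul
        ε⁻¹
      refine h3.congr_of_eventuallyEq (Eventually.of_forall fun ν => ?_)
      simp only [Pi.smul_apply, variationAt_apply, smul_eq_mul]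
      ring
    have h3 := (differentiable_cut (pairing (ν i) y / ε)).hasDerivAt.comp_hasFDerivAt ν h2
    refine h3.congr_fderiv ?_
    rw [smul_smul, mul_comm]
  refine ((HasFDerivAt.finsetProd h1).const_mul (weightD (quad K y))).congr_fderiv ?_
  rw [Finset.smul_sum]
  refine Finset.sum_congr rfl fun i _ => ?_
  rw [smoothVolDeriv, faceDensity, Finset.prod_singleton, smul_smul, smul_smul,
    Finset.compl_singleton]
  congr 1
  ring

/-- The cutoff function is differentiated under the integral sign. All integrands are supported in
a fixed ball as long as the quadratic form is positive on the cones. -/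
theorem hasFDerivAt_smoothVol {c : ℝ} (hc : 0 < c) {ν₀ : Fin N → Ambient n}
    (h₀ : ∀ᶠ ν in 𝓝 ν₀, ∀ y ∈ polyCone ν, c * ‖y‖ ^ 2 ≤ quad K y) :
    ∀ᶠ ν in 𝓝 ν₀, ∀ ε > 0, HasFDerivAt (smoothVol K ε)
      (∑ i, ∫ y, smoothVolDeriv K ε i ν y) ν := by
  obtain ⟨r, hr, hball⟩ := Metric.eventually_nhds_iff_ball.1 h₀
  have hsmall : ∀ ν ∈ Metric.closedBall ν₀ (r / 2), ∀ y ∈ polyCone ν, c * ‖y‖ ^ 2 ≤ quad K y :=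
    fun ν hν => hball ν (Metric.closedBall_subset_ball (by linarith) hν)
  filter_upwards [Metric.ball_mem_nhds ν₀ (half_pos hr)] with ν hν ε hε
  set ρ := Real.sqrt (2 / c) with hρ
  have hsupp : ∀ ν ∈ Metric.closedBall ν₀ (r / 2), ∀ i y,
      smoothVolDeriv K ε i ν y ≠ 0 → ‖y‖ ≤ ρ := by
    intro ν hν i y h
    have h1 : weightD (quad K y) * faceDensity {i} ε ν y ≠ 0 := fun h0 => h (by
      rw [smoothVolDeriv, h0, zero_smul])
    exact norm_le_of_quad_le hc (hsmall ν hν y (faceDensity_support hε (right_ne_zero_of_mul h1)))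
      (weightD_support (left_ne_zero_of_mul h1))
  have hcontF : ∀ ν : Fin N → Ambient n, Continuous fun y : Ambient n =>
      weightD (quad K y) * ∏ i, cut (pairing (ν i) y / ε) := by
    intro ν
    simp only [← faceDensity_empty]
    exact (continuous_weightD.comp (continuous_quad K n)).mul
      (continuous_faceDensity_right ∅ ε ν)
  have hcontF' : ∀ i, Continuous fun y : Ambient n => smoothVolDeriv K ε i ν y := fun i =>
    continuous_smoothVolDeriv_right K ε i ν
  have hK : IsCompact (Metric.closedBall ν₀ (r / 2) ×ˢ Metric.closedBall (0 : Ambient n) ρ) :=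
    (isCompact_closedBall _ _).prod (isCompact_closedBall _ _)
  obtain ⟨M, hM⟩ := hK.exists_bound_of_continuousOn
    (f := fun p => ∑ i, smoothVolDeriv K ε i p.1 p.2)
    (continuous_finsetSum _ fun i _ => continuous_smoothVolDeriv K ε i).continuousOn
  have hmem := Metric.ball_subset_closedBall hν
  have hsum : ∑ i, ∫ y, smoothVolDeriv K ε i ν y = ∫ y, ∑ i, smoothVolDeriv K ε i ν y :=
    (integral_finsetSum _ fun i _ =>
      integrable_of_continuous_of_norm_le volume (hcontF' i) (hsupp ν hmem i)).symm
  rw [hsum]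
  refine hasFDerivAt_integral_of_dominated_of_fderiv_le (s := Metric.ball ν₀ (r / 2))
    (bound := (Metric.closedBall (0 : Ambient n) ρ).indicator fun _ => M)
    (F' := fun ν y => ∑ i, smoothVolDeriv K ε i ν y)
    (Metric.isOpen_ball.mem_nhds hν) ?_ ?_ ?_ ?_ ?_ ?_
  · exact Eventually.of_forall fun ν => (hcontF ν).aestronglyMeasurable
  · refine integrable_of_continuous_of_norm_le (ρ := ρ) volume (hcontF ν) fun y hy => ?_
    rw [← faceDensity_empty] at hy
    exact norm_le_of_quad_le hc
      (hsmall ν hmem y (faceDensity_support hε (right_ne_zero_of_mul hy)))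
      (weightD_support (left_ne_zero_of_mul hy))
  · exact (continuous_finsetSum _ fun i _ => hcontF' i).aestronglyMeasurable
  · refine Eventually.of_forall fun y μ hμ => ?_
    have hμ' := Metric.ball_subset_closedBall hμ
    by_cases hy : y ∈ Metric.closedBall (0 : Ambient n) ρ
    · rw [indicator_of_mem hy]
      exact hM (μ, y) ⟨hμ', hy⟩
    · rw [indicator_of_notMem hy, Finset.sum_eq_zero, norm_zero]
      intro i _
      by_contra h
      exact hy (mem_closedBall_zero_iff.2 (hsupp μ hμ' i y h))
  · exact (integrable_indicator_iff measurableSet_closedBall).2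
      (integrableOn_const (measure_closedBall_lt_top.ne))
  · exact Eventually.of_forall fun y μ _ => hasFDerivAt_smoothVol_integrand K ε μ y

theorem ae_ne_zero_of_ne_zero {E : Type*} [NormedAddCommGroup E] [NormedSpace ℝ E]
    [FiniteDimensional ℝ E] [MeasurableSpace E] [BorelSpace E] (μ : Measure E) [μ.IsAddHaarMeasure]
    {φ : E →L[ℝ] ℝ} (hφ : φ ≠ 0) : ∀ᵐ y ∂μ, φ y ≠ 0 := by
  have h := Measure.addHaar_submodule μ (LinearMap.ker φ.toLinearMap) (fun h => hφ (by
    ext y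
    have h1 : y ∈ LinearMap.ker φ.toLinearMap := by rw [h]; trivial
    simpa using h1))
  rw [ae_iff]
  convert h using 2
  ext y
  simp

theorem ae_pairing_ne_zero {a : Ambient n} (ha : a ≠ 0) : ∀ᵐ y : Ambient n, pairing a y ≠ 0 := by
  have h := ae_ne_zero_of_ne_zero volume (φ := (pairingL a : Ambient n →L[ℝ] ℝ)) fun h =>
    (pairing_self_pos ha).ne' (by rw [← pairingL_apply, h]; rfl)
  simpa only [pairingL_apply] using h

theorem norm_prod_cut_le (s : Finset (Fin N)) (x : Fin N → ℝ) : ‖∏ i ∈ s, cut (x i)‖ ≤ 1 := by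
  rw [Real.norm_eq_abs, Finset.abs_prod]
  refine Finset.prod_le_one (fun _ _ => abs_nonneg _) fun i _ => ?_
  rw [abs_of_nonneg (cut_nonneg _)]
  exact cut_le_one _

theorem tendsto_smoothVol {c : ℝ} (hc : 0 < c) {ν : Fin N → Ambient n}
    (h : ∀ y ∈ polyCone ν, c * ‖y‖ ^ 2 ≤ quad K y) (hν : ∀ i, ν i ≠ 0) :
    Tendsto (fun ε => smoothVol K ε ν) (𝓝[>] 0) (𝓝 (coneVol K ν)) := by
  have hae : ∀ᵐ y : Ambient n, ∀ i, pairing (ν i) y ≠ 0 :=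
    ae_all_iff.2 fun i => ae_pairing_ne_zero (hν i)
  have e : coneVol K ν = ∫ y, weightD (quad K y) * ∏ i, if pairing (ν i) y < 0 then 1 else 0 := by
    rw [coneVol, ← integral_indicator (isClosed_polyCone ν).measurableSet]
    refine integral_congr_ae ?_
    filter_upwards [hae] with y hy
    by_cases hyC : y ∈ polyCone ν
    · rw [indicator_of_mem hyC, Finset.prod_eq_one, mul_one]
      intro i _
      exact if_pos (lt_of_le_of_ne (hyC i) (hy i))
    · rw [indicator_of_notMem hyC]
      simp only [polyCone, mem_ofPred_eq, not_forall, not_le] at hyC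
      obtain ⟨i, hi⟩ := hyC
      rw [Finset.prod_eq_zero (Finset.mem_univ i) (if_neg hi.not_gt), mul_zero]
  rw [e]
  obtain ⟨M, hM⟩ := IsCompact.exists_bound_of_continuousOn
    (isCompact_closedBall (0 : Ambient n) (Real.sqrt (2 / c))) (f := fun y => weightD (quad K y))
    (continuous_weightD.comp (continuous_quad K n)).continuousOn
  refine tendsto_integral_filter_of_dominated_convergence
    ((Metric.closedBall (0 : Ambient n) (Real.sqrt (2 / c))).indicator fun _ => M) ?_ ?_ ?_ ?_
  · refine Eventually.of_forall fun ε => ?_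
    simp only [← faceDensity_empty]
    exact ((continuous_weightD.comp (continuous_quad K n)).mul
      (continuous_faceDensity_right ∅ ε ν)).aestronglyMeasurable
  · filter_upwards [self_mem_nhdsWithin] with ε hε
    refine Eventually.of_forall fun y => ?_
    by_cases hy : y ∈ Metric.closedBall (0 : Ambient n) (Real.sqrt (2 / c))
    · rw [indicator_of_mem hy, norm_mul]
      have h1 := hM y hy
      have h2 := norm_prod_cut_le Finset.univ fun i => pairing (ν i) y / ε
      calc _ ≤ M * 1 := mul_le_mul h1 h2 (norm_nonneg _) ((norm_nonneg _).trans h1)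
        _ = M := mul_one M
    · rw [indicator_of_notMem hy]
      refine (norm_eq_zero.2 ?_).le
      by_contra hne
      rw [← faceDensity_empty] at hne
      exact hy (mem_closedBall_zero_iff.2 (norm_le_of_quad_le hc
        (h y (faceDensity_support hε (right_ne_zero_of_mul hne)))
        (weightD_support (left_ne_zero_of_mul hne))))
  · exact (integrable_indicator_iff measurableSet_closedBall).2
      (integrableOn_const (measure_closedBall_lt_top.ne))
  · filter_upwards [hae] with y hy
    exact tendsto_const_nhds.mul (tendsto_finsetProd _ fun i _ =>
      tendsto_cut_div tendsto_id tendsto_const_nhds (hy i))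

/-- A linear map that turns the linear function `b` into `ε` times the linear function `a`, and
moves points only in the direction `e`. -/
def straighten (ε : ℝ) (a b e : Ambient n) : Ambient n →ₗ[ℝ] Ambient n :=
  LinearMap.transvection ((pairing b e)⁻¹ • (ε • (pairingL a : Ambient n →L[ℝ] ℝ).toLinearMap -
    (pairingL b : Ambient n →L[ℝ] ℝ).toLinearMap)) e

theorem straighten_apply (ε : ℝ) (a b e y : Ambient n) :
    straighten ε a b e y = y + ((pairing b e)⁻¹ * (ε * pairing a y - pairing b y)) • e := by
  simp [straighten, LinearMap.transvection.apply]

theorem pairing_straighten {ε : ℝ} {a b e : Ambient n} (hb : pairing b e ≠ 0) (y : Ambient n) :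
    pairing b (straighten ε a b e y) = ε * pairing a y := by
  rw [straighten_apply, pairing_add, pairing_smul]
  field_simp
  ring

theorem det_straighten {ε : ℝ} {a b e : Ambient n} (ha : pairing a e = 1) (hb : pairing b e ≠ 0) :
    LinearMap.det (straighten ε a b e) = ε / pairing b e := by
  rw [straighten, LinearMap.transvection.det]
  simp [ha]
  field_simp
  ring

/-- The smoothed integrals over a facet converge, jointly in the smoothing parameter and the
half-spaces. Straightening the facet and stretching the normal direction turns the integrals into
integrals over a fixed bounded region. -/
theorem exists_tendsto_smoothVolDeriv {c : ℝ} (hc : 0 < c) {ν₀ : Fin N → Ambient n}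
    (h₀ : ∀ᶠ ν in 𝓝 ν₀, ∀ y ∈ polyCone ν, c * ‖y‖ ^ 2 ≤ quad K y) {i : Fin N}
    (hi : ν₀ i ≠ 0) (hne : ∀ j, j ≠ i → ∀ s : ℝ, ν₀ j ≠ s • ν₀ i) :
    ∃ D, Tendsto (fun p : ℝ × (Fin N → Ambient n) => ∫ y, smoothVolDeriv K p.1 i p.2 y)
      (𝓝[>] 0 ×ˢ 𝓝 ν₀) (𝓝 D) := by
  obtain ⟨e, -, he⟩ := exists_pairing_eq (a := 0) (b := ν₀ i) (by simpa using hi)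
  set l : Filter (ℝ × (Fin N → Ambient n)) := 𝓝[>] 0 ×ˢ 𝓝 ν₀ with hl
  have hlfst : Tendsto Prod.fst l (𝓝[>] 0) := tendsto_fst
  have hlsnd : Tendsto Prod.snd l (𝓝 ν₀) := tendsto_snd
  have hfst0 : Tendsto (fun p : ℝ × (Fin N → Ambient n) => p.1) l (𝓝 0) :=
    hlfst.mono_right nhdsWithin_le_nhds
  have hεpos : ∀ᶠ p in l, 0 < p.1 := hlfst.eventually self_mem_nhdsWithin
  have hν : ∀ k, Tendsto (fun p : ℝ × (Fin N → Ambient n) => p.2 k) l (𝓝 (ν₀ k)) := fun k =>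
    (tendsto_pi_nhds.1 hlsnd) k
  have hpair : ∀ k, ∀ (z : ℝ × (Fin N → Ambient n) → Ambient n) (z₀ : Ambient n),
      Tendsto z l (𝓝 z₀) → Tendsto (fun p => pairing (p.2 k) (z p)) l (𝓝 (pairing (ν₀ k) z₀)) :=
    fun k z z₀ hz => (continuous_pairing.tendsto (ν₀ k, z₀)).comp ((hν k).prodMk_nhds hz)
  have hbe : Tendsto (fun p : ℝ × (Fin N → Ambient n) => pairing (p.2 i) e) l (𝓝 1) := by
    have := hpair i (fun _ => e) e tendsto_const_nhds
    rwa [he] at this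
  have hbpos : ∀ᶠ p in l, 0 < pairing (p.2 i) e := hbe.eventually_const_lt one_pos
  let R : ℝ × (Fin N → Ambient n) → Ambient n → Ambient n := fun p y =>
    straighten p.1 (ν₀ i) (p.2 i) e y
  let R₀ : Ambient n → Ambient n := fun y => y + (-(pairing (ν₀ i) y)) • e
  have hR : ∀ y, Tendsto (fun p => R p y) l (𝓝 (R₀ y)) := by
    intro y
    simp only [R, R₀, straighten_apply]
    refine tendsto_const_nhds.add (Tendsto.smul ?_ tendsto_const_nhds)
    have h1 := (hbe.inv₀ one_ne_zero).mul ((hfst0.mul_const (pairing (ν₀ i) y)).sub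
      (hpair i (fun _ => y) y tendsto_const_nhds))
    convert h1 using 2
    ring
  let J : ℝ × (Fin N → Ambient n) → Ambient n → (Fin N → Ambient n) →L[ℝ] ℝ := fun p y =>
    (weightD (quad K (R p y)) * (deriv cut (pairing (ν₀ i) y) *
      ∏ k ∈ {i}ᶜ, cut (pairing (p.2 k) (R p y) / p.1))) • variationAt i (R p y)
  let J₀ : Ambient n → (Fin N → Ambient n) →L[ℝ] ℝ := fun y =>
    (weightD (quad K (R₀ y)) * (deriv cut (pairing (ν₀ i) y) *
      ∏ k ∈ {i}ᶜ, if pairing (ν₀ k) (R₀ y) < 0 then 1 else 0)) • variationAt i (R₀ y)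
  have hpi : ∀ p, 0 < pairing (p.2 i) e → ∀ y, pairing (p.2 i) (R p y) = p.1 * pairing (ν₀ i) y :=
    fun p hp y => pairing_straighten hp.ne' y
  have hsubst : ∀ᶠ p in l, (pairing (p.2 i) e)⁻¹ • ∫ y, J p y =
      ∫ y, smoothVolDeriv K p.1 i p.2 y := by
    filter_upwards [hεpos, hbpos] with p hε hb
    have hdet := det_straighten (ε := p.1) he hb.ne'
    have hdet0 : LinearMap.det (straighten p.1 (ν₀ i) (p.2 i) e) ≠ 0 := by
      rw [hdet]; exact (div_pos hε hb).ne'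
    rw [integral_eq_abs_det_smul volume hdet0 (smoothVolDeriv K p.1 i p.2), hdet,
      abs_of_pos (div_pos hε hb), ← integral_smul, ← integral_smul]
    refine integral_congr_ae (Eventually.of_forall fun y => ?_)
    have h1 := hpi p hb y
    simp only [R] at h1
    simp only [J, R, smoothVolDeriv, faceDensity, Finset.prod_singleton, smul_smul, h1]
    congr 1
    rw [mul_div_cancel_left₀ _ hε.ne']
    field_simp
  have hae : ∀ᵐ y : Ambient n, ∀ k, k ≠ i → pairing (ν₀ k) (R₀ y) ≠ 0 := by
    refine ae_all_iff.2 fun k => ?_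
    by_cases hk : k = i
    · exact Eventually.of_forall fun y h => absurd hk h
    -- the hyperplanes `k` and `i` meet in a null set of the hyperplane `i`
    have hnz : ν₀ k + (-(pairing (ν₀ k) e)) • ν₀ i ≠ 0 := fun h => hne k hk (pairing (ν₀ k) e) (by
      rwa [neg_smul, ← sub_eq_add_neg, sub_eq_zero] at h)
    have h1 := ae_pairing_ne_zero hnz
    filter_upwards [h1] with y hy _ h
    apply hy
    rw [add_pairing, smul_pairing]
    simp only [R₀, pairing_add, pairing_smul] at h
    linarith
  set ρ := Real.sqrt (2 / c) with hρ
  have hcont : Continuous fun y : Ambient n => pairing (ν₀ i) y :=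
    Continuous.comp (f := fun y : Ambient n => (ν₀ i, y)) continuous_pairing (by fun_prop)
  obtain ⟨Ca, hCa⟩ : ∃ Ca, ∀ y : Ambient n, |pairing (ν₀ i) y| ≤ Ca * ‖y‖ :=
    ⟨‖(pairingL (ν₀ i) : Ambient n →L[ℝ] ℝ)‖, fun y => by
      have := (pairingL (ν₀ i) : Ambient n →L[ℝ] ℝ).le_opNorm y
      rwa [pairingL_apply, Real.norm_eq_abs] at this⟩
  have hCa0 : 0 ≤ |Ca| := abs_nonneg _
  have hbd : ∀ᶠ p in l, ∀ y, J p y ≠ 0 → ‖R p y‖ ≤ ρ ∧ ‖y‖ ≤ ρ + (1 + |Ca| * ρ) * ‖e‖ := by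
    filter_upwards [hεpos, hbpos, hlsnd.eventually h₀] with p hε hb hquad y hy
    have h1 := left_ne_zero_of_smul hy
    have h2 := right_ne_zero_of_mul h1
    have hη := deriv_cut_support (left_ne_zero_of_mul h2)
    have hmem : R p y ∈ polyCone p.2 := by
      intro k
      by_cases hk : k = i
      · rw [hk, hpi p hb y]
        exact (mul_neg_of_pos_of_neg hε hη.2).le
      · by_contra hpos
        refine right_ne_zero_of_mul h2 (Finset.prod_eq_zero (i := k) (by simpa using hk) ?_)
        exact cut_of_nonneg (div_pos (not_le.1 hpos) hε).le
    have h3 : ‖R p y‖ ≤ ρ := norm_le_of_quad_le hc (hquad _ hmem)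
      (weightD_support (left_ne_zero_of_mul h1))
    refine ⟨h3, ?_⟩
    set t := (pairing (p.2 i) e)⁻¹ * (p.1 * pairing (ν₀ i) y - pairing (p.2 i) y) with ht
    have h4 : R p y = y + t • e := straighten_apply _ _ _ _ _
    have h5 : pairing (ν₀ i) (R p y) = pairing (ν₀ i) y + t := by
      rw [h4, pairing_add, pairing_smul, he, mul_one]
    have h6 : |t| ≤ 1 + |Ca| * ρ := by
      have h7 : |pairing (ν₀ i) (R p y)| ≤ |Ca| * ρ :=
        (hCa _).trans (mul_le_mul (le_abs_self _) h3 (norm_nonneg _) hCa0)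
      have h8 : t = pairing (ν₀ i) (R p y) - pairing (ν₀ i) y := by rw [h5]; ring
      rw [h8]
      have h9 : |pairing (ν₀ i) y| ≤ 1 := abs_le.2 ⟨hη.1.le, by linarith [hη.2]⟩
      have := abs_sub (pairing (ν₀ i) (R p y)) (pairing (ν₀ i) y)
      linarith
    calc ‖y‖ = ‖R p y - t • e‖ := by rw [h4]; simp
      _ ≤ ‖R p y‖ + ‖t • e‖ := norm_sub_le _ _
      _ ≤ ρ + (1 + |Ca| * ρ) * ‖e‖ := by
        rw [norm_smul, Real.norm_eq_abs]
        gcongr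
  obtain ⟨M, hM⟩ := (isCompact_closedBall (0 : Ambient n) ρ).exists_bound_of_continuousOn
    (f := fun y => weightD (quad K y) • (variationAt i y : (Fin N → Ambient n) →L[ℝ] ℝ))
    (((continuous_weightD.comp (continuous_quad K n)).smul (continuous_variationAt i)).continuousOn)
  obtain ⟨C, hC⟩ := exists_abs_deriv_cut_le
  have hlim : Tendsto (fun p => ∫ y, J p y) l (𝓝 (∫ y, J₀ y)) := by
    refine tendsto_integral_filter_of_dominated_convergence
      ((Metric.closedBall (0 : Ambient n) (ρ + (1 + |Ca| * ρ) * ‖e‖)).indicator fun _ => C * M)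
      ?_ ?_ ?_ ?_
    · refine Eventually.of_forall fun p => Continuous.aestronglyMeasurable ?_
      have hRc : Continuous (R p) := LinearMap.continuous_of_finiteDimensional _
      have hpc : ∀ k, Continuous fun y => pairing (p.2 k) (R p y) / p.1 := fun k =>
        (Continuous.comp (f := fun y : Ambient n => (p.2 k, R p y)) continuous_pairing
          (by fun_prop)).div_const _
      exact ((continuous_weightD.comp ((continuous_quad K n).comp hRc)).mul
        ((continuous_deriv_cut.comp hcont).mul
          (continuous_finsetProd _ fun k _ => continuous_cut.comp (hpc k)))).smul
        ((continuous_variationAt i).comp hRc)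
    · filter_upwards [hbd] with p hp
      refine Eventually.of_forall fun y => ?_
      by_cases hJ : J p y = 0
      · rw [hJ, norm_zero]
        refine indicator_nonneg (fun z _ => ?_) y
        have h1 := (abs_nonneg _).trans (hC 0)
        have h2 := (norm_nonneg _).trans (hM 0 (Metric.mem_closedBall_self (Real.sqrt_nonneg _)))
        exact mul_nonneg h1 h2
      · obtain ⟨h1, h2⟩ := hp y hJ
        rw [indicator_of_mem (mem_closedBall_zero_iff.2 h2)]
        have e1 : J p y = (deriv cut (pairing (ν₀ i) y) *
            ∏ k ∈ {i}ᶜ, cut (pairing (p.2 k) (R p y) / p.1)) •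
            (weightD (quad K (R p y)) • variationAt i (R p y)) := by
          simp only [J, smul_smul]
          congr 1
          ring
        rw [e1, norm_smul, norm_mul, Real.norm_eq_abs (deriv cut _)]
        have h3 := hC (pairing (ν₀ i) y)
        have h4 := norm_prod_cut_le {i}ᶜ fun k => pairing (p.2 k) (R p y) / p.1
        have h5 := hM _ (mem_closedBall_zero_iff.2 h1)
        have h6 : |deriv cut (pairing (ν₀ i) y)| *
            ‖∏ k ∈ {i}ᶜ, cut (pairing (p.2 k) (R p y) / p.1)‖ ≤ C * 1 :=
          mul_le_mul h3 h4 (norm_nonneg _) ((abs_nonneg _).trans h3)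
        rw [mul_one] at h6
        exact mul_le_mul h6 h5 (norm_nonneg _) ((abs_nonneg _).trans h3)
    · exact (integrable_indicator_iff measurableSet_closedBall).2
        (integrableOn_const (measure_closedBall_lt_top.ne))
    · filter_upwards [hae] with y hy
      refine Tendsto.smul (Tendsto.mul ?_ (tendsto_const_nhds.mul
        (tendsto_finsetProd _ fun k hk => ?_))) ?_
      · exact ((continuous_weightD.comp (continuous_quad K n)).tendsto _).comp (hR y)
      · exact tendsto_cut_div hlfst (hpair k _ _ (hR y)) (hy k (by simpa using hk))
      · exact ((continuous_variationAt i).tendsto _).comp (hR y)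
  refine ⟨∫ y, J₀ y, ?_⟩
  have h1 := ((hbe.inv₀ one_ne_zero).smul hlim).congr' hsubst
  rwa [inv_one, one_smul] at h1

/-- `coneVol` is differentiable in the half-spaces. Its derivative is the limit of
the derivatives of the smoothed volumes. -/
theorem exists_hasFDerivAt_coneVol {c : ℝ} (hc : 0 < c) {ν₀ : Fin N → Ambient n}
    (h₀ : ∀ᶠ ν in 𝓝 ν₀, ∀ y ∈ polyCone ν, c * ‖y‖ ^ 2 ≤ quad K y)
    (hν : ∀ i, ν₀ i ≠ 0) (hne : ∀ i j, j ≠ i → ∀ s : ℝ, ν₀ j ≠ s • ν₀ i) :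
    ∃ D, HasFDerivAt (coneVol K) D ν₀ ∧
      Tendsto (fun ε => ∑ i, ∫ y, smoothVolDeriv K ε i ν₀ y) (𝓝[>] 0) (𝓝 D) := by
  choose D hD using fun i => exists_tendsto_smoothVolDeriv hc h₀ (hν i) (hne i)
  have hsum : Tendsto (fun p : ℝ × (Fin N → Ambient n) => ∑ i, ∫ y, smoothVolDeriv K p.1 i p.2 y)
      (𝓝[>] 0 ×ˢ 𝓝 ν₀) (𝓝 (∑ i, D i)) := tendsto_finsetSum _ fun i _ => hD i
  refine ⟨∑ i, D i, ?_, ?_⟩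
  · have hne0 : ∀ᶠ ν : Fin N → Ambient n in 𝓝 ν₀, ∀ i, ν i ≠ 0 :=
      eventually_all.2 fun i => (continuous_apply i).continuousAt.eventually_ne (hν i)
    refine hasFDerivAt_of_tendstoUniformlyOnFilter (l := 𝓝[>] (0 : ℝ)) (f := fun ε => smoothVol K ε)
      (f' := fun ε ν => ∑ i, ∫ y, smoothVolDeriv K ε i ν y) (g' := fun _ => ∑ i, D i) ?_ ?_ ?_
    · rw [Metric.tendstoUniformlyOnFilter_iff]
      intro r hr
      filter_upwards [Metric.tendsto_nhds.1 hsum r hr] with p hp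
      rwa [dist_comm]
    · have h1 := hasFDerivAt_smoothVol hc h₀
      have h2 : ∀ᶠ ε : ℝ in 𝓝[>] 0, 0 < ε := self_mem_nhdsWithin
      filter_upwards [h2.prod_mk h1] with p hp
      exact hp.2 p.1 hp.1
    · filter_upwards [h₀, hne0] with ν h1 h2
      exact tendsto_smoothVol hc h1 h2
  · have h : Tendsto (fun ε : ℝ => (ε, ν₀)) (𝓝[>] 0) (𝓝[>] 0 ×ˢ 𝓝 ν₀) :=
      tendsto_id.prodMk tendsto_const_nhds
    have h3 := hsum.comp h
    simp only [Function.comp_def] at h3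
    exact h3

/-! ### Integration by parts on the facets -/

theorem hasLineDerivAt_weight_quad (K : ℝ) (a y : Ambient n) :
    HasLineDerivAt ℝ (fun y : Ambient n => weight (quad K y))
      (-(weightD (quad K y) * (K * pairing a y))) y (normal K a) := by
  have h := (hasDerivAt_weight (quad K y)).comp_hasFDerivAt y
    (hasFDerivAt_quad K y).differentiableAt.hasFDerivAt
  have h2 := h.hasLineDerivAt (normal K a)
  refine HasDerivAt.congr_deriv h2 ?_
  rw [_root_.smul_apply, fderiv_quad_apply, form_comm, form_normal, smul_eq_mul]
  ring

/-- A derivative along the facet `i` of its smoothed indicator function only sees the other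
facets. -/
theorem hasLineDerivAt_faceDensity {ν : Fin N → Ambient n} {i : Fin N} {v : Ambient n}
    (hv : pairing (ν i) v = 0) (ε : ℝ) (y : Ambient n) :
    HasLineDerivAt ℝ (faceDensity {i} ε ν)
      (∑ j ∈ {i}ᶜ, pairing (ν j) v * faceDensity {i, j} ε ν y) y v := by
  have hline : ∀ j, ∀ t : ℝ, pairing (ν j) (y + t • v) = pairing (ν j) y + t * pairing (ν j) v :=
    fun j t => by rw [pairing_add, pairing_smul]
  have h1 : ∀ j ∈ ({i}ᶜ : Finset (Fin N)),
      HasDerivAt (fun t : ℝ => cut (pairing (ν j) (y + t • v) / ε))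
        (ε⁻¹ * deriv cut (pairing (ν j) y / ε) * pairing (ν j) v) 0 := by
    intro j _
    have h2 : HasDerivAt (fun t : ℝ => pairing (ν j) (y + t • v) / ε) (pairing (ν j) v / ε) 0 := by
      simp only [hline]
      exact (((hasDerivAt_id (0 : ℝ)).mul_const _).const_add _).div_const ε |>.congr_deriv (by simp)
    have h3 := HasDerivAt.comp (h₂ := cut) (0 : ℝ) (differentiable_cut _).hasDerivAt h2
    refine h3.congr_deriv ?_
    simp only [zero_smul, add_zero]
    ring
  have h2 := (HasDerivAt.fun_finsetProd h1).const_mul (ε⁻¹ * deriv cut (pairing (ν i) y / ε))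
  have h3 : (fun t : ℝ => faceDensity {i} ε ν (y + t • v)) = fun t =>
      ε⁻¹ * deriv cut (pairing (ν i) y / ε) *
        ∏ j ∈ {i}ᶜ, cut (pairing (ν j) (y + t • v) / ε) := by
    funext t
    rw [faceDensity, Finset.prod_singleton, hline i, hv, mul_zero, add_zero]
  rw [HasLineDerivAt, h3]
  refine h2.congr_deriv ?_
  rw [Finset.mul_sum]
  refine Finset.sum_congr rfl fun j hj => ?_
  have hij : i ≠ j := fun h => by simp [h] at hj
  have e1 : ({i, j} : Finset (Fin N))ᶜ = ({i}ᶜ : Finset (Fin N)).erase j := by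
    ext k; simp; tauto
  rw [faceDensity, Finset.prod_pair hij, e1]
  simp only [zero_smul, add_zero, smul_eq_mul]
  ring

/-- Integration by parts on the facets. When the half-spaces stay normalized, the field
`normal K (δ i)` is tangent to the hyperplane `i`, and up to sign it is the gradient of the normal
velocity of the facet `i`. -/
theorem mul_sum_integral_smoothVolDeriv {c : ℝ} (hc : 0 < c) {ν : Fin N → Ambient n}
    (h : ∀ y ∈ polyCone ν, c * ‖y‖ ^ 2 ≤ quad K y) {δ : Fin N → Ambient n}
    (hδ : ∀ i, pairing (ν i) (normal K (δ i)) = 0) {ε : ℝ} (hε : 0 < ε) :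
    K * (∑ i, ∫ y, smoothVolDeriv K ε i ν y) δ =
      ∑ i, ∑ j ∈ {i}ᶜ, pairing (ν j) (normal K (δ i)) *
        ∫ y, weight (quad K y) * faceDensity {i, j} ε ν y := by
  have hw : Continuous fun y : Ambient n => weight (quad K y) :=
    continuous_weight.comp (continuous_quad K n)
  have hwD : Continuous fun y : Ambient n => weightD (quad K y) :=
    continuous_weightD.comp (continuous_quad K n)
  have hpair : ∀ a : Ambient n, Continuous fun y : Ambient n => pairing a y := fun a =>
    Continuous.comp (f := fun y : Ambient n => (a, y)) continuous_pairing (by fun_prop)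
  have hint : ∀ i, Integrable (smoothVolDeriv K ε i ν) := fun i =>
    integrable_of_continuous_of_norm_le volume (continuous_smoothVolDeriv_right K ε i ν)
      (ρ := Real.sqrt (2 / c)) fun y hy => by
        have h1 := left_ne_zero_of_smul hy
        exact norm_le_of_quad_le hc (h y (faceDensity_support hε (right_ne_zero_of_mul h1)))
          (weightD_support (left_ne_zero_of_mul h1))
  have hint2 : ∀ s : Finset (Fin N),
      Integrable fun y => weight (quad K y) * faceDensity s ε ν y := fun s =>
    integrable_of_continuous_of_norm_le volume (hw.mul (continuous_faceDensity_right s ε ν))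
      (ρ := Real.sqrt (2 / c)) fun y hy =>
        norm_le_of_quad_le hc (h y (faceDensity_support hε (right_ne_zero_of_mul hy)))
          (weight_support (left_ne_zero_of_mul hy))
  rw [_root_.sum_apply, Finset.mul_sum]
  refine Finset.sum_congr rfl fun i _ => ?_
  rw [ContinuousLinearMap.integral_apply (hint i)]
  have e1 : ∀ y, weight (quad K y) *
      (∑ j ∈ {i}ᶜ, pairing (ν j) (normal K (δ i)) * faceDensity {i, j} ε ν y) =
      ∑ j ∈ {i}ᶜ, pairing (ν j) (normal K (δ i)) *
        (weight (quad K y) * faceDensity {i, j} ε ν y) := fun y => by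
    rw [Finset.mul_sum]
    exact Finset.sum_congr rfl fun j _ => by ring
  have hparts := integral_bilinear_hasLineDerivAt_right_eq_neg_left_of_integrable (μ := volume)
    (B := ContinuousLinearMap.mul ℝ ℝ) (f := fun y : Ambient n => weight (quad K y))
    (f' := fun y => -(weightD (quad K y) * (K * pairing (δ i) y)))
    (g := faceDensity {i} ε ν)
    (g' := fun y => ∑ j ∈ {i}ᶜ, pairing (ν j) (normal K (δ i)) * faceDensity {i, j} ε ν y)
    (v := normal K (δ i)) ?_ ?_ ?_ ?_ ?_
  · simp only [ContinuousLinearMap.mul_apply', e1] at hparts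
    rw [integral_finsetSum _ fun j _ => (hint2 {i, j}).const_mul _] at hparts
    simp only [integral_const_mul] at hparts
    rw [hparts, ← integral_const_mul, ← integral_neg]
    refine integral_congr_ae (Eventually.of_forall fun y => ?_)
    simp only [smoothVolDeriv, _root_.smul_apply, variationAt_apply, smul_eq_mul]
    ring
  · refine integrable_of_continuous_of_norm_le volume (ρ := Real.sqrt (2 / c)) ?_ fun y hy => ?_
    · exact (hwD.mul (continuous_const.mul (hpair _))).neg.mul
        (continuous_faceDensity_right _ ε ν)
    · have hy' : -(weightD (quad K y) * (K * pairing (δ i) y)) * faceDensity {i} ε ν y ≠ 0 := hy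
      exact norm_le_of_quad_le hc (h y (faceDensity_support hε (right_ne_zero_of_mul hy')))
        (weightD_support (left_ne_zero_of_mul (neg_ne_zero.1 (left_ne_zero_of_mul hy'))))
  · simp only [ContinuousLinearMap.mul_apply', e1]
    exact integrable_finsetSum _ fun j _ => (hint2 {i, j}).const_mul _
  · exact hint2 {i}
  · exact fun y _ => hasLineDerivAt_weight_quad K (δ i) y
  · exact fun y _ => hasLineDerivAt_faceDensity (hδ i) ε y

end

section

variable {K : ℝ}

/-! ### Concentration on the faces of codimension two -/

theorem det_extendByTwo_comb {k : ℕ} (T : Ambient k →L[ℝ] Ambient (k + 2)) (p r : Ambient (k + 2))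
    (a b c d : ℝ) :
    LinearMap.det (extendByTwo T (a • p + c • r) (b • p + d • r)) =
      (a * d - b * c) * LinearMap.det (extendByTwo T p r) := by
  set B : ℝ × ℝ →ₗ[ℝ] ℝ × ℝ := Matrix.toLin (Module.Basis.finTwoProd ℝ)
    (Module.Basis.finTwoProd ℝ) !![a, b; c, d] with hB
  have hB_apply : ∀ v, B v = (a * v.1 + b * v.2, c * v.1 + d * v.2) := fun v =>
    Matrix.toLin_finTwoProd_apply a b c d v
  have hmap : extendByTwo T (a • p + c • r) (b • p + d • r) =
      extendByTwo T p r ∘ₗ (ambientSplit k).symm.toLinearMap ∘ₗ (LinearMap.id.prodMap B) ∘ₗ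
        (ambientSplit k).symm.symm.toLinearMap := by
    refine LinearMap.ext fun w => ?_
    simp only [LinearMap.coe_comp, Function.comp_apply, LinearEquiv.coe_coe,
      LinearEquiv.symm_symm, extendByTwo_apply, LinearEquiv.apply_symm_apply,
      LinearMap.prodMap_apply, LinearMap.id_apply, hB_apply]
    module
  rw [hmap, LinearMap.det_comp, ← LinearMap.comp_assoc, LinearMap.comp_assoc, LinearMap.det_conj,
    LinearMap.det_prodMap, LinearMap.det_id, one_mul, hB, LinearMap.det_toLin,
    Matrix.det_fin_two_of]
  ring

theorem det_extendByTwo_ne_zero {k : ℕ} {T : Ambient k →L[ℝ] Ambient (k + 2)}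
    (hT : Function.Injective T) {a b p r : Ambient (k + 2)} (haT : ∀ z, pairing a (T z) = 0)
    (hbT : ∀ z, pairing b (T z) = 0) (hap : pairing a p = 1) (har : pairing a r = 0)
    (hbp : pairing b p = 0) (hbr : pairing b r = 1) :
    LinearMap.det (extendByTwo T p r) ≠ 0 := by
  have hinj : Function.Injective (extendByTwo T p r) := by
    rw [injective_iff_map_eq_zero]
    intro w hw
    rw [extendByTwo_apply] at hw
    have h1 := congrArg (pairing a) hw
    have h2 := congrArg (pairing b) hw
    have h0 : ∀ v : Ambient (k + 2), pairing v 0 = 0 := fun v => by simp [pairing]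
    simp only [pairing_add, pairing_smul, haT, hap, har, h0, mul_one, mul_zero, zero_add,
      add_zero] at h1
    simp only [pairing_add, pairing_smul, hbT, hbp, hbr, h0, mul_one, mul_zero, zero_add] at h2
    rw [h1, h2, zero_smul, zero_smul, add_zero, add_zero] at hw
    have h3 : (ambientSplit k w).1 = 0 := hT (by rw [hw, map_zero])
    exact (LinearEquiv.map_eq_zero_iff (ambientSplit k)).1 (Prod.ext h3 (Prod.ext h1 h2))
  exact (LinearEquiv.isUnit_det' (LinearEquiv.ofInjectiveEndo _ hinj)).ne_zero

/-- Almost no point of a cone over a face lies on a further hyperplane. -/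
theorem ae_pairing_comp_ne_zero {k n N : ℕ} {ν : Fin N → Ambient n} {i j : Fin N}
    {T : Ambient k →L[ℝ] Ambient n} (hne : ∀ l, l ≠ i → l ≠ j → ∃ z, pairing (ν l) (T z) ≠ 0) :
    ∀ᵐ z : Ambient k, ∀ l, l ≠ i → l ≠ j → pairing (ν l) (T z) ≠ 0 := by
  refine ae_all_iff.2 fun l => ?_
  by_cases hl : l ≠ i ∧ l ≠ j
  · obtain ⟨z, hz⟩ := hne l hl.1 hl.2
    have h1 := ae_ne_zero_of_ne_zero (volume : Measure (Ambient k))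
      (φ := (pairingL (ν l)).comp T) (fun h0 => hz (by
        have := DFunLike.congr_fun h0 z
        simpa using this))
    filter_upwards [h1] with q hq _ _
    simpa using hq
  · exact Eventually.of_forall fun _ h1 h2 => absurd ⟨h1, h2⟩ hl

/-- The smoothed integrals over the intersection of two facets converge to an integral over the
cone over the face of codimension two. -/
theorem tendsto_integral_faceDensity_pair {k N : ℕ} {c : ℝ} (hc : 0 < c)
    {ν : Fin N → Ambient (k + 2)} (h : ∀ y ∈ polyCone ν, c * ‖y‖ ^ 2 ≤ quad K y) {i j : Fin N}
    (hij : i ≠ j) {T : Ambient k →L[ℝ] Ambient (k + 2)} {S : Ambient (k + 2) →L[ℝ] Ambient k}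
    (hST : ∀ z, S (T z) = z) {p r : Ambient (k + 2)} (hiT : ∀ z, pairing (ν i) (T z) = 0)
    (hjT : ∀ z, pairing (ν j) (T z) = 0) (hip : pairing (ν i) p = 1) (hir : pairing (ν i) r = 0)
    (hjp : pairing (ν j) p = 0) (hjr : pairing (ν j) r = 1)
    (hne : ∀ l, l ≠ i → l ≠ j → ∃ z, pairing (ν l) (T z) ≠ 0) :
    Tendsto (fun ε => ∫ y, weight (quad K y) * faceDensity {i, j} ε ν y) (𝓝[>] 0)
      (𝓝 (|LinearMap.det (extendByTwo T p r)| *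
        ∫ z in T ⁻¹' polyCone ν, weight (quad K (T z)))) := by
  have hdet := det_extendByTwo_ne_zero (fun z w hzw => by rw [← hST z, hzw, hST w]) hiT hjT hip hir
    hjp hjr
  -- coordinates in which the two facets are coordinate hyperplanes, with the normal plane stretched
  let Q : ℝ → Ambient k × (ℝ × ℝ) → Ambient (k + 2) := fun ε q =>
    T q.1 + (q.2.1 • (ε • p) + q.2.2 • (ε • r))
  have hQc : ∀ ε, Continuous (Q ε) := fun ε => by simp only [Q]; fun_prop
  have hQi : ∀ ε q, pairing (ν i) (Q ε q) = ε * q.2.1 := fun ε q => by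
    simp only [Q, pairing_add, pairing_smul, hiT, hip, hir]; ring
  have hQj : ∀ ε q, pairing (ν j) (Q ε q) = ε * q.2.2 := fun ε q => by
    simp only [Q, pairing_add, pairing_smul, hjT, hjp, hjr]; ring
  let H : ℝ → Ambient k × (ℝ × ℝ) → ℝ := fun ε q =>
    weight (quad K (Q ε q)) * (deriv cut q.2.1 * deriv cut q.2.2) *
      ∏ l ∈ {i, j}ᶜ, cut (pairing (ν l) (Q ε q) / ε)
  let F : Ambient k → ℝ := fun z => weight (quad K (T z)) *
    ∏ l ∈ {i, j}ᶜ, if pairing (ν l) (T z) < 0 then 1 else 0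
  have hcT : Continuous fun z => quad K (T z) := (continuous_quad K _).comp T.continuous
  have hpc : ∀ l, Continuous fun y : Ambient (k + 2) => pairing (ν l) y := fun l =>
    Continuous.comp (f := fun y : Ambient (k + 2) => (ν l, y)) continuous_pairing (by fun_prop)
  have hsubst : ∀ᶠ ε : ℝ in 𝓝[>] 0, |LinearMap.det (extendByTwo T p r)| * ∫ q, H ε q =
      ∫ y, weight (quad K y) * faceDensity {i, j} ε ν y := by
    filter_upwards [self_mem_nhdsWithin] with ε hε
    have hε' : (0 : ℝ) < ε := hε
    have hd : LinearMap.det (extendByTwo T (ε • p) (ε • r)) =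
        ε ^ 2 * LinearMap.det (extendByTwo T p r) := by
      have := det_extendByTwo_comb T p r ε 0 0 ε
      simp only [zero_smul, add_zero, zero_add] at this
      rw [this]; ring
    have hd0 : LinearMap.det (extendByTwo T (ε • p) (ε • r)) ≠ 0 := by
      rw [hd]; exact mul_ne_zero (pow_ne_zero _ hε'.ne') hdet
    rw [integral_eq_abs_det_smul volume hd0 (fun y => weight (quad K y) * faceDensity {i, j} ε ν y),
      hd, abs_mul, abs_of_pos (pow_pos hε' 2), smul_eq_mul]
    let E : Ambient (k + 2) ≃L[ℝ] Ambient k × (ℝ × ℝ) := (ambientSplit k).toContinuousLinearEquiv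
    have hemb : MeasurableEmbedding (ambientSplit k) := E.toHomeomorph.measurableEmbedding
    have hint : ∫ w, H ε (ambientSplit k w) = ε ^ 2 * ∫ w, weight (quad K
        (extendByTwo T (ε • p) (ε • r) w)) * faceDensity {i, j} ε ν
          (extendByTwo T (ε • p) (ε • r) w) := by
      rw [← integral_const_mul]
      refine integral_congr_ae (Eventually.of_forall fun w => ?_)
      have h1 : extendByTwo T (ε • p) (ε • r) w = Q ε (ambientSplit k w) := rfl
      simp only [H, h1, faceDensity, Finset.prod_pair hij, hQi, hQj, mul_div_cancel_left₀ _ hε'.ne']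
      field_simp
    rw [← (measurePreserving_ambientSplit k).integral_comp hemb, hint]
    ring
  have hlim : Tendsto (fun ε => ∫ q, H ε q) (𝓝[>] 0) (𝓝 (∫ q : Ambient k × (ℝ × ℝ),
      F q.1 * (deriv cut q.2.1 * deriv cut q.2.2))) := by
    set ρ := Real.sqrt (2 / c)
    obtain ⟨C, hC⟩ := exists_abs_deriv_cut_le
    have hC0 : 0 ≤ C := (abs_nonneg _).trans (hC 0)
    set ρ' := max (‖S‖ * (ρ + ‖p‖ + ‖r‖)) 1 with hρ'
    refine tendsto_integral_filter_of_dominated_convergence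
      ((Metric.closedBall (0 : Ambient k × (ℝ × ℝ)) ρ').indicator fun _ => C * C) ?_ ?_ ?_ ?_
    · refine Eventually.of_forall fun ε => Continuous.aestronglyMeasurable ?_
      exact ((continuous_weight.comp ((continuous_quad K _).comp (hQc ε))).mul
        ((continuous_deriv_cut.comp (by fun_prop)).mul
          (continuous_deriv_cut.comp (by fun_prop)))).mul
        (continuous_finsetProd _ fun l _ =>
          continuous_cut.comp (((hpc l).comp (hQc ε)).div_const _))
    · have hε1 : ∀ᶠ ε : ℝ in 𝓝[>] 0, ε < 1 :=
        (tendsto_id.mono_right nhdsWithin_le_nhds).eventually_lt_const one_pos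
      filter_upwards [self_mem_nhdsWithin, hε1] with ε hε hε1
      have hε' : (0 : ℝ) < ε := hε
      refine Eventually.of_forall fun q => ?_
      by_cases hH : H ε q = 0
      · rw [hH, norm_zero]
        exact indicator_nonneg (fun _ _ => mul_nonneg hC0 hC0) q
      have h1 := left_ne_zero_of_mul hH
      have h2 := right_ne_zero_of_mul h1
      have ha := deriv_cut_support (left_ne_zero_of_mul h2)
      have hb := deriv_cut_support (right_ne_zero_of_mul h2)
      have hmem : Q ε q ∈ polyCone ν := by
        intro l
        by_cases hli : l = i
        · rw [hli, hQi]; exact (mul_neg_of_pos_of_neg hε' ha.2).le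
        by_cases hlj : l = j
        · rw [hlj, hQj]; exact (mul_neg_of_pos_of_neg hε' hb.2).le
        by_contra hpos
        refine right_ne_zero_of_mul hH (Finset.prod_eq_zero (i := l) (by simp [hli, hlj]) ?_)
        exact cut_of_nonneg (div_pos (not_le.1 hpos) hε').le
      have h3 : ‖Q ε q‖ ≤ ρ := norm_le_of_quad_le hc (h _ hmem)
        (weight_support (left_ne_zero_of_mul h1))
      have ha1 : |q.2.1| ≤ 1 := abs_le.2 ⟨ha.1.le, by linarith [ha.2]⟩
      have hb1 : |q.2.2| ≤ 1 := abs_le.2 ⟨hb.1.le, by linarith [hb.2]⟩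
      have hs : ∀ (x : ℝ) (v : Ambient (k + 2)), |x| ≤ 1 → ‖x • (ε • v)‖ ≤ ‖v‖ := by
        intro x v hx
        rw [norm_smul, norm_smul, Real.norm_eq_abs, Real.norm_eq_abs, abs_of_pos hε', ← mul_assoc]
        have : |x| * ε ≤ 1 := by nlinarith [abs_nonneg x]
        exact mul_le_of_le_one_left (norm_nonneg v) this
      have h4 : ‖T q.1‖ ≤ ρ + ‖p‖ + ‖r‖ := by
        have e : T q.1 = Q ε q - q.2.1 • (ε • p) - q.2.2 • (ε • r) := by simp only [Q]; abel
        rw [e]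
        refine (norm_sub_le _ _).trans (add_le_add ((norm_sub_le _ _).trans
          (add_le_add h3 (hs _ _ ha1))) (hs _ _ hb1))
      have h5 : ‖q.1‖ ≤ ρ' := by
        refine le_trans ?_ (le_max_left _ _)
        calc ‖q.1‖ = ‖S (T q.1)‖ := by rw [hST]
          _ ≤ ‖S‖ * ‖T q.1‖ := S.le_opNorm _
          _ ≤ _ := by gcongr
      have h6 : q ∈ Metric.closedBall (0 : Ambient k × (ℝ × ℝ)) ρ' := by
        rw [mem_closedBall_zero_iff]
        exact max_le h5 (max_le (ha1.trans (le_max_right _ _)) (hb1.trans (le_max_right _ _)))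
      rw [indicator_of_mem h6]
      have hw1 : ‖weight (quad K (Q ε q))‖ ≤ 1 := by
        rw [Real.norm_eq_abs, abs_of_nonneg (weight_nonneg _)]
        exact cut_le_one _
      have hp1 := norm_prod_cut_le {i, j}ᶜ fun l => pairing (ν l) (Q ε q) / ε
      have hcc : ‖deriv cut q.2.1 * deriv cut q.2.2‖ ≤ C * C := by
        rw [norm_mul]
        exact mul_le_mul (hC _) (hC _) (norm_nonneg _) hC0
      simp only [H]
      rw [norm_mul, norm_mul]
      calc _ ≤ 1 * (C * C) * 1 := mul_le_mul (mul_le_mul hw1 hcc (norm_nonneg _) zero_le_one) hp1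
              (norm_nonneg _) (by positivity)
        _ = C * C := by ring
    · exact (integrable_indicator_iff measurableSet_closedBall).2
        (integrableOn_const ((isCompact_closedBall _ _).measure_lt_top.ne))
    · have hae : ∀ᵐ q : Ambient k × (ℝ × ℝ), ∀ l, l ≠ i → l ≠ j → pairing (ν l) (T q.1) ≠ 0 :=
        Measure.quasiMeasurePreserving_fst.ae (ae_pairing_comp_ne_zero hne)
      filter_upwards [hae] with q hq
      have hQ0 : Tendsto (fun ε => Q ε q) (𝓝[>] 0) (𝓝 (T q.1)) := by
        have hcont : Continuous fun ε => Q ε q := by simp only [Q]; fun_prop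
        have := (hcont.tendsto 0).mono_left (nhdsWithin_le_nhds (s := Ioi 0))
        simpa [Q] using this
      have e : F q.1 * (deriv cut q.2.1 * deriv cut q.2.2) =
          weight (quad K (T q.1)) * (deriv cut q.2.1 * deriv cut q.2.2) *
            ∏ l ∈ {i, j}ᶜ, if pairing (ν l) (T q.1) < 0 then 1 else 0 := by
        simp only [F]; ring
      rw [e]
      refine Tendsto.mul (Tendsto.mul ?_ tendsto_const_nhds)
        (tendsto_finsetProd _ fun l hl => ?_)
      · exact ((continuous_weight.comp (continuous_quad K _)).tendsto _).comp hQ0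
      · simp only [Finset.mem_compl, Finset.mem_insert, Finset.mem_singleton, not_or] at hl
        exact tendsto_cut_div tendsto_id (((hpc l).tendsto _).comp hQ0) (hq l hl.1 hl.2)
  have hval : ∫ q : Ambient k × (ℝ × ℝ), F q.1 * (deriv cut q.2.1 * deriv cut q.2.2) =
      ∫ z in T ⁻¹' polyCone ν, weight (quad K (T z)) := by
    have hone : ∫ v : ℝ × ℝ, deriv cut v.1 * deriv cut v.2 = 1 := by
      have := integral_prod_mul (μ := (volume : Measure ℝ)) (ν := (volume : Measure ℝ))
        (deriv cut) (deriv cut)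
      rw [Measure.volume_eq_prod, this, integral_deriv_cut]
      norm_num
    have hsplit := integral_prod_mul (μ := (volume : Measure (Ambient k)))
      (ν := (volume : Measure (ℝ × ℝ))) F fun v : ℝ × ℝ => deriv cut v.1 * deriv cut v.2
    refine hsplit.trans ?_
    rw [hone, mul_one,
      ← integral_indicator ((isClosed_polyCone ν).preimage T.continuous).measurableSet]
    have hae := ae_pairing_comp_ne_zero hne
    refine integral_congr_ae ?_
    filter_upwards [hae] with z hz
    by_cases hzC : z ∈ T ⁻¹' polyCone ν
    · rw [indicator_of_mem hzC]
      simp only [F]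
      rw [Finset.prod_eq_one, mul_one]
      intro l hl
      simp only [Finset.mem_compl, Finset.mem_insert, Finset.mem_singleton, not_or] at hl
      exact if_pos (lt_of_le_of_ne (hzC l) (hz l hl.1 hl.2))
    · rw [indicator_of_notMem hzC]
      simp only [polyCone, mem_preimage, mem_ofPred_eq, not_forall, not_le] at hzC
      obtain ⟨l, hl⟩ := hzC
      simp only [F]
      rw [Finset.prod_eq_zero (i := l) _ (if_neg hl.not_gt), mul_zero]
      simp only [Finset.mem_compl, Finset.mem_insert, Finset.mem_singleton, not_or]
      exact ⟨fun h0 => by rw [h0, hiT] at hl; exact lt_irrefl _ hl,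
        fun h0 => by rw [h0, hjT] at hl; exact lt_irrefl _ hl⟩
  rw [← hval]
  exact (hlim.const_mul _).congr' hsubst

/-! ### Volumes as integrals over cones -/

theorem integrable_radial (k : ℕ) {w : ℝ → ℝ} (hw : Continuous w) (hw2 : ∀ x, w x ≠ 0 → x ≤ 2) :
    Integrable fun r : ℝ => r ^ k * w (r ^ 2) := by
  refine integrable_of_continuous_of_norm_le volume (ρ := 2) (by fun_prop) fun r hr => ?_
  have := hw2 _ (right_ne_zero_of_mul hr)
  rw [Real.norm_eq_abs]
  exact abs_le_of_sq_le_sq (by linarith) (by norm_num)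

/-- `IsConeOver.riemannianVolume_mul` for real-valued weights. The volume is finite since the weight
has bounded support on the cone. -/
theorem IsConeOver.toReal_riemannianVolume_mul {k n : ℕ}
    {Γ : Subgroup (Ambient n ≃L[ℝ] Ambient n)} {T : Ambient k →L[ℝ] Ambient n}
    {S : Ambient n →L[ℝ] Ambient k} {κ : ℝ} {A : Set (Ambient n)}
    (hA : IsConeOver K Γ T S κ A) (hΓ : IsSpaceFormGroup K Γ) {c : ℝ} (hc : 0 < c)
    (h : ∀ y ∈ A, c * ‖y‖ ^ 2 ≤ quad K y) {w : ℝ → ℝ} (hw : Continuous w) (hw0 : ∀ x, 0 ≤ w x)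
    (hw2 : ∀ x, w x ≠ 0 → x ≤ 2) (hpos : 0 < ∫ r in Ioi (0 : ℝ), r ^ k * w (r ^ 2)) :
    riemannianVolume K Γ k (proj K Γ '' {x : Model K n | (x : Ambient n) ∈ A}) ≠ ⊤ ∧
    (riemannianVolume K Γ k (proj K Γ '' {x : Model K n | (x : Ambient n) ∈ A})).toReal *
        ∫ r in Ioi (0 : ℝ), r ^ k * w (r ^ 2) =
      κ * ∫ z in T ⁻¹' A, w (quad K (T z)) := by
  have hrad : ∫⁻ r in Ioi (0 : ℝ), ENNReal.ofReal (r ^ k) * ENNReal.ofReal (w (r ^ 2)) =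
      ENNReal.ofReal (∫ r in Ioi (0 : ℝ), r ^ k * w (r ^ 2)) := by
    rw [ofReal_integral_eq_lintegral_ofReal (integrable_radial k hw hw2).integrableOn]
    · refine setLIntegral_congr_fun measurableSet_Ioi fun r hr => ?_
      exact (ENNReal.ofReal_mul (pow_nonneg (le_of_lt hr) k)).symm
    · filter_upwards [ae_restrict_mem measurableSet_Ioi] with r hr
      exact mul_nonneg (pow_nonneg (le_of_lt hr) k) (hw0 _)
  have hcont : Continuous fun z => w (quad K (T z)) :=
    hw.comp ((continuous_quad K n).comp T.continuous)
  have hmeas : MeasurableSet (T ⁻¹' A) := (hA.closed.preimage T.continuous).measurableSet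
  have hint : IntegrableOn (fun z => w (quad K (T z))) (T ⁻¹' A) := by
    refine IntegrableOn.of_forall_sdiff_eq_zero (s := Metric.closedBall 0 (‖S‖ * Real.sqrt (2 / c)))
      (hcont.continuousOn.integrableOn_compact (isCompact_closedBall _ _)) hmeas ?_
    rintro z ⟨hzA, hz⟩
    by_contra h0
    refine hz (mem_closedBall_zero_iff.2 ?_)
    calc ‖z‖ = ‖S (T z)‖ := by rw [hA.left_inv]
      _ ≤ ‖S‖ * ‖T z‖ := S.le_opNorm _
      _ ≤ _ := by
        gcongr
        exact norm_le_of_quad_le hc (h _ hzA) (hw2 _ h0)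
  have hcone : ∫⁻ z in T ⁻¹' A, ENNReal.ofReal κ * ENNReal.ofReal (w (quad K (T z))) =
      ENNReal.ofReal (κ * ∫ z in T ⁻¹' A, w (quad K (T z))) := by
    rw [lintegral_const_mul' _ _ ENNReal.ofReal_ne_top, ENNReal.ofReal_mul hA.κ_nonneg,
      ofReal_integral_eq_lintegral_ofReal hint (Eventually.of_forall fun _ => hw0 _)]
  have hmain := hA.riemannianVolume_mul hΓ (f := fun x => ENNReal.ofReal (w x))
    (ENNReal.measurable_ofReal.comp hw.measurable) (by rw [hrad]; exact ENNReal.ofReal_ne_top)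
  rw [hrad, hcone] at hmain
  refine ⟨fun htop => ?_, ?_⟩
  · rw [htop, ENNReal.top_mul (ENNReal.ofReal_pos.2 hpos).ne'] at hmain
    exact ENNReal.ofReal_ne_top hmain.symm
  · have := congrArg ENNReal.toReal hmain
    rwa [ENNReal.toReal_mul, ENNReal.toReal_ofReal hpos.le, ENNReal.toReal_ofReal (mul_nonneg
      hA.κ_nonneg (setIntegral_nonneg hmeas fun _ _ => hw0 _))] at this

theorem integral_radial_weight_pos (k : ℕ) : 0 < ∫ r in Ioi (0 : ℝ), r ^ k * weight (r ^ 2) := by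
  have h1 : ∫ r in Ioc (0 : ℝ) 1, r ^ k * weight (r ^ 2) = 1 / (k + 1) := by
    have : ∫ r in Ioc (0 : ℝ) 1, r ^ k * weight (r ^ 2) = ∫ r in Ioc (0 : ℝ) 1, r ^ k := by
      refine setIntegral_congr_fun measurableSet_Ioc fun r hr => ?_
      rw [weight_eq_one (by nlinarith [hr.1, hr.2]), mul_one]
    rw [this, ← intervalIntegral.integral_of_le zero_le_one, integral_pow]
    simp
  have h2 : (0 : ℝ) < 1 / (k + 1) := by positivity
  rw [← h1] at h2
  refine h2.trans_le (setIntegral_mono_set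
    (integrable_radial k continuous_weight fun _ => weight_support).integrableOn ?_
    (Eventually.of_forall fun r hr => hr.1))
  filter_upwards [ae_restrict_mem measurableSet_Ioi] with r hr
  exact mul_nonneg (pow_nonneg (le_of_lt hr) k) (weight_nonneg _)

/-- Integration by parts in the radial direction. -/
theorem integral_radial_weightD (k : ℕ) : ∫ r in Ioi (0 : ℝ), r ^ (k + 2) * weightD (r ^ 2) =
    (k + 1) * ∫ r in Ioi (0 : ℝ), r ^ k * weight (r ^ 2) := by
  have hi1 := (integrable_radial (k + 2) continuous_weightD fun _ => weightD_support).integrableOn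
    (s := Ioi (0 : ℝ))
  have hi2 := ((integrable_radial k continuous_weight fun _ => weight_support).integrableOn
    (s := Ioi (0 : ℝ))).const_mul ((k : ℝ) + 1)
  have hd : ∀ r ∈ Ici (0 : ℝ), HasDerivAt (fun r : ℝ => r ^ (k + 1) * weight (r ^ 2))
      ((k + 1) * (r ^ k * weight (r ^ 2)) - r ^ (k + 2) * weightD (r ^ 2)) r := by
    intro r _
    have h1 : HasDerivAt (fun r : ℝ => r ^ 2) (2 * r) r := by simpa using hasDerivAt_pow 2 r
    have h2 := (hasDerivAt_pow (k + 1) r).mul ((hasDerivAt_weight (r ^ 2)).comp r h1)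
    refine h2.congr_deriv ?_
    simp only [Function.comp_apply, Nat.cast_add, Nat.cast_one, Nat.add_sub_cancel]
    ring
  have htend : Tendsto (fun r : ℝ => r ^ (k + 1) * weight (r ^ 2)) atTop (𝓝 0) := by
    refine tendsto_const_nhds.congr' ?_
    filter_upwards [eventually_gt_atTop (2 : ℝ)] with r hr
    by_contra h
    have := weight_support (right_ne_zero_of_mul (Ne.symm h))
    nlinarith
  have h := integral_Ioi_of_hasDerivAt_of_tendsto' hd (hi2.sub hi1) htend
  rw [integral_sub hi2 hi1, integral_const_mul] at h
  simp only [ne_eq, Nat.add_eq_zero_iff, one_ne_zero, and_false, not_false_eq_true, zero_pow,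
    zero_mul, sub_zero] at h
  linarith

/-! ### The cones over a polyhedron and over its faces of codimension two -/

theorem IsConvexPolyhedron.isConeOver_polyCone {n N : ℕ}
    {Γ : Subgroup (Ambient n ≃L[ℝ] Ambient n)} {ν : Fin N → Ambient n}
    (hν : IsConvexPolyhedron K Γ ν) (hn : 0 < n) :
    IsConeOver K Γ (.id ℝ (Ambient n)) (.id ℝ (Ambient n)) 1 (polyCone ν) where
  left_inv _ := rfl
  κ_nonneg := zero_le_one
  sqrt_det z L hz hL := by
    rw [ContinuousLinearMap.id_comp, one_mul]
    exact sqrt_det_gram hz L hL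
  closed := isClosed_polyCone ν
  smul_mem r hr y hy := smul_mem_polyCone hr.le hy
  right_inv _ _ := rfl
  quad_pos y hy hy0 := (hν.quad_pos hn hy hy0).1
  fst_pos hK y hy hy0 := (hν.quad_pos hn hy hy0).2 hK
  injOn := hν.embedded

/-- Linear coordinates on the intersection of two hyperplanes. -/
theorem exists_coordinates_inter {k : ℕ} {a b : Ambient (k + 2)} (hab : ∀ s : ℝ, b ≠ s • a)
    (hba : ∀ s : ℝ, a ≠ s • b) :
    ∃ (T : Ambient k →L[ℝ] Ambient (k + 2)) (S : Ambient (k + 2) →L[ℝ] Ambient k),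
      (∀ z, S (T z) = z) ∧ (∀ z, pairing a (T z) = 0) ∧ (∀ z, pairing b (T z) = 0) ∧
      ∀ y, pairing a y = 0 → pairing b y = 0 → T (S y) = y := by
  obtain ⟨e, he1, he2⟩ := exists_pairing_eq hab
  obtain ⟨e', he1', he2'⟩ := exists_pairing_eq hba
  let φ : Ambient (k + 2) →ₗ[ℝ] ℝ × ℝ := ((pairingL a).prod (pairingL b)).toLinearMap
  have hφ : ∀ y, φ y = (pairing a y, pairing b y) := fun y => by simp [φ]
  have hsurj : Function.Surjective φ := by
    rintro ⟨s, t⟩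
    refine ⟨s • e' + t • e, ?_⟩
    rw [hφ]
    simp [pairing_add, pairing_smul, he1, he2, he1', he2']
  have hrank : Module.finrank ℝ (Ambient k) = Module.finrank ℝ (LinearMap.ker φ) := by
    have h1 := LinearMap.finrank_range_add_finrank_ker φ
    rw [LinearMap.range_eq_top.2 hsurj, finrank_top] at h1
    simp only [Module.finrank_prod, Module.finrank_self, finrank_euclideanSpace,
      Fintype.card_fin] at h1 ⊢
    omega
  let e := LinearEquiv.ofFinrankEq (Ambient k) (LinearMap.ker φ) hrank
  let T : Ambient k →ₗ[ℝ] Ambient (k + 2) := (LinearMap.ker φ).subtype ∘ₗ e.toLinearMap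
  have hTinj : LinearMap.ker T = ⊥ :=
    LinearMap.ker_eq_bot.2 ((LinearMap.ker φ).injective_subtype.comp e.injective)
  obtain ⟨S, hS⟩ := T.exists_leftInverse_of_injective hTinj
  have hST : ∀ z, S (T z) = z := fun z => LinearMap.congr_fun hS z
  have hT : ∀ z, φ (T z) = 0 := fun z => (e z).2
  refine ⟨LinearMap.toContinuousLinearMap T, LinearMap.toContinuousLinearMap S, hST, fun z => ?_,
    fun z => ?_, fun y hy1 hy2 => ?_⟩
  · have := hT z
    rw [hφ] at this
    exact congrArg Prod.fst this
  · have := hT z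
    rw [hφ] at this
    exact congrArg Prod.snd this
  · have hy : y ∈ LinearMap.ker φ := by
      rw [LinearMap.mem_ker, hφ, hy1, hy2]; rfl
    have h1 : T (e.symm ⟨y, hy⟩) = y := by simp [T]
    change T (S y) = y
    rw [← h1, hST]

theorem IsConvexPolyhedron.pairing_normal_self {n N : ℕ} {Γ : Subgroup (Ambient n ≃L[ℝ] Ambient n)}
    {ν : Fin N → Ambient n} (hν : IsConvexPolyhedron K Γ ν) (i : Fin N) :
    pairing (ν i) (normal K (ν i)) = 1 := by
  rw [← metricForm_normal_normal]; exact hν.unit i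

/-- The cone over the intersection of two facets. -/
theorem IsConvexPolyhedron.isConeOver_ridge {k N : ℕ}
    {Γ : Subgroup (Ambient (k + 2) ≃L[ℝ] Ambient (k + 2))} {ν : Fin N → Ambient (k + 2)}
    (hν : IsConvexPolyhedron K Γ ν) {i j : Fin N}
    {T : Ambient k →L[ℝ] Ambient (k + 2)} {S : Ambient (k + 2) →L[ℝ] Ambient k}
    (hST : ∀ z, S (T z) = z) (hiT : ∀ z, pairing (ν i) (T z) = 0)
    (hjT : ∀ z, pairing (ν j) (T z) = 0)
    (hTS : ∀ y, pairing (ν i) y = 0 → pairing (ν j) y = 0 → T (S y) = y)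
    (hc : pairing (ν i) (normal K (ν j)) ^ 2 < 1) :
    IsConeOver K Γ T S (|LinearMap.det (extendByTwo T (normal K (ν i)) (normal K (ν j)))| /
        Real.sqrt (1 - pairing (ν i) (normal K (ν j)) ^ 2))
      {y | y ∈ polyCone ν ∧ pairing (ν i) y = 0 ∧ pairing (ν j) y = 0} where
  left_inv := hST
  κ_nonneg := by positivity
  sqrt_det z L hz hL := by
    refine sqrt_det_gram_codimTwo T (hν.unit i) (hν.unit j) (metricForm_normal_normal ..) hc hz
      (normal_isTangent K _ _ (hiT z)) (normal_isTangent K _ _ (hjT z)) L hL (fun u => ?_)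
      fun u => ?_
    · rw [metricForm_normal K _ _ _ hz (hL u), hiT]
    · rw [metricForm_normal K _ _ _ hz (hL u), hjT]
  closed := by
    have hpc : ∀ l, Continuous fun y : Ambient (k + 2) => pairing (ν l) y := fun l =>
      Continuous.comp (f := fun y : Ambient (k + 2) => (ν l, y)) continuous_pairing (by fun_prop)
    exact (isClosed_polyCone ν).inter ((isClosed_eq (hpc i) continuous_const).inter
      (isClosed_eq (hpc j) continuous_const))
  smul_mem r hr y hy := ⟨smul_mem_polyCone hr.le hy.1, by rw [pairing_smul, hy.2.1, mul_zero],
    by rw [pairing_smul, hy.2.2, mul_zero]⟩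
  right_inv y hy := hTS y hy.2.1 hy.2.2
  quad_pos y hy hy0 := (hν.quad_pos (by omega) hy.1 hy0).1
  fst_pos hK y hy hy0 := (hν.quad_pos (by omega) hy.1 hy0).2 hK
  injOn := hν.embedded.mono fun _ hx => hx.1

/-- If some ray of the cone lies on the hyperplanes `i` and `j` only, then these two facets meet in
a face of codimension two. -/
theorem IsConvexPolyhedron.hasDim_of_forall_neg {k N : ℕ}
    {Γ : Subgroup (Ambient (k + 2) ≃L[ℝ] Ambient (k + 2))} {ν : Fin N → Ambient (k + 2)}
    (hν : IsConvexPolyhedron K Γ ν) {i j : Fin N}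
    {T : Ambient k →L[ℝ] Ambient (k + 2)} {S : Ambient (k + 2) →L[ℝ] Ambient k}
    (hST : ∀ z, S (T z) = z) (hiT : ∀ z, pairing (ν i) (T z) = 0)
    (hjT : ∀ z, pairing (ν j) (T z) = 0)
    (hTS : ∀ y, pairing (ν i) y = 0 → pairing (ν j) y = 0 → T (S y) = y)
    {z₀ : Ambient k} (hz₀ : ∀ l, l ≠ i → l ≠ j → pairing (ν l) (T z₀) < 0) :
    HasDim K (facet K ν i ∩ facet K ν j) k := by
  set M := Submodule.span ℝ
    ((fun x : Model K (k + 2) => (x : Ambient (k + 2))) '' (facet K ν i ∩ facet K ν j)) with hM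
  -- the condition on `z₀` is open, so the rays that satisfy it span the image of `T`
  let O : Set (Ambient k) := ⋂ l, {z | l ≠ i → l ≠ j → pairing (ν l) (T z) < 0}
  have hO : IsOpen O := by
    refine isOpen_iInter_of_finite fun l => ?_
    by_cases hl : l ≠ i ∧ l ≠ j
    · simp only [hl.1, hl.2, ne_eq, not_false_eq_true, forall_const]
      refine isOpen_lt ?_ continuous_const
      exact Continuous.comp (f := fun z => (ν l, T z)) continuous_pairing (by fun_prop)
    · convert isOpen_univ
      refine eq_univ_of_forall fun z h1 h2 => absurd ⟨h1, h2⟩ hl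
  have hOM : O ⊆ (M.comap (T : Ambient k →ₗ[ℝ] Ambient (k + 2)) : Set (Ambient k)) := by
    intro z hz
    change T z ∈ M
    have hmem : T z ∈ polyCone ν := fun l => by
      by_cases hli : l = i
      · rw [hli, hiT]
      by_cases hlj : l = j
      · rw [hlj, hjT]
      exact (mem_iInter.1 hz l hli hlj).le
    by_cases h0 : T z = 0
    · rw [h0]; exact M.zero_mem
    obtain ⟨h1, h2⟩ := hν.quad_pos (by omega) hmem h0
    have hs := Real.sqrt_pos.2 h1
    have hx := smul_mem_polyCone (inv_pos.2 hs).le hmem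
    have h3 : (Real.sqrt (quad K (T z)))⁻¹ • T z ∈ M :=
      Submodule.subset_span ⟨⟨_, normalize_mem_modelSet h1 h2⟩,
        ⟨⟨hx, by rw [pairing_smul, hiT, mul_zero]⟩, ⟨hx, by rw [pairing_smul, hjT, mul_zero]⟩⟩, rfl⟩
    exact (M.smul_mem_iff (inv_pos.2 hs).ne').1 h3
  have htop : M.comap (T : Ambient k →ₗ[ℝ] Ambient (k + 2)) = ⊤ :=
    Submodule.eq_top_of_nonempty_interior' _
      ⟨z₀, interior_maximal hOM hO (mem_iInter.2 hz₀)⟩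
  have hMT : M = LinearMap.range (T : Ambient k →ₗ[ℝ] Ambient (k + 2)) := by
    refine le_antisymm (Submodule.span_le.2 ?_) ?_
    · rintro _ ⟨x, hx, rfl⟩
      exact ⟨S x, hTS _ hx.1.2 hx.2.2⟩
    · rintro _ ⟨z, rfl⟩
      have : z ∈ M.comap (T : Ambient k →ₗ[ℝ] Ambient (k + 2)) := by rw [htop]; trivial
      exact this
  change Module.finrank ℝ M = k + 1
  rw [hMT, LinearMap.finrank_range_of_inj (f := (T : Ambient k →ₗ[ℝ] Ambient (k + 2)))
    (fun z w h => by rw [← hST z, ← hST w]; exact congrArg S h)]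
  simp only [Module.finrank_prod, Module.finrank_self, finrank_euclideanSpace, Fintype.card_fin]
  omega

/-- At a face of codimension two, the outward normals of the two facets are independent. -/
theorem IsConvexPolyhedron.pairing_normal_sq_lt_one {n N d : ℕ}
    {Γ : Subgroup (Ambient n ≃L[ℝ] Ambient n)} {ν : Fin N → Ambient n}
    (hν : IsConvexPolyhedron K Γ ν) {i j : Fin N} (hij : i ≠ j)
    (hdim : HasDim K (facet K ν i ∩ facet K ν j) d) :
    pairing (ν i) (normal K (ν j)) ^ 2 < 1 := by
  have hne : (facet K ν i ∩ facet K ν j).Nonempty := by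
    by_contra h
    rw [not_nonempty_iff_eq_empty] at h
    rw [HasDim, h, image_empty, Submodule.span_empty, finrank_bot] at hdim
    omega
  obtain ⟨x, hxi, hxj⟩ := hne
  exact metricForm_normal_sq_lt_one x.2 hxi.2 hxj.2 (hν.pairing_normal_self i)
    (hν.pairing_normal_self j) (hν.ne_smul hij)

/-- A third hyperplane does not contain the intersection of the hyperplanes `i` and `j`. -/
theorem exists_pairing_ne_zero {k N : ℕ} {Γ : Subgroup (Ambient (k + 2) ≃L[ℝ] Ambient (k + 2))}
    {ν : Fin N → Ambient (k + 2)} (hν : IsConvexPolyhedron K Γ ν) {i j : Fin N} (hij : i ≠ j)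
    {T : Ambient k →L[ℝ] Ambient (k + 2)} {S : Ambient (k + 2) →L[ℝ] Ambient k}
    (hTS : ∀ y, pairing (ν i) y = 0 → pairing (ν j) y = 0 → T (S y) = y) (l : Fin N) (hli : l ≠ i)
    (hlj : l ≠ j) : ∃ z, pairing (ν l) (T z) ≠ 0 := by
  obtain ⟨e, h1, h2, h3⟩ := exists_pairing_eq₂ (hν.ne_smul hij)
    (hν.ne_smul_add_smul hij hli.symm hlj.symm)
  exact ⟨S e, by rw [hTS e h1 h2, h3]; exact one_ne_zero⟩

/-- At a face of codimension two, the smoothed integrals converge to the volume of the face, divided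
by the sine of the dihedral angle. -/
theorem IsConvexPolyhedron.tendsto_integral_faceDensity_of_hasDim {k N : ℕ}
    {Γ : Subgroup (Ambient (k + 2) ≃L[ℝ] Ambient (k + 2))} (hΓ : IsSpaceFormGroup K Γ)
    {ν : Fin N → Ambient (k + 2)} (hν : IsConvexPolyhedron K Γ ν) {c : ℝ} (hc : 0 < c)
    (h : ∀ y ∈ polyCone ν, c * ‖y‖ ^ 2 ≤ quad K y) {i j : Fin N} (hij : i ≠ j)
    (hdim : HasDim K (facet K ν i ∩ facet K ν j) k) :
    riemannianVolume K Γ k (ridge K Γ ν i j) ≠ ⊤ ∧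
    Tendsto (fun ε => ∫ y, weight (quad K y) * faceDensity {i, j} ε ν y) (𝓝[>] 0)
      (𝓝 ((riemannianVolume K Γ k (ridge K Γ ν i j)).toReal *
        (∫ r in Ioi (0 : ℝ), r ^ k * weight (r ^ 2)) /
          Real.sqrt (1 - pairing (ν i) (normal K (ν j)) ^ 2))) := by
  obtain ⟨T, S, hST, hiT, hjT, hTS⟩ := exists_coordinates_inter (hν.ne_smul hij)
    (hν.ne_smul hij.symm)
  have hcos := hν.pairing_normal_sq_lt_one hij hdim
  have hcone := hν.isConeOver_ridge hST hiT hjT hTS hcos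
  set C := pairing (ν i) (normal K (ν j)) with hC
  have hii := hν.pairing_normal_self i
  have hjj := hν.pairing_normal_self j
  have hji : pairing (ν j) (normal K (ν i)) = C := pairing_normal_comm ..
  have hsub : (1 - C ^ 2) ≠ 0 := by linarith
  -- the basis of the normal plane that is dual to the two conormals
  set p := (1 - C ^ 2)⁻¹ • (normal K (ν i) + (-C) • normal K (ν j)) with hp
  set r := (1 - C ^ 2)⁻¹ • (normal K (ν j) + (-C) • normal K (ν i)) with hr
  have hip : pairing (ν i) p = 1 := by
    rw [hp, pairing_smul, pairing_add, pairing_smul, hii, ← hC]; field_simp; ring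
  have hir : pairing (ν i) r = 0 := by
    rw [hr, pairing_smul, pairing_add, pairing_smul, hii, ← hC]; ring
  have hjp : pairing (ν j) p = 0 := by
    rw [hp, pairing_smul, pairing_add, pairing_smul, hjj, hji]; ring
  have hjr : pairing (ν j) r = 1 := by
    rw [hr, pairing_smul, pairing_add, pairing_smul, hjj, hji]; field_simp; ring
  have hlim := tendsto_integral_faceDensity_pair hc h hij hST hiT hjT hip hir hjp hjr
    (exists_pairing_ne_zero hν hij hTS)
  obtain ⟨hfin, hvol⟩ := hcone.toReal_riemannianVolume_mul hΓ hc (fun y hy => h y hy.1)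
    continuous_weight weight_nonneg (fun _ => weight_support) (integral_radial_weight_pos k)
  have hset : facet K ν i ∩ facet K ν j = {x : Model K (k + 2) | (x : Ambient (k + 2)) ∈
      {y | y ∈ polyCone ν ∧ pairing (ν i) y = 0 ∧ pairing (ν j) y = 0}} := by
    ext x
    exact ⟨fun hx => ⟨hx.1.1, hx.1.2, hx.2.2⟩, fun hx => ⟨⟨hx.1, hx.2.1⟩, ⟨hx.1, hx.2.2⟩⟩⟩
  have hpre : T ⁻¹' {y | y ∈ polyCone ν ∧ pairing (ν i) y = 0 ∧ pairing (ν j) y = 0} =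
      T ⁻¹' polyCone ν := by
    ext z
    exact ⟨fun hz => hz.1, fun hz => ⟨hz, hiT z, hjT z⟩⟩
  rw [← hset] at hfin hvol
  refine ⟨hfin, ?_⟩
  convert hlim using 2
  change (riemannianVolume K Γ k (proj K Γ '' (facet K ν i ∩ facet K ν j))).toReal * _ / _ = _
  rw [hvol, hpre]
  have hni : normal K (ν i) = (1 : ℝ) • p + C • r := by
    rw [hp, hr]; match_scalars <;> field_simp <;> ring
  have hnj : normal K (ν j) = C • p + (1 : ℝ) • r := by
    rw [hp, hr]; match_scalars <;> field_simp <;> ring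
  have hpos : 0 < 1 - C ^ 2 := by linarith
  have hs := Real.sqrt_pos.2 hpos
  rw [hni, hnj, det_extendByTwo_comb, abs_mul, show |(1 : ℝ) * 1 - C * C| = 1 - C ^ 2 by
    rw [show (1 : ℝ) * 1 - C * C = 1 - C ^ 2 by ring, abs_of_pos hpos]]
  nth_rewrite 1 [← Real.sq_sqrt hpos.le]
  field_simp

/-- If two facets do not meet in a face of codimension two, the smoothed integrals tend to zero. -/
theorem IsConvexPolyhedron.tendsto_integral_faceDensity_of_not_hasDim {k N : ℕ}
    {Γ : Subgroup (Ambient (k + 2) ≃L[ℝ] Ambient (k + 2))}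
    {ν : Fin N → Ambient (k + 2)} (hν : IsConvexPolyhedron K Γ ν) {c : ℝ} (hc : 0 < c)
    (h : ∀ y ∈ polyCone ν, c * ‖y‖ ^ 2 ≤ quad K y) {i j : Fin N} (hij : i ≠ j)
    (hdim : ¬ HasDim K (facet K ν i ∩ facet K ν j) k) :
    Tendsto (fun ε => ∫ y, weight (quad K y) * faceDensity {i, j} ε ν y) (𝓝[>] 0) (𝓝 0) := by
  obtain ⟨T, S, hST, hiT, hjT, hTS⟩ := exists_coordinates_inter (hν.ne_smul hij)
    (hν.ne_smul hij.symm)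
  obtain ⟨p, hjp, hip⟩ := exists_pairing_eq (hν.ne_smul hij.symm)
  obtain ⟨r, hir, hjr⟩ := exists_pairing_eq (hν.ne_smul hij)
  have hne := exists_pairing_ne_zero hν hij hTS
  have hlim := tendsto_integral_faceDensity_pair hc h hij hST hiT hjT hip hir hjp hjr hne
  have hae : ∀ᵐ z : Ambient k, z ∉ T ⁻¹' polyCone ν := by
    have h1 : ∀ᵐ z : Ambient k, ∀ l, l ≠ i → l ≠ j → pairing (ν l) (T z) ≠ 0 :=
      ae_pairing_comp_ne_zero hne
    filter_upwards [h1] with z hz hmem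
    exact hdim (hν.hasDim_of_forall_neg hST hiT hjT hTS (z₀ := z) fun l hli hlj =>
      lt_of_le_of_ne (hmem l) (hz l hli hlj))
  have h0 : ∫ z in T ⁻¹' polyCone ν, weight (quad K (T z)) = 0 :=
    setIntegral_measure_zero _ (by
      have h1 := ae_iff.1 hae
      simp only [not_not] at h1
      exact h1)
  rwa [h0, mul_zero] at hlim

/-! ### The variation of the volume and of the dihedral angles -/

/-- The volume of the polyhedron is a constant multiple of `coneVol`. -/
theorem IsConvexPolyhedron.toReal_riemannianVolume_body_mul {k N : ℕ}
    {Γ : Subgroup (Ambient (k + 2) ≃L[ℝ] Ambient (k + 2))} (hΓ : IsSpaceFormGroup K Γ)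
    {ν : Fin N → Ambient (k + 2)} (hν : IsConvexPolyhedron K Γ ν) :
    riemannianVolume K Γ (k + 2) (body K Γ ν) ≠ ⊤ ∧
    (riemannianVolume K Γ (k + 2) (body K Γ ν)).toReal *
      ((k + 1) * ∫ r in Ioi (0 : ℝ), r ^ k * weight (r ^ 2)) = coneVol K ν := by
  obtain ⟨c, hc, h⟩ := eventually_quad_ge fun y hy hy0 => (hν.quad_pos (by omega) hy hy0).1
  have hpos : 0 < ∫ r in Ioi (0 : ℝ), r ^ (k + 2) * weightD (r ^ 2) := by
    rw [integral_radial_weightD]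
    exact mul_pos (by positivity) (integral_radial_weight_pos k)
  have := (hν.isConeOver_polyCone (by omega)).toReal_riemannianVolume_mul hΓ hc h.self_of_nhds
    continuous_weightD weightD_nonneg (fun _ => weightD_support) hpos
  rw [integral_radial_weightD, one_mul] at this
  exact this

theorem mem_codimTwoFaces {k N : ℕ} {ν : Fin N → Ambient (k + 2)} {p : Fin N × Fin N} :
    p ∈ codimTwoFaces K ν ↔ p.1 < p.2 ∧ HasDim K (facet K ν p.1 ∩ facet K ν p.2) k := by
  simp only [codimTwoFaces, Finset.mem_filter, Finset.mem_univ, true_and, Nat.add_right_cancel_iff,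
    exists_eq_left]

theorem hasDerivWithinAt_pairing_normal {n : ℕ} {f g : ℝ → Ambient n} {f' g' : Ambient n}
    {I : Set ℝ} {t : ℝ} (hf : HasDerivWithinAt f f' I t) (hg : HasDerivWithinAt g g' I t) :
    HasDerivWithinAt (fun s => pairing (f s) (normal K (g s)))
      (pairing (g t) (normal K f') + pairing (f t) (normal K g')) I t := by
  have hf1 := hf.hasFDerivWithinAt.fst.hasDerivWithinAt
  have hf2 := hf.hasFDerivWithinAt.snd.hasDerivWithinAt
  have hg1 := hg.hasFDerivWithinAt.fst.hasDerivWithinAt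
  have hg2 := hg.hasFDerivWithinAt.snd.hasDerivWithinAt
  refine ((hf1.mul (hg1.const_mul K)).add (hf2.inner ℝ hg2)).congr_deriv ?_
  simp [pairing, normal, real_inner_comm]
  ring

theorem hasDerivWithinAt_dihedralAngle {n N : ℕ} {ν : ℝ → Fin N → Ambient n} {δ : Fin N → Ambient n}
    {I : Set ℝ} {t : ℝ} (hδ : ∀ i, HasDerivWithinAt (fun s => ν s i) (δ i) I t) {i j : Fin N}
    (hc : pairing (ν t i) (normal K (ν t j)) ^ 2 < 1) :
    HasDerivWithinAt (fun s => dihedralAngle K (ν s) i j)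
      ((pairing (ν t j) (normal K (δ i)) + pairing (ν t i) (normal K (δ j))) /
        Real.sqrt (1 - pairing (ν t i) (normal K (ν t j)) ^ 2)) I t := by
  simp only [dihedralAngle, metricForm_normal_normal]
  obtain ⟨h1, h2⟩ := abs_lt.1 ((sq_lt_one_iff_abs_lt_one _).1 hc)
  have h := ((Real.hasDerivAt_arccos h1.ne' h2.ne).comp_hasDerivWithinAt t
    (hasDerivWithinAt_pairing_normal (K := K) (hδ i) (hδ j))).const_sub Real.pi
  refine h.congr_deriv ?_
  ring

theorem sum_sum_compl_eq {N : ℕ} (g : Fin N → Fin N → ℝ) :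
    ∑ i, ∑ j ∈ {i}ᶜ, g i j =
      ∑ p : Fin N × Fin N, if p.1 < p.2 then g p.1 p.2 + g p.2 p.1 else 0 := by
  have h1 : ∀ i, ∑ j ∈ {i}ᶜ, g i j =
      ∑ j, ((if i < j then g i j else 0) + if j < i then g i j else 0) := by
    intro i
    refine Eq.trans (Finset.sum_congr rfl fun j hj => ?_)
      (Finset.sum_subset (Finset.subset_univ {i}ᶜ) fun j _ hj => ?_)
    · simp only [Finset.mem_compl, Finset.mem_singleton] at hj
      rcases lt_or_gt_of_ne hj with h | h <;> simp [h, h.not_gt]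
    · simp only [Finset.mem_compl, Finset.mem_singleton, not_not] at hj
      simp [hj]
  simp only [h1, Finset.sum_add_distrib]
  rw [Finset.sum_comm (f := fun i j => if j < i then g i j else 0), Fintype.sum_prod_type,
    ← Finset.sum_add_distrib]
  refine Finset.sum_congr rfl fun i _ => ?_
  rw [← Finset.sum_add_distrib]
  refine Finset.sum_congr rfl fun j _ => ?_
  split_ifs <;> simp

/-- The first variation of the volume of the cone, as a sum over the faces of codimension two. -/
theorem IsConvexPolyhedron.exists_hasFDerivAt_coneVol {k N : ℕ}
    {Γ : Subgroup (Ambient (k + 2) ≃L[ℝ] Ambient (k + 2))} (hΓ : IsSpaceFormGroup K Γ)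
    {ν : Fin N → Ambient (k + 2)} (hν : IsConvexPolyhedron K Γ ν) :
    ∃ D : (Fin N → Ambient (k + 2)) →L[ℝ] ℝ, HasFDerivAt (coneVol K) D ν ∧
      ∀ δ : Fin N → Ambient (k + 2), (∀ i, pairing (ν i) (normal K (δ i)) = 0) →
        K * D δ = (∫ r in Ioi (0 : ℝ), r ^ k * weight (r ^ 2)) * ∑ p ∈ codimTwoFaces K ν,
          (riemannianVolume K Γ k (ridge K Γ ν p.1 p.2)).toReal *
            ((pairing (ν p.2) (normal K (δ p.1)) + pairing (ν p.1) (normal K (δ p.2))) /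
              Real.sqrt (1 - pairing (ν p.1) (normal K (ν p.2)) ^ 2)) := by
  classical
  obtain ⟨c, hc, h⟩ := eventually_quad_ge fun y hy hy0 => (hν.quad_pos (by omega) hy hy0).1
  have hν0 : ∀ i, ν i ≠ 0 := fun i h0 => by
    have := hν.pairing_normal_self i
    rw [h0] at this
    simp [pairing] at this
  obtain ⟨D, hD, hlim⟩ := SpaceForms.exists_hasFDerivAt_coneVol hc h hν0
    fun i j hji s => hν.ne_smul hji.symm s
  refine ⟨D, hD, fun δ hδ => ?_⟩
  set c₂ := ∫ r in Ioi (0 : ℝ), r ^ k * weight (r ^ 2) with hc₂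
  -- the limits of the smoothed integrals
  let A : Fin N → Fin N → ℝ := fun i j =>
    if HasDim K (facet K ν i ∩ facet K ν j) k then
      (riemannianVolume K Γ k (ridge K Γ ν i j)).toReal * c₂ /
        Real.sqrt (1 - pairing (ν i) (normal K (ν j)) ^ 2) else 0
  have hA : ∀ i j, i ≠ j →
      Tendsto (fun ε => ∫ y, weight (quad K y) * faceDensity {i, j} ε ν y) (𝓝[>] 0)
        (𝓝 (A i j)) := by
    intro i j hij
    by_cases hdim : HasDim K (facet K ν i ∩ facet K ν j) k
    · simp only [A, if_pos hdim]
      exact (hν.tendsto_integral_faceDensity_of_hasDim hΓ hc h.self_of_nhds hij hdim).2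
    · simp only [A, if_neg hdim]
      exact hν.tendsto_integral_faceDensity_of_not_hasDim hc h.self_of_nhds hij hdim
  have hsymm : ∀ i j, A i j = A j i := fun i j => by
    simp only [A, ridge, inter_comm (facet K ν i), pairing_normal_comm K (ν i) (ν j)]
  have h1 : Tendsto (fun ε => K * (∑ i, ∫ y, smoothVolDeriv K ε i ν y) δ) (𝓝[>] 0)
      (𝓝 (K * D δ)) :=
    (((ContinuousLinearMap.apply ℝ ℝ δ).continuous.tendsto D).comp hlim).const_mul K
  have h2 : Tendsto (fun ε => K * (∑ i, ∫ y, smoothVolDeriv K ε i ν y) δ) (𝓝[>] 0)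
      (𝓝 (∑ i, ∑ j ∈ {i}ᶜ, pairing (ν j) (normal K (δ i)) * A i j)) := by
    refine Tendsto.congr' (f₁ := fun ε => ∑ i, ∑ j ∈ {i}ᶜ, pairing (ν j) (normal K (δ i)) *
        ∫ y, weight (quad K y) * faceDensity {i, j} ε ν y) ?_
      (tendsto_finsetSum _ fun i _ => tendsto_finsetSum _ fun j hj => (hA i j ?_).const_mul _)
    · filter_upwards [self_mem_nhdsWithin] with ε hε
      exact (mul_sum_integral_smoothVolDeriv hc h.self_of_nhds hδ hε).symm
    · simp only [Finset.mem_compl, Finset.mem_singleton] at hj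
      exact fun h => hj h.symm
  rw [tendsto_nhds_unique h1 h2, sum_sum_compl_eq, Finset.mul_sum,
    ← Finset.sum_filter_add_sum_filter_not Finset.univ fun p => p ∈ codimTwoFaces K ν,
    Finset.filter_mem_eq_inter, Finset.univ_inter, Finset.sum_eq_zero (s := Finset.filter _ _),
    add_zero]
  · refine Finset.sum_congr rfl fun p hp => ?_
    obtain ⟨hlt, hdim⟩ := mem_codimTwoFaces.1 hp
    rw [if_pos hlt, hsymm p.2 p.1]
    simp only [A, if_pos hdim]
    ring
  · intro p hp
    simp only [Finset.mem_filter, Finset.mem_univ, true_and, mem_codimTwoFaces, not_and] at hp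
    split_ifs with hlt
    · rw [hsymm p.2 p.1]
      simp only [A, if_neg (hp hlt), mul_zero, add_zero]
    · rfl

/-- The Schläfli formula, with the constant in terms of the sectional curvature. -/
theorem IsDeformation.schlaefli {k N : ℕ}
    {Γ : Subgroup (Ambient (k + 2) ≃L[ℝ] Ambient (k + 2))} (hΓ : IsSpaceFormGroup K Γ) {I : Set ℝ}
    (hI : I.OrdConnected) (hI' : I.Nontrivial) {ν : ℝ → Fin N → Ambient (k + 2)}
    (hν : IsDeformation K Γ I ν) {t : ℝ} (ht : t ∈ I) :
    ∃ (V' : ℝ) (θ' : Fin N × Fin N → ℝ),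
      HasDerivWithinAt (fun s => (riemannianVolume K Γ (k + 2) (body K Γ (ν s))).toReal) V' I t ∧
      (∀ p ∈ codimTwoFaces K (ν t),
        HasDerivWithinAt (fun s => dihedralAngle K (ν s) p.1 p.2) (θ' p) I t) ∧
      (k + 1) * K * V' = ∑ p ∈ codimTwoFaces K (ν t),
        (riemannianVolume K Γ k (ridge K Γ (ν t) p.1 p.2)).toReal * θ' p := by
  have hP := hν.isConvexPolyhedron t ht
  set c₂ := ∫ r in Ioi (0 : ℝ), r ^ k * weight (r ^ 2) with hc₂
  have hc₂0 : 0 < c₂ := integral_radial_weight_pos k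
  have hk : (0 : ℝ) < (k : ℝ) + 1 := by positivity
  set δ : Fin N → Ambient (k + 2) := fun i => derivWithin (fun s => ν s i) I t
  have hδ : ∀ i, HasDerivWithinAt (fun s => ν s i) (δ i) I t := fun i =>
    ((hν.contDiffOn i).differentiableOn (by norm_num) t ht).hasDerivWithinAt
  have huniq : UniqueDiffWithinAt ℝ I t :=
    uniqueDiffWithinAt_convex hI.convex (hI.convex.nontrivial_iff_nonempty_interior.1 hI')
      (subset_closure ht)
  -- differentiate the normalization of the conormals
  have hδ0 : ∀ i, pairing (ν t i) (normal K (δ i)) = 0 := by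
    intro i
    have h1 := hasDerivWithinAt_pairing_normal (K := K) (hδ i) (hδ i)
    have h2 : HasDerivWithinAt (fun s => pairing (ν s i) (normal K (ν s i))) 0 I t :=
      (hasDerivWithinAt_const t I (1 : ℝ)).congr
        (fun s hs => (hν.isConvexPolyhedron s hs).pairing_normal_self i)
        (hP.pairing_normal_self i)
    have := huniq.eq_deriv _ h1 h2
    linarith
  obtain ⟨D, hD, hDδ⟩ := hP.exists_hasFDerivAt_coneVol hΓ
  refine ⟨D δ / ((k + 1) * c₂), fun p =>
    (pairing (ν t p.2) (normal K (δ p.1)) + pairing (ν t p.1) (normal K (δ p.2))) /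
      Real.sqrt (1 - pairing (ν t p.1) (normal K (ν t p.2)) ^ 2), ?_, fun p hp => ?_, ?_⟩
  · have hV : ∀ s ∈ I, (riemannianVolume K Γ (k + 2) (body K Γ (ν s))).toReal =
        coneVol K (ν s) / ((k + 1) * c₂) := fun s hs => by
      rw [eq_div_iff (by positivity)]
      exact ((hν.isConvexPolyhedron s hs).toReal_riemannianVolume_body_mul hΓ).2
    exact ((hD.comp_hasDerivWithinAt t (hasDerivWithinAt_pi.2 hδ)).div_const _).congr hV (hV t ht)
  · obtain ⟨hlt, hdim⟩ := mem_codimTwoFaces.1 hp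
    exact hasDerivWithinAt_dihedralAngle hδ (hP.pairing_normal_sq_lt_one hlt.ne hdim)
  · have h := hDδ δ hδ0
    rw [← hc₂] at h
    rw [← mul_right_inj' hc₂0.ne', ← h]
    field_simp

end

end SpaceForms

end

theorem mainTheorem3 (m : ℕ) (hm : 2 ≤ m) (K S : ℝ)
    (hS : SpaceForms.HasScalarCurvature K (m + 1) S)
    (Γ : Subgroup (SpaceForms.Ambient (m + 1) ≃L[ℝ] SpaceForms.Ambient (m + 1)))
    (hΓ : SpaceForms.IsSpaceFormGroup K Γ)
    (N : ℕ) (I : Set ℝ) (hI : I.OrdConnected) (hI' : I.Nontrivial)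
    (ν : ℝ → Fin N → SpaceForms.Ambient (m + 1)) (hν : SpaceForms.IsDeformation K Γ I ν)
    (t : ℝ) (ht : t ∈ I) :
    (∀ s ∈ I, SpaceForms.riemannianVolume K Γ (m + 1) (SpaceForms.body K Γ (ν s)) ≠ ⊤) ∧
    (∀ p ∈ SpaceForms.codimTwoFaces K (ν t),
      SpaceForms.riemannianVolume K Γ (m - 1) (SpaceForms.ridge K Γ (ν t) p.1 p.2) ≠ ⊤) ∧
    ∃ (V' : ℝ) (θ' : Fin N × Fin N → ℝ),
      HasDerivWithinAt
        (fun s => (SpaceForms.riemannianVolume K Γ (m + 1) (SpaceForms.body K Γ (ν s))).toReal)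
        V' I t ∧
      (∀ p ∈ SpaceForms.codimTwoFaces K (ν t),
        HasDerivWithinAt (fun s => SpaceForms.dihedralAngle K (ν s) p.1 p.2) (θ' p) I t) ∧
      S / (m + 1) * V' =
        ∑ p ∈ SpaceForms.codimTwoFaces K (ν t),
          (SpaceForms.riemannianVolume K Γ (m - 1)
            (SpaceForms.ridge K Γ (ν t) p.1 p.2)).toReal * θ' p := by
  obtain ⟨k, rfl⟩ : ∃ k, m = k + 1 := ⟨m - 1, by omega⟩
  have hP := hν.isConvexPolyhedron
  refine ⟨fun s hs => ((hP s hs).toReal_riemannianVolume_body_mul hΓ).1, fun p hp => ?_, ?_⟩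
  · obtain ⟨hlt, hdim⟩ := SpaceForms.mem_codimTwoFaces.1 hp
    obtain ⟨c, hc, h⟩ := SpaceForms.eventually_quad_ge fun y hy hy0 =>
      ((hP t ht).quad_pos (by omega) hy hy0).1
    exact ((hP t ht).tendsto_integral_faceDensity_of_hasDim hΓ hc h.self_of_nhds hlt.ne hdim).1
  · obtain ⟨V', θ', hV, hθ, h⟩ := hν.schlaefli hΓ hI hI' ht
    refine ⟨V', θ', hV, hθ, Eq.trans ?_ h⟩
    rw [hS.eq]
    push_cast
    field_simp
    ring
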